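/- Let $S$ be an associative unital ring. An $S$-ring is a ring $T$ with a ring homomorphism $S\to T$; it is an $S$-bimodule in the obvious way. Let $A=\bigoplus_{n\ge 0}A^n$ be a graded $S$-ring which is connected (the homomorphism $S\to A$ is an isomorphism onto $A^0$) and strongly graded ($A^nA^m=A^{n+m}$ for all $n,m\ge 0$). **Notation.** Let $T=T_A:=T_S(A^1)$ be the tensor $S$-ring of the $S$-bimodule $A^1$, with its grading $T=\bigoplus_n T^n$, $T^n=(A^1)^{\otimes_S n}$, its projections $p^n:T\to T^n$ and its filtration $T^{\le n}=T^0\oplus\dots\oplus T^n$. Let $I_A$ be the kernel of the canonical morphism $\pi_A:T_A\to A$ which is the identity on $S$ and on $A^1$. For $X\subseteq T$ let $\langle X\rangle$ be the two-sided ideal generated by $X$. * A *bimodule of relations* for $A$ is a graded $S$-subbimodule $R\subseteq T_A$ such that $I_A=R\oplus(I_AT^1+T^1I_A)$. Then $A$ is identified, through $\pi_A$, with $A(R):=T/\langle R\rangle$. * For an $S$-subbimodule $P\subseteq T$ let $U(P):=T/\langle P\rangle$, filtered by the images of the $T^{\le n}$, with associated graded ring $\operatorname{gr}U(P)$, and let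 $R_P=\bigoplus_n R_P^n$ be the graded subbimodule of $T$ with $R_P^n=p^n(P\cap T^{\le n})$. If $R\subseteq R_P$ is a graded subbimodule, there is a morphism of graded rings $\Phi_{P,R}:A(R)\to\operatorname{gr}U(P)$ sending the class of $x\in T^n$ to the class of $x+\langle P\rangle$ in $\operatorname{gr}^nU(P)$; $U(P)$ is called a *PBW-deformation* of $A(R)$ if $\Phi_{P,R}$ is an isomorphism. * A *filtered map* $\alpha:R\to T$ is here a morphism of $S$-bimodules such that $\alpha(r)\in T^{\le n}$ and $p^n(\alpha(r))=r$ for all $n$ and all $r\in R^n$ (that is, $\alpha(r)-r\in T^{\le n-1}$). * For an $S$-subbimodule $Q\subseteq T$ let $Q_n:=\sum_{i+j+k=n}T^{\le i}\,(Q\cap T^{\le j})\,T^{\le k}$. One says that $Q$ satisfies the *Jacobi condition* $(J_n)$ if $Q_{n+1}\cap T^{\le n}\subseteq Q_n$. * Let $\operatorname{Tor}^A_{3,n}(S,S)$ be the component of internal degree $n$ of $\operatorname{Tor}^A_3(S,S)$, where $S=A/\bigoplus_{n>0}A^n$. The *homological complexity* of $A$ is $c(A):=-1$ if $\operatorname{Tor}^A_3(S,S)=0$,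 and $c(A):=\sup\{n-1\mid \operatorname{Tor}^A_{3,n}(S,S)\ne 0\}\in\mathbb N\cup\{\infty\}$ otherwise. **Theorem.** Let $A$ be a strongly graded connected $S$-ring which has a bimodule of relations $R\subseteq T_A$, and let $P$ be an $S$-subbimodule of $T_A$ such that $R\subseteq R_P$. Assume that $R$ and $A^1$ are projective as left $S$-modules and that $R_P$ is a projective $S$-bimodule (that is, a projective module over $S\otimes_{\mathbb Z}S^{op}$). Then $U(P)$ is a PBW-deformation of $A$ (that is, of $A(R)\cong A$) if and only if 1. $\langle R\rangle=\langle R_P\rangle$, and 2. there is a filtered map $\alpha:R\to T_A$ such that $\alpha(R)\subseteq P\subseteq\langle\alpha(R)\rangle$ and such that either $c(A)=-1$, or $\alpha(R)$ satisfies the Jacobi condition $(J_k)$ for every integer $k$ with $1\le k\le c(A)$ (for every $k\ge 1$ if $c(A)=\infty$). -/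

import Mathlib

open scoped TensorProduct DirectSum
open MulOpposite (op)

universe u v

namespace PBW

/-! ### Bimodules and `S`-rings -/

/-- The enveloping ring `Sᵉ = S ⊗ Sᵒᵖ`. An `S`-bimodule is a module over it. -/
def Env (S : Type*) [Ring S] : Type _ := S ⊗[ℤ] Sᵐᵒᵖ

instance (S : Type*) [Ring S] : Ring (Env S) := inferInstanceAs (Ring (S ⊗[ℤ] Sᵐᵒᵖ))

/-- The element `s ⊗ t` of the enveloping ring. -/
def Env.tmul {S : Type*} [Ring S] (s t : S) : Env S := (s ⊗ₜ[ℤ] op t : S ⊗[ℤ] Sᵐᵒᵖ)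

theorem Env.induction {S : Type*} [Ring S] {p : Env S → Prop} (e : Env S) (zero : p 0)
    (tmul : ∀ s t, p (Env.tmul s t)) (add : ∀ a b, p a → p b → p (a + b)) : p e :=
  TensorProduct.induction_on (motive := p) e zero (fun s t => tmul s t.unop) add

/-- The ring homomorphism `S → Sᵉ`, `s ↦ s ⊗ 1`. -/
def Env.includeLeft (S : Type*) [Ring S] : S →+* Env S :=
  (Algebra.TensorProduct.includeLeftRingHom : S →+* S ⊗[ℤ] Sᵐᵒᵖ)

/-- An `S`-bimodule is left projective if it is projective as a left `S`-module,
for the action `s • v = (s ⊗ 1) • v`. -/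
def LeftProjective (S V : Type*) [Ring S] [AddCommGroup V] [Module (Env S) V] : Prop :=
  letI : Module S V :=
    Module.compHom V (Env.includeLeft S)
  Module.Projective S V

/-- An `S`-ring: a ring `T` with a ring homomorphism `S → T`. -/
class SRing (S T : Type*) [Ring S] [Ring T] where
  unit : S →+* T

/-- The two-sided action of `S` on an `S`-ring. -/
def envAction (S T : Type*) [Ring S] [Ring T] [SRing S T] : Env S →+* Module.End ℤ T :=
  (Algebra.TensorProduct.lift
    ((Algebra.lmul ℤ T).comp (SRing.unit (S := S) (T := T)).toIntAlgHom)
    ((Module.toModuleEnd ℤ (S := Tᵐᵒᵖ) T).comp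
      (RingHom.op (SRing.unit (S := S) (T := T)))).toIntAlgHom
    (fun s t => LinearMap.ext fun x => by
      show SRing.unit s * (x * SRing.unit t.unop) = SRing.unit s * x * SRing.unit t.unop
      rw [mul_assoc]) : S ⊗[ℤ] Sᵐᵒᵖ →ₐ[ℤ] Module.End ℤ T).toRingHom

/-- An `S`-ring is an `S`-bimodule, with `(s ⊗ t) • x = s x t`; see `env_smul_def`. -/
instance SRing.bimodule (S T : Type*) [Ring S] [Ring T] [SRing S T] : Module (Env S) T :=
  Module.compHom T (envAction S T)

theorem env_smul_def {S T : Type*} [Ring S] [Ring T] [SRing S T] (s t : S) (x : T) :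
    Env.tmul s t • x = SRing.unit s * x * SRing.unit t := by
  show (envAction S T (Env.tmul s t)) x = _
  show SRing.unit s * (x * SRing.unit t) = _
  rw [mul_assoc]

/-- A subbimodule of an `S`-ring. -/
abbrev Subbimodule (S T : Type*) [Ring S] [Ring T] [SRing S T] := Submodule (Env S) T

/-- The additive subgroup underlying a subbimodule, as a `ℤ`-submodule of the ring; sums and
products of such subgroups are those of `Submodule ℤ T`. -/
def Subbimodule.toZ {S T : Type*} [Ring S] [Ring T] [SRing S T] (X : Subbimodule S T) :
    Submodule ℤ T :=
  AddSubgroup.toIntSubmodule X.toAddSubgroup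

/-- A connected graded `S`-ring: a ring graded by subbimodules such that `S → T` identifies `S`
with the component of degree `0`. -/
class IsConnected {S T : Type*} [Ring S] [Ring T] [SRing S T]
    (𝒯 : ℕ → Subbimodule S T) [GradedRing 𝒯] : Prop where
  unit_injective : Function.Injective (SRing.unit (S := S) (T := T))
  mem_zero_iff : ∀ x : T, x ∈ 𝒯 0 ↔ ∃ s : S, SRing.unit s = x

/-- A graded `S`-ring is strongly graded if `T^n T^m = T^{n+m}` for all `n` and `m`. -/
def IsStronglyGraded {S T : Type*} [Ring S] [Ring T] [SRing S T]
    (𝒯 : ℕ → Subbimodule S T) : Prop :=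
  ∀ n m, (𝒯 n).toZ * (𝒯 m).toZ = (𝒯 (n + m)).toZ

/-! ### The tensor `S`-ring of a bimodule -/

section TensorRing

variable (S V : Type*) [Ring S] [AddCommGroup V] [Module (Env S) V]

/-- The defining relations of the tensor `S`-ring of `V`, between words in the letters `s ∈ S` and
`v ∈ V`. -/
inductive TensorRel : FreeAlgebra ℤ (S ⊕ V) → FreeAlgebra ℤ (S ⊕ V) → Prop
  | one : TensorRel (FreeAlgebra.ι ℤ (Sum.inl 1)) 1
  | add (s t : S) : TensorRel (FreeAlgebra.ι ℤ (Sum.inl (s + t)))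
      (FreeAlgebra.ι ℤ (Sum.inl s) + FreeAlgebra.ι ℤ (Sum.inl t))
  | mul (s t : S) : TensorRel (FreeAlgebra.ι ℤ (Sum.inl (s * t)))
      (FreeAlgebra.ι ℤ (Sum.inl s) * FreeAlgebra.ι ℤ (Sum.inl t))
  | vadd (v w : V) : TensorRel (FreeAlgebra.ι ℤ (Sum.inr (v + w)))
      (FreeAlgebra.ι ℤ (Sum.inr v) + FreeAlgebra.ι ℤ (Sum.inr w))
  | left (s : S) (v : V) : TensorRel (FreeAlgebra.ι ℤ (Sum.inr (Env.tmul s 1 • v)))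
      (FreeAlgebra.ι ℤ (Sum.inl s) * FreeAlgebra.ι ℤ (Sum.inr v))
  | right (v : V) (s : S) : TensorRel (FreeAlgebra.ι ℤ (Sum.inr (Env.tmul 1 s • v)))
      (FreeAlgebra.ι ℤ (Sum.inr v) * FreeAlgebra.ι ℤ (Sum.inl s))

/-- The tensor `S`-ring `T_S(V)`: the universal `S`-ring with a bimodule map from `V`, see
`TensorRing.lift`. -/
def TensorRing : Type _ := RingQuot (TensorRel S V)

instance : Ring (TensorRing S V) := inferInstanceAs (Ring (RingQuot (TensorRel S V)))

namespace TensorRing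

/-- The quotient map from the free ring. -/
def mk : FreeAlgebra ℤ (S ⊕ V) →+* TensorRing S V :=
  (RingQuot.mkAlgHom ℤ (TensorRel S V)).toRingHom

theorem mk_rel {S V : Type*} [Ring S] [AddCommGroup V] [Module (Env S) V]
    {x y : FreeAlgebra ℤ (S ⊕ V)} (h : TensorRel S V x y) :
    mk S V x = mk S V y :=
  RingQuot.mkAlgHom_rel ℤ h

instance : SRing S (TensorRing S V) where
  unit :=
    { toFun := fun s => mk S V (FreeAlgebra.ι ℤ (Sum.inl s))
      map_one' := by rw [mk_rel .one, map_one]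
      map_mul' := fun s t => by rw [mk_rel (.mul s t), map_mul]
      map_zero' := by
        have h := mk_rel (S := S) (V := V) (.add 0 0)
        rw [map_add, add_zero] at h
        exact left_eq_add.mp h
      map_add' := fun s t => by rw [mk_rel (.add s t), map_add] }

/-- The canonical map `V → T_S(V)`. -/
def ι : V →+ TensorRing S V where
  toFun v := mk S V (FreeAlgebra.ι ℤ (Sum.inr v))
  map_zero' := by
    have h := mk_rel (S := S) (V := V) (.vadd 0 0)
    rw [map_add, add_zero] at h
    exact left_eq_add.mp h
  map_add' v w := by rw [mk_rel (.vadd v w), map_add]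

variable {S V}

theorem ι_left (s : S) (v : V) :
    ι S V (Env.tmul s 1 • v) = SRing.unit s * ι S V v := by
  show mk S V _ = mk S V _ * mk S V _
  rw [mk_rel (.left s v), map_mul]

theorem ι_right (v : V) (s : S) :
    ι S V (Env.tmul 1 s • v) = ι S V v * SRing.unit s := by
  show mk S V _ = mk S V _ * mk S V _
  rw [mk_rel (.right v s), map_mul]

/-- The universal property of the tensor `S`-ring. -/
def lift {B : Type*} [Ring B] (f : S →+* B) (g : V →+ B)
    (hl : ∀ s v, g (Env.tmul s 1 • v) = f s * g v)
    (hr : ∀ v s, g (Env.tmul 1 s • v) = g v * f s) : TensorRing S V →+* B :=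
  (RingQuot.liftAlgHom ℤ ⟨FreeAlgebra.lift ℤ (Sum.elim f g), fun x y h => by
    induction h with
    | left s v => simpa using hl s v
    | right v s => simpa using hr v s
    | _ => simp⟩ : RingQuot (TensorRel S V) →ₐ[ℤ] B).toRingHom

section
variable {B : Type*} [Ring B] (f : S →+* B) (g : V →+ B)
    (hl : ∀ s v, g (Env.tmul s 1 • v) = f s * g v)
    (hr : ∀ v s, g (Env.tmul 1 s • v) = g v * f s)

@[simp] theorem lift_unit (s : S) : lift f g hl hr (SRing.unit s) = f s := by
  show RingQuot.liftAlgHom ℤ _ (RingQuot.mkAlgHom ℤ _ _) = _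
  rw [RingQuot.liftAlgHom_mkAlgHom_apply, FreeAlgebra.lift_ι_apply]; rfl

@[simp] theorem lift_ι (v : V) : lift f g hl hr (ι S V v) = g v := by
  show RingQuot.liftAlgHom ℤ _ (RingQuot.mkAlgHom ℤ _ _) = _
  rw [RingQuot.liftAlgHom_mkAlgHom_apply, FreeAlgebra.lift_ι_apply]; rfl

theorem hom_ext {p q : TensorRing S V →+* B}
    (hu : ∀ s : S, p (SRing.unit s) = q (SRing.unit s)) (hv : ∀ v, p (ι S V v) = q (ι S V v)) :
    p = q := by
  have h : (p.comp (mk S V)).toIntAlgHom = (q.comp (mk S V)).toIntAlgHom := by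
    apply FreeAlgebra.hom_ext
    funext x
    cases x with
    | inl s => exact hu s
    | inr v => exact hv v
  apply RingHom.ext
  intro x
  obtain ⟨y, rfl⟩ := RingQuot.mkAlgHom_surjective ℤ (TensorRel S V) x
  exact DFunLike.congr_fun h y
end

variable (S V)

/-- The component of degree `n` of the tensor `S`-ring, spanned as a bimodule by the products
`v₁ ⋯ vₙ`. -/
def grade (n : ℕ) : Subbimodule S (TensorRing S V) :=
  Submodule.span (Env S) {x | ∃ l : List V, l.length = n ∧ x = (l.map (ι S V)).prod}

variable {S V}

theorem unit_mul_mem {n : ℕ} {x : TensorRing S V} (s : S) (hx : x ∈ grade S V n) :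
    SRing.unit s * x ∈ grade S V n := by
  have := (grade S V n).smul_mem (Env.tmul s 1) hx
  rwa [env_smul_def, map_one, mul_one] at this

theorem mul_unit_mem {n : ℕ} {x : TensorRing S V} (s : S) (hx : x ∈ grade S V n) :
    x * SRing.unit s ∈ grade S V n := by
  have := (grade S V n).smul_mem (Env.tmul 1 s) hx
  rwa [env_smul_def, map_one, one_mul] at this

/-- An induction principle: the components are generated additively by the elements
`s v₁ ⋯ vₙ t`. -/
theorem grade_induction {n : ℕ} {p : TensorRing S V → Prop}
    (word : ∀ (s t : S) (l : List V), l.length = n →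
      p (SRing.unit s * (l.map (ι S V)).prod * SRing.unit t))
    (zero : p 0) (add : ∀ x y, p x → p y → p (x + y))
    {x : TensorRing S V} (hx : x ∈ grade S V n) : p x := by
  induction hx using Submodule.closure_induction with
  | zero => exact zero
  | add x y _ _ hx hy => exact add _ _ hx hy
  | smul_mem e x hx =>
    obtain ⟨l, hl, rfl⟩ := hx
    induction e using Env.induction with
    | zero => rw [zero_smul]; exact zero
    | tmul s t => rw [env_smul_def]; exact word s t l hl
    | add a b ha hb => rw [add_smul]; exact add _ _ ha hb

theorem word_mem (l : List V) : (l.map (ι S V)).prod ∈ grade S V l.length :=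
  Submodule.subset_span ⟨l, rfl, rfl⟩

theorem unit_mul_word_mem (r : S) (l m : List V) :
    (l.map (ι S V)).prod * SRing.unit r * (m.map (ι S V)).prod
      ∈ grade S V (l.length + m.length) := by
  cases m with
  | nil => simpa using mul_unit_mem r (word_mem l)
  | cons v m =>
    have h := word_mem (S := S) (l ++ Env.tmul r 1 • v :: m)
    rw [List.length_append, List.length_cons] at h
    rw [List.length_cons]
    convert h using 1
    rw [List.map_append, List.prod_append, List.map_cons, List.map_cons, List.prod_cons,
      List.prod_cons, ι_left]
    simp only [mul_assoc]

instance : SetLike.GradedMonoid (grade S V) where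
  one_mem := word_mem []
  mul_mem n m x y hx hy := by
    refine grade_induction (p := fun x => x * y ∈ grade S V (n + m)) (fun s t l hl => ?_) ?_
      (fun x x' hx hx' => ?_) hx
    · refine grade_induction (p := fun y => _ * y ∈ grade S V (n + m)) (fun s' t' l' hl' => ?_) ?_
        (fun y y' hy hy' => ?_) hy
      · have h := mul_unit_mem t' (unit_mul_mem s (unit_mul_word_mem (t * s') l l'))
        rw [hl, hl'] at h
        convert h using 1
        rw [map_mul]
        simp only [mul_assoc]
      · rw [mul_zero]; exact zero_mem _
      · rw [mul_add]; exact add_mem hy hy'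
    · rw [zero_mul]; exact zero_mem _
    · rw [add_mul]; exact add_mem hx hx'

theorem unit_mem (s : S) : SRing.unit s ∈ grade S V 0 := by
  simpa using mul_unit_mem s (word_mem (S := S) (V := V) [])

theorem ι_mem (v : V) : ι S V v ∈ grade S V 1 := by
  simpa using word_mem (S := S) [v]

/-- The decomposition of the tensor `S`-ring into its components. -/
def toDirectSum : TensorRing S V →+* ⨁ n, grade S V n :=
  lift
    { toFun := fun s => DirectSum.of (fun n => grade S V n) 0 ⟨SRing.unit s, unit_mem s⟩
      map_one' := by
        rw [DirectSum.one_def]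
        exact congrArg _ (Subtype.ext (map_one _))
      map_mul' := fun s t => by
        rw [DirectSum.of_mul_of]
        exact DirectSum.of_eq_of_gradedMonoid_eq (Sigma.subtype_ext rfl (map_mul _ _ _))
      map_zero' := by
        rw [← map_zero (DirectSum.of (fun n => grade S V n) 0)]
        exact congrArg _ (Subtype.ext (map_zero _))
      map_add' := fun s t => by
        rw [← map_add]
        exact congrArg _ (Subtype.ext (map_add _ _ _)) }
    ((DirectSum.of (fun n => grade S V n) 1).comp
      ((ι S V).codRestrict (grade S V 1) ι_mem))
    (fun s v => by
      refine Eq.trans ?_ (DirectSum.of_mul_of _ _).symm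
      exact DirectSum.of_eq_of_gradedMonoid_eq (Sigma.subtype_ext rfl (ι_left s v)))
    (fun v s => by
      refine Eq.trans ?_ (DirectSum.of_mul_of _ _).symm
      exact DirectSum.of_eq_of_gradedMonoid_eq (Sigma.subtype_ext rfl (ι_right v s)))

theorem toDirectSum_unit (s : S) : toDirectSum (SRing.unit s : TensorRing S V) =
    DirectSum.of (fun n => grade S V n) 0 ⟨SRing.unit s, unit_mem s⟩ := lift_unit ..

theorem toDirectSum_ι (v : V) : toDirectSum (ι S V v) =
    DirectSum.of (fun n => grade S V n) 1 ⟨ι S V v, ι_mem v⟩ := lift_ι ..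

theorem toDirectSum_word (l : List V) : toDirectSum (l.map (ι S V)).prod =
    DirectSum.of (fun n => grade S V n) l.length ⟨_, word_mem l⟩ := by
  induction l with
  | nil => exact map_one _
  | cons v l ih =>
    refine (map_mul _ (ι S V v) (l.map (ι S V)).prod).trans ?_
    rw [ih, toDirectSum_ι, DirectSum.of_mul_of]
    exact DirectSum.of_eq_of_gradedMonoid_eq (Sigma.subtype_ext (add_comm _ _) rfl)

theorem toDirectSum_of_mem {n : ℕ} {x : TensorRing S V} (hx : x ∈ grade S V n) :
    toDirectSum x = DirectSum.of (fun n => grade S V n) n ⟨x, hx⟩ := by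
  suffices h : ∃ hx, toDirectSum x = DirectSum.of (fun n => grade S V n) n ⟨x, hx⟩ from h.2
  refine grade_induction (p := fun x => ∃ hx : x ∈ grade S V n, toDirectSum x =
    DirectSum.of (fun n => grade S V n) n ⟨x, hx⟩) (fun s t l hl => ?_) ?_
      (fun x y hx hy => ?_) hx
  rotate_left
  · refine ⟨zero_mem _, ?_⟩
    rw [map_zero]; exact (map_zero _).symm
  · obtain ⟨hx, ex⟩ := hx
    obtain ⟨hy, ey⟩ := hy
    refine ⟨add_mem hx hy, ?_⟩
    rw [map_add, ex, ey, ← map_add]; rfl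
  · subst hl
    refine ⟨mul_unit_mem t (unit_mul_mem s (word_mem l)), ?_⟩
    rw [map_mul, map_mul, toDirectSum_word, toDirectSum_unit, toDirectSum_unit,
      DirectSum.of_mul_of, DirectSum.of_mul_of]
    exact DirectSum.of_eq_of_gradedMonoid_eq (Sigma.subtype_ext (Nat.zero_add _) rfl)

instance : GradedRing (grade S V) where
  decompose' := toDirectSum
  left_inv x := by
    have h : (DirectSum.coeRingHom (grade S V)).comp toDirectSum = RingHom.id _ := by
      apply hom_ext
      · intro s
        rw [RingHom.comp_apply, toDirectSum_unit]
        exact DirectSum.coeAddMonoidHom_of _ _ _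
      · intro v
        rw [RingHom.comp_apply, toDirectSum_ι]
        exact DirectSum.coeAddMonoidHom_of _ _ _
    exact DFunLike.congr_fun h x
  right_inv x := by
    induction x using DirectSum.induction_on with
    | zero => rw [map_zero, map_zero]
    | of n x => rw [DirectSum.coeAddMonoidHom_of, toDirectSum_of_mem x.2]
    | add x y hx hy => rw [map_add, map_add, hx, hy]

theorem unit_injective : Function.Injective (SRing.unit (S := S) (T := TensorRing S V)) := by
  have h : ∀ s : S, lift (RingHom.id S) (0 : V →+ S) (by simp) (by simp)
      (SRing.unit s : TensorRing S V) = s := fun s => lift_unit ..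
  exact Function.LeftInverse.injective h

instance : IsConnected (grade S V) where
  unit_injective := unit_injective
  mem_zero_iff x := by
    constructor
    · intro hx
      refine grade_induction (p := fun x => ∃ s : S, SRing.unit s = x) (fun s t l hl => ?_)
        ⟨0, map_zero _⟩ (fun x y hx hy => ?_) hx
      · rw [List.length_eq_zero_iff] at hl
        subst hl
        exact ⟨s * t, by simp⟩
      · obtain ⟨s, rfl⟩ := hx
        obtain ⟨t, rfl⟩ := hy
        exact ⟨s + t, map_add _ _ _⟩
    · rintro ⟨s, rfl⟩
      exact unit_mem s

end TensorRing
end TensorRing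

/-! ### Associated graded rings -/

section AssociatedGraded

variable {U : Type*} [Ring U]

/-- An increasing filtration `F 0 ⊆ F 1 ⊆ ⋯` of a ring, compatible with the multiplication. -/
class IsRingFilt (F : ℕ → AddSubgroup U) : Prop where
  mono : ∀ n, F n ≤ F (n + 1)
  one_mem : (1 : U) ∈ F 0
  mul_mem : ∀ {m n : ℕ} {u v : U}, u ∈ F m → v ∈ F n → u * v ∈ F (m + n)

/-- `F (n - 1)`, where `F (-1) = 0`. -/
def below (F : ℕ → AddSubgroup U) : ℕ → AddSubgroup U
  | 0 => ⊥
  | n + 1 => F n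

theorem below_mul_mem {F : ℕ → AddSubgroup U} [IsRingFilt F] {m n : ℕ} {u v : U}
    (hu : u ∈ below F m) (hv : v ∈ F n) : u * v ∈ below F (m + n) := by
  cases m with
  | zero =>
    have h : u = 0 := hu
    rw [h, zero_mul]; exact zero_mem _
  | succ m =>
    rw [Nat.add_right_comm]
    exact IsRingFilt.mul_mem (F := F) hu hv

theorem mul_below_mem {F : ℕ → AddSubgroup U} [IsRingFilt F] {m n : ℕ} {u v : U}
    (hu : u ∈ F m) (hv : v ∈ below F n) : u * v ∈ below F (m + n) := by
  cases n with
  | zero =>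
    have h : v = 0 := hv
    rw [h, mul_zero]; exact zero_mem _
  | succ n => exact IsRingFilt.mul_mem (F := F) hu hv

/-- The component `gr^n U = F n / F (n - 1)` of the associated graded ring. -/
abbrev Gr (F : ℕ → AddSubgroup U) (n : ℕ) : Type _ :=
  F n ⧸ (below F n).addSubgroupOf (F n)

/-- The class in `gr^n U` of an element of `F n`. -/
def Gr.mk (F : ℕ → AddSubgroup U) (n : ℕ) : F n →+ Gr F n := QuotientAddGroup.mk' _

theorem Gr.mk_surjective (F : ℕ → AddSubgroup U) (n : ℕ) : Function.Surjective (Gr.mk F n) :=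
  QuotientAddGroup.mk'_surjective _

theorem Gr.mk_eq_zero {F : ℕ → AddSubgroup U} {n : ℕ} (u : F n) :
    Gr.mk F n u = 0 ↔ (u : U) ∈ below F n :=
  QuotientAddGroup.eq_zero_iff u

variable (F : ℕ → AddSubgroup U) [IsRingFilt F]

/-- The multiplication `gr^m U × gr^n U → gr^{m+n} U` induced by that of `U`. -/
def Gr.mul (m n : ℕ) : Gr F m →+ Gr F n →+ Gr F (m + n) :=
  QuotientAddGroup.lift _
    (AddMonoidHom.mk'
      (fun u : F m => QuotientAddGroup.lift ((below F n).addSubgroupOf (F n))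
        (AddMonoidHom.mk'
          (fun v : F n => Gr.mk F (m + n) ⟨u * v, IsRingFilt.mul_mem u.2 v.2⟩)
          (fun v w => by
            rw [← map_add]; exact congrArg _ (Subtype.ext (mul_add _ _ _))))
        (fun v hv => (Gr.mk_eq_zero _).2 (mul_below_mem u.2 hv)))
      (fun u w => by
        ext v
        show Gr.mk F (m + n) _ = Gr.mk F (m + n) _ + Gr.mk F (m + n) _
        rw [← map_add]; exact congrArg _ (Subtype.ext (add_mul _ _ _))))
    (fun u hu => by
      ext v
      exact (Gr.mk_eq_zero _).2 (below_mul_mem hu v.2))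

theorem Gr.mul_mk_mk {m n : ℕ} (u : F m) (v : F n) :
    Gr.mul F m n (Gr.mk F m u) (Gr.mk F n v) =
      Gr.mk F (m + n) ⟨u * v, IsRingFilt.mul_mem u.2 v.2⟩ := rfl

theorem Gr.sigma_ext {U : Type*} [Ring U] {F : ℕ → AddSubgroup U} {m n : ℕ} (h : m = n)
    {u : F m} {v : F n} (huv : (u : U) = v) :
    GradedMonoid.mk (A := Gr F) m (Gr.mk F m u) = GradedMonoid.mk n (Gr.mk F n v) := by
  subst h
  rw [Subtype.ext huv]

instance : GradedMonoid.GOne (Gr F) := ⟨Gr.mk F 0 ⟨1, IsRingFilt.one_mem⟩⟩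

instance : GradedMonoid.GMul (Gr F) := ⟨fun {m n} x y => Gr.mul F m n x y⟩

instance : DirectSum.GRing (Gr F) where
  mul_zero _ := map_zero _
  zero_mul {m n} y := by
    show Gr.mul F m n 0 y = 0
    rw [map_zero]; rfl
  mul_add _ _ _ := map_add _ _ _
  add_mul {m n} x y z := by
    show Gr.mul F m n (x + y) z = Gr.mul F m n x z + Gr.mul F m n y z
    rw [map_add]; rfl
  one_mul := by
    rintro ⟨n, x⟩
    obtain ⟨u, rfl⟩ := Gr.mk_surjective F n x
    exact Gr.sigma_ext (Nat.zero_add n) (one_mul _)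
  mul_one := by
    rintro ⟨n, x⟩
    obtain ⟨u, rfl⟩ := Gr.mk_surjective F n x
    exact Gr.sigma_ext (Nat.add_zero n) (mul_one _)
  mul_assoc := by
    rintro ⟨l, x⟩ ⟨m, y⟩ ⟨n, z⟩
    obtain ⟨u, rfl⟩ := Gr.mk_surjective F l x
    obtain ⟨v, rfl⟩ := Gr.mk_surjective F m y
    obtain ⟨w, rfl⟩ := Gr.mk_surjective F n z
    exact Gr.sigma_ext (Nat.add_assoc l m n) (mul_assoc _ _ _)
  natCast k := k • Gr.mk F 0 ⟨1, IsRingFilt.one_mem⟩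
  natCast_zero := zero_nsmul _
  natCast_succ k := succ_nsmul _ k
  intCast k := k • Gr.mk F 0 ⟨1, IsRingFilt.one_mem⟩
  intCast_ofNat k := natCast_zsmul _ k
  intCast_negSucc_ofNat k := negSucc_zsmul _ k

end AssociatedGraded

/-! ### The homogeneous and the non-homogeneous algebra of a bimodule -/

section Deformation

variable {S T : Type*} [Ring S] [Ring T] [SRing S T] (𝒯 : ℕ → Subbimodule S T) [GradedRing 𝒯]

/-- The standard filtration `T^{≤n} = T^0 + ⋯ + T^n`. -/
def upTo (n : ℕ) : Subbimodule S T := ⨆ i : Set.Iic n, 𝒯 i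

/-- A subbimodule is graded if it contains the homogeneous components of its elements. -/
def IsGradedSub (X : Subbimodule S T) : Prop :=
  ∀ x ∈ X, ∀ n, GradedRing.proj 𝒯 n x ∈ X

/-- `R_X`, the graded subbimodule whose component of degree `n` is `p^n(X ∩ T^{≤n})`; it is
generated by the nonzero homogeneous components of highest degree of the elements of `X`. -/
def leading (X : Subbimodule S T) : Subbimodule S T :=
  Submodule.span (Env S) {y | ∃ n, ∃ x ∈ X, x ∈ upTo 𝒯 n ∧ GradedRing.proj 𝒯 n x = y}

/-- The two-sided ideal generated by a subbimodule. -/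
def ideal (X : Subbimodule S T) : TwoSidedIdeal T := TwoSidedIdeal.span (X : Set T)

/-- The quotient of `T` by the ideal generated by `X`. For a bimodule `P` this is the ring `U(P)`,
and for a graded bimodule `R` it is the graded ring `A(R)`. -/
abbrev QuotRing (X : Subbimodule S T) : Type _ := (ideal X).ringCon.Quotient

/-- The projection of `T` onto its quotient by the ideal generated by `X`. -/
abbrev QuotRing.mk (X : Subbimodule S T) : T →+* QuotRing X := (ideal X).ringCon.mk'

/-- The filtration of `U(P)` by the images of the subgroups `T^{≤n}`. -/
def quotFilt (P : Subbimodule S T) (n : ℕ) : AddSubgroup (QuotRing P) :=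
  (upTo 𝒯 n).toAddSubgroup.map (QuotRing.mk P).toAddMonoidHom

variable {𝒯}

theorem le_upTo {S T : Type*} [Ring S] [Ring T] [SRing S T] {𝒯 : ℕ → Subbimodule S T} {i n : ℕ}
    (h : i ≤ n) : 𝒯 i ≤ upTo 𝒯 n :=
  le_iSup_of_le (⟨i, h⟩ : Set.Iic n) le_rfl

theorem upTo_mono {S T : Type*} [Ring S] [Ring T] [SRing S T] {𝒯 : ℕ → Subbimodule S T} {m n : ℕ}
    (h : m ≤ n) : upTo 𝒯 m ≤ upTo 𝒯 n :=
  iSup_le fun i => le_upTo (i.2.trans h)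

theorem upTo_mul_mem {m n : ℕ} {x y : T} (hx : x ∈ upTo 𝒯 m) (hy : y ∈ upTo 𝒯 n) :
    x * y ∈ upTo 𝒯 (m + n) := by
  refine Submodule.iSup_induction (fun i : Set.Iic m => 𝒯 i)
    (motive := fun x => x * y ∈ upTo 𝒯 (m + n)) hx (fun i x hx => ?_) ?_ (fun a b ha hb => ?_)
  · refine Submodule.iSup_induction (fun i : Set.Iic n => 𝒯 i)
      (motive := fun y => x * y ∈ upTo 𝒯 (m + n)) hy (fun j y hy => ?_) ?_ (fun a b ha hb => ?_)
    · exact le_upTo (add_le_add i.2 j.2) (SetLike.GradedMul.mul_mem hx hy)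
    · rw [mul_zero]; exact zero_mem _
    · rw [mul_add]; exact add_mem ha hb
  · rw [zero_mul]; exact zero_mem _
  · rw [add_mul]; exact add_mem ha hb

theorem sub_proj_mem_below {n : ℕ} {x : T} (hx : x ∈ upTo 𝒯 n) :
    ∀ P : Subbimodule S T, QuotRing.mk P (x - GradedRing.proj 𝒯 n x) ∈ below (quotFilt 𝒯 P) n := by
  intro P
  refine Submodule.iSup_induction (fun i : Set.Iic n => 𝒯 i)
    (motive := fun x => QuotRing.mk P (x - GradedRing.proj 𝒯 n x) ∈ below (quotFilt 𝒯 P) n)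
    hx (fun i x hx => ?_) ?_ (fun a b ha hb => ?_)
  · obtain ⟨i, hi⟩ := i
    rcases (Set.mem_Iic.1 hi).eq_or_lt with rfl | hlt
    · rw [GradedRing.proj_apply, DirectSum.decompose_of_mem_same 𝒯 hx, sub_self, map_zero]
      exact zero_mem _
    · obtain ⟨k, rfl⟩ := Nat.exists_eq_add_of_lt hlt
      rw [GradedRing.proj_apply, DirectSum.decompose_of_mem_ne 𝒯 hx hlt.ne, sub_zero]
      exact ⟨x, le_upTo (Nat.le_add_right i k) hx, rfl⟩
  · rw [map_zero, sub_zero, map_zero]; exact zero_mem _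
  · rw [map_add, add_sub_add_comm, map_add]; exact add_mem ha hb

instance (P : Subbimodule S T) : IsRingFilt (quotFilt 𝒯 P) where
  mono n := AddSubgroup.map_mono (upTo_mono n.le_succ)
  one_mem := ⟨1, le_upTo le_rfl SetLike.GradedOne.one_mem, map_one (QuotRing.mk P)⟩
  mul_mem := by
    rintro m n _ _ ⟨x, hx, rfl⟩ ⟨y, hy, rfl⟩
    exact ⟨x * y, upTo_mul_mem hx hy, map_mul (QuotRing.mk P) x y⟩

variable (𝒯)

/-- The map `φ_P^n : T^n → gr^n U(P)` sending `x` to the class of `x + ⟨P⟩`. -/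
def phiComponent (P : Subbimodule S T) (n : ℕ) : 𝒯 n →+ Gr (quotFilt 𝒯 P) n :=
  (Gr.mk (quotFilt 𝒯 P) n).comp
    (AddMonoidHom.mk' (fun x : 𝒯 n => ⟨QuotRing.mk P (x : T), x, le_upTo le_rfl x.2, rfl⟩)
      (fun x y => Subtype.ext (map_add (QuotRing.mk P) (x : T) (y : T))))

theorem phiComponent_one (P : Subbimodule S T) :
    phiComponent 𝒯 P 0 (GradedMonoid.GOne.one (A := fun n => 𝒯 n)) = GradedMonoid.GOne.one :=
  congrArg (Gr.mk (quotFilt 𝒯 P) 0) (Subtype.ext (map_one (QuotRing.mk P)))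

theorem phiComponent_mul (P : Subbimodule S T) {i j : ℕ} (x : 𝒯 i) (y : 𝒯 j) :
    phiComponent 𝒯 P (i + j) (GradedMonoid.GMul.mul (A := fun n => 𝒯 n) x y) =
      GradedMonoid.GMul.mul (phiComponent 𝒯 P i x) (phiComponent 𝒯 P j y) :=
  congrArg (Gr.mk (quotFilt 𝒯 P) (i + j)) (Subtype.ext (map_mul (QuotRing.mk P) (x : T) (y : T)))

/-- The morphism of graded rings `φ_P : T → gr U(P)` with components `φ_P^n`. -/
def phi (P : Subbimodule S T) : T →+* ⨁ n, Gr (quotFilt 𝒯 P) n :=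
  (DirectSum.toSemiring (fun n => (DirectSum.of (Gr (quotFilt 𝒯 P)) n).comp (phiComponent 𝒯 P n))
    (congrArg (DirectSum.of (Gr (quotFilt 𝒯 P)) 0) (phiComponent_one 𝒯 P))
    (fun {i j} x y =>
      (congrArg (DirectSum.of (Gr (quotFilt 𝒯 P)) (i + j)) (phiComponent_mul 𝒯 P x y)).trans
        (DirectSum.of_mul_of _ _).symm)).comp
    (DirectSum.decomposeRingEquiv 𝒯).toRingHom

theorem phi_of_mem (P : Subbimodule S T) {n : ℕ} {x : T} (hx : x ∈ 𝒯 n) :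
    phi 𝒯 P x = DirectSum.of (Gr (quotFilt 𝒯 P)) n (phiComponent 𝒯 P n ⟨x, hx⟩) := by
  show DirectSum.toAddMonoid _ (DirectSum.decompose 𝒯 x) = _
  rw [DirectSum.decompose_of_mem 𝒯 hx, DirectSum.toAddMonoid_of]
  rfl

theorem phi_unit_mul (P : Subbimodule S T) (s t : S) (x : T) :
    phi 𝒯 P (Env.tmul s t • x) = phi 𝒯 P (SRing.unit s) * phi 𝒯 P x * phi 𝒯 P (SRing.unit t) := by
  rw [env_smul_def, map_mul, map_mul]

theorem phi_eq_zero_of_mem_leading (P : Subbimodule S T) {x : T} (hx : x ∈ leading 𝒯 P) :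
    phi 𝒯 P x = 0 := by
  induction hx using Submodule.closure_induction with
  | zero => exact map_zero _
  | add x y _ _ hx hy => rw [map_add, hx, hy, add_zero]
  | smul_mem e x hx =>
    have h0 : phi 𝒯 P x = 0 := by
      obtain ⟨n, y, hyP, hyn, rfl⟩ := hx
      have hmem : GradedRing.proj 𝒯 n y ∈ 𝒯 n := SetLike.coe_mem _
      rw [phi_of_mem 𝒯 P hmem]
      suffices h : phiComponent 𝒯 P n ⟨_, hmem⟩ = 0 by rw [h, map_zero]
      refine (Gr.mk_eq_zero _).2 ?_
      have h1 := neg_mem (sub_proj_mem_below hyn P)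
      rw [← map_neg, neg_sub, map_sub] at h1
      have h2 : QuotRing.mk P y = 0 := by
        rw [← map_zero (QuotRing.mk P)]
        exact (RingCon.eq _).2 ((TwoSidedIdeal.mem_iff _ _).1 (TwoSidedIdeal.subset_span hyP))
      rwa [h2, sub_zero] at h1
    induction e using Env.induction with
    | zero => rw [zero_smul, map_zero]
    | tmul s t => rw [phi_unit_mul, h0, mul_zero, zero_mul]
    | add a b ha hb => rw [add_smul, map_add, ha, hb, add_zero]

/-- The morphism of graded rings `Φ_{P,R} : A(R) → gr U(P)` defined for `R ⊆ R_P`; it sends the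
class of `x ∈ T^n` to the class of `x + ⟨P⟩` in `gr^n U(P)`. -/
def Phi (P R : Subbimodule S T) (h : R ≤ leading 𝒯 P) :
    QuotRing R →+* ⨁ n, Gr (quotFilt 𝒯 P) n :=
  (ideal R).ringCon.lift (phi 𝒯 P) (by
    have h1 : ideal R ≤ TwoSidedIdeal.ker (phi 𝒯 P) :=
      TwoSidedIdeal.span_le.2 fun x hx =>
        (TwoSidedIdeal.mem_ker _).2 (phi_eq_zero_of_mem_leading 𝒯 P (h hx))
    intro x y hxy
    have h2 := h1 ((TwoSidedIdeal.rel_iff _ x y).1 hxy)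
    rwa [TwoSidedIdeal.mem_ker, map_sub, sub_eq_zero] at h2)

/-- `U(P)` is a PBW-deformation of `A(R)`, where `R ⊆ R_P`, if `Φ_{P,R}` is an isomorphism. -/
def IsPBWDeformation (P R : Subbimodule S T) (h : R ≤ leading 𝒯 P) : Prop :=
  Function.Bijective (Phi 𝒯 P R h)

/-- The subgroup `P_n = ∑_{i+j+k=n} T^{≤i} P^{≤j} T^{≤k}`. -/
def jacobiFilt (P : Subbimodule S T) (n : ℕ) : Submodule ℤ T :=
  ⨆ (i : ℕ) (j : ℕ) (k : ℕ) (_ : i + j + k = n),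
    (upTo 𝒯 i).toZ * (P ⊓ upTo 𝒯 j).toZ * (upTo 𝒯 k).toZ

/-- The Jacobi condition `(J_n)`: `P_{n+1} ∩ T^{≤n} ⊆ P_n`. -/
def Jacobi (P : Subbimodule S T) (n : ℕ) : Prop :=
  jacobiFilt 𝒯 P (n + 1) ⊓ (upTo 𝒯 n).toZ ≤ jacobiFilt 𝒯 P n

/-- A graded subbimodule `R` is a bimodule of relations for `T/I` if it is a complement in `I` of
`I T^1 + T^1 I`. -/
structure IsBimoduleOfRelations (R : Subbimodule S T) (I : Submodule ℤ T) : Prop where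
  graded : IsGradedSub 𝒯 R
  inf_eq : R.toZ ⊓ (I * (𝒯 1).toZ + (𝒯 1).toZ * I) = ⊥
  sup_eq : R.toZ ⊔ (I * (𝒯 1).toZ + (𝒯 1).toZ * I) = I

/-- A bimodule map `α : R → T` is filtered, with inclusion `R ⊆ T` as its component of degree `0`,
if it sends `R^n` to `T^{≤n}` and `p^n(α(r)) = r` for `r ∈ R^n`. -/
def IsFilteredMap {R : Subbimodule S T} (α : R →ₗ[Env S] T) : Prop :=
  ∀ (n : ℕ) (r : R), (r : T) ∈ 𝒯 n → α r ∈ upTo 𝒯 n ∧ GradedRing.proj 𝒯 n (α r) = r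

end Deformation

/-! ### The torsion groups of a connected graded ring -/

section TensorOver

/-- The subgroup of `N ⊗ M` generated by the elements `n a ⊗ m - n ⊗ a m`. -/
def tensorRel (A N M : Type*) [Ring A] [AddCommGroup N] [Module Aᵐᵒᵖ N] [AddCommGroup M]
    [Module A M] : AddSubgroup (N ⊗[ℤ] M) :=
  AddSubgroup.closure
    {z | ∃ (n : N) (a : A) (m : M), (op a • n) ⊗ₜ[ℤ] m - n ⊗ₜ[ℤ] (a • m) = z}

/-- The tensor product `N ⊗_A M` of a right module and a left module over a ring `A`. -/
abbrev TensorOver (A N M : Type*) [Ring A] [AddCommGroup N] [Module Aᵐᵒᵖ N] [AddCommGroup M]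
    [Module A M] : Type _ := (N ⊗[ℤ] M) ⧸ tensorRel A N M

/-- The element `n ⊗ m` of `N ⊗_A M`. -/
def TensorOver.tmul (A : Type*) {N M : Type*} [Ring A] [AddCommGroup N] [Module Aᵐᵒᵖ N]
    [AddCommGroup M] [Module A M] (n : N) (m : M) : TensorOver A N M :=
  QuotientAddGroup.mk' (tensorRel A N M) (n ⊗ₜ[ℤ] m)

/-- The map `N ⊗_A M → N ⊗_A M'` induced by an `A`-linear map. -/
def TensorOver.map {A : Type*} (N : Type*) {M M' : Type*} [Ring A] [AddCommGroup N]
    [Module Aᵐᵒᵖ N] [AddCommGroup M] [Module A M] [AddCommGroup M'] [Module A M']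
    (f : M →ₗ[A] M') : TensorOver A N M →+ TensorOver A N M' :=
  QuotientAddGroup.map (tensorRel A N M) (tensorRel A N M')
    (LinearMap.lTensor N f.toAddMonoidHom.toIntLinearMap).toAddMonoidHom
    ((AddSubgroup.closure_le _).2 (by
      rintro _ ⟨n, a, m, rfl⟩
      refine AddSubgroup.subset_closure ⟨n, a, f m, ?_⟩
      rw [← map_smul]
      exact (map_sub (LinearMap.lTensor N f.toAddMonoidHom.toIntLinearMap).toAddMonoidHom
        ((op a • n) ⊗ₜ[ℤ] m) (n ⊗ₜ[ℤ] (a • m))).symm))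

theorem TensorOver.map_tmul {A N M M' : Type*} [Ring A] [AddCommGroup N]
    [Module Aᵐᵒᵖ N] [AddCommGroup M] [Module A M] [AddCommGroup M'] [Module A M']
    (f : M →ₗ[A] M') (n : N) (m : M) :
    TensorOver.map N f (TensorOver.tmul A n m) = TensorOver.tmul A n (f m) := rfl

end TensorOver

section Tor

variable {S A : Type*} [Ring S] [Ring A] [SRing S A] (𝒜 : ℕ → Subbimodule S A) [GradedRing 𝒜]

/-- The isomorphism of `S` with the component of degree `0`. -/
noncomputable def degreeZeroEquiv [IsConnected 𝒜] : S ≃+* 𝒜 0 :=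
  RingEquiv.ofBijective
    ({ toFun := fun s => ⟨SRing.unit s, (IsConnected.mem_zero_iff _).2 ⟨s, rfl⟩⟩
       map_one' := Subtype.ext (map_one _)
       map_mul' := fun _ _ => Subtype.ext (map_mul _ _ _)
       map_zero' := Subtype.ext (map_zero _)
       map_add' := fun _ _ => Subtype.ext (map_add _ _ _) } : S →+* 𝒜 0)
    ⟨fun _ _ h => IsConnected.unit_injective (𝒯 := 𝒜) (congrArg Subtype.val h), fun x => by
      obtain ⟨s, hs⟩ := (IsConnected.mem_zero_iff (𝒯 := 𝒜) _).1 x.2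
      exact ⟨s, Subtype.ext hs⟩⟩

/-- The projection `A → A^0 = S`. -/
noncomputable def augmentation [IsConnected 𝒜] : A →+* S :=
  ((degreeZeroEquiv 𝒜).symm : 𝒜 0 →+* S).comp (GradedRing.projZeroRingHom' 𝒜)

/-- `S` as a right `A`-module, through the projection `A → S`. -/
def RightTrivial [IsConnected 𝒜] : Type _ := S

instance [IsConnected 𝒜] : AddCommGroup (RightTrivial 𝒜) := inferInstanceAs (AddCommGroup S)

noncomputable instance [IsConnected 𝒜] : Module Aᵐᵒᵖ (RightTrivial 𝒜) :=
  letI : Module Sᵐᵒᵖ (RightTrivial 𝒜) := inferInstanceAs (Module Sᵐᵒᵖ S)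
  Module.compHom (RightTrivial 𝒜) (RingHom.op (augmentation 𝒜))

theorem rightTrivial_smul [IsConnected 𝒜] (a : A) (s : S) :
    op a • (show RightTrivial 𝒜 from s) = s * augmentation 𝒜 a := rfl

end Tor

/-- A left `A`-module with subgroups of homogeneous elements of each degree, together with a
submodule. -/
structure Syzygy (A : Type v) [Ring A] where
  carrier : Type v
  [addCommGroup : AddCommGroup carrier]
  [module : Module A carrier]
  comp : ℕ → AddSubgroup carrier
  sub : Submodule A carrier

attribute [instance] Syzygy.addCommGroup Syzygy.module

section Resolution

variable {S : Type u} {A : Type v} [Ring S] [Ring A] [SRing S A]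
  (𝒜 : ℕ → Subbimodule S A) [GradedRing 𝒜]

/-- The homogeneous elements of the submodule of a syzygy, each with a degree. -/
abbrev Syzygy.Gen (X : Syzygy A) : Type v :=
  Σ n : ℕ, {x : X.carrier // x ∈ X.comp n ∧ x ∈ X.sub}

/-- The canonical map to `X` from the free module on the homogeneous elements of `X.sub`. -/
noncomputable def Syzygy.cover (X : Syzygy A) : (X.Gen →₀ A) →ₗ[A] X.carrier :=
  Finsupp.linearCombination A fun g => (g.2 : X.carrier)

/-- The homogeneous elements of degree `n` of the free module on the homogeneous elements of
`X.sub`, where the basis element of a homogeneous element of degree `k` has degree `k`: the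
elements `f` with each coefficient `f g` homogeneous of degree `n - deg g`. -/
def Syzygy.nextComp (X : Syzygy A) (n : ℕ) : AddSubgroup (X.Gen →₀ A) where
  carrier := {f | ∀ (g : X.Gen) (j : ℕ), j + g.1 ≠ n → GradedRing.proj 𝒜 j (f g) = 0}
  zero_mem' := fun g j _ => map_zero _
  add_mem' := fun {f f'} hf hf' g j h => by
    rw [Finsupp.add_apply, map_add, hf g j h, hf' g j h, add_zero]
  neg_mem' := fun {f} hf g j h => by
    rw [Finsupp.neg_apply, map_neg, hf g j h, neg_zero]

/-- The free graded module on the homogeneous elements of `X.sub`, together with the kernel of its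
canonical map to `X`. -/
noncomputable def Syzygy.next (X : Syzygy A) : Syzygy A where
  carrier := X.Gen →₀ A
  comp := X.nextComp 𝒜
  sub := LinearMap.ker X.cover

/-- The standard graded free resolution `⋯ → F_2 → F_1 → F_0 = A → S → 0` of the left `A`-module
`S`: the module `F_{i+1}` is free on the homogeneous elements of the kernel of `F_i → F_{i-1}`
(of `A → S`, for `i = 0`). -/
noncomputable def resolution [IsConnected 𝒜] : ℕ → Syzygy A
  | 0 =>
    { carrier := A
      comp := fun n => (𝒜 n).toAddSubgroup
      sub := RingHom.ker (augmentation 𝒜) }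
  | i + 1 => (resolution i).next 𝒜

/-- The differential `F_{i+1} → F_i` of the resolution. -/
noncomputable def resolutionD [IsConnected 𝒜] (i : ℕ) :
    (resolution 𝒜 (i + 1)).carrier →ₗ[A] (resolution 𝒜 i).carrier :=
  (resolution 𝒜 i).cover

variable {𝒜}

/-- The submodule `sub` is spanned by homogeneous elements, and the families of homogeneous
elements behave as in a graded module. -/
structure IsGood (𝒜 : ℕ → Subbimodule S A) {M : Type v} [AddCommGroup M] [Module A M]
    (comp : ℕ → AddSubgroup M) (sub : Submodule A M) : Prop where
  smul_mem : ∀ {i j : ℕ} {a : A} {x : M}, a ∈ 𝒜 i → x ∈ comp j → a • x ∈ comp (i + j)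
  indep : ∀ (N : ℕ) (x : ℕ → M), (∀ n, x n ∈ comp n) →
    ∑ n ∈ Finset.range N, x n = 0 → ∀ n < N, x n = 0
  sub_le : ∀ x ∈ sub, ∃ (N : ℕ) (y : ℕ → M),
    (∀ n, y n ∈ comp n ∧ y n ∈ sub) ∧ ∑ n ∈ Finset.range N, y n = x

theorem proj_proj (i j : ℕ) (a : A) :
    GradedRing.proj 𝒜 i (GradedRing.proj 𝒜 j a) = if i = j then GradedRing.proj 𝒜 j a else 0 := by
  split_ifs with h
  · subst h
    exact DirectSum.decompose_of_mem_same 𝒜 (SetLike.coe_mem _)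
  · exact DirectSum.decompose_of_mem_ne 𝒜 (SetLike.coe_mem _) (Ne.symm h)

theorem exists_sum_proj (a : A) :
    ∃ N, ∀ M ≥ N, ∑ n ∈ Finset.range M, GradedRing.proj 𝒜 n a = a := by
  classical
  refine ⟨(DirectSum.decompose 𝒜 a).support.sup id + 1, fun M hM => ?_⟩
  conv_rhs => rw [← DirectSum.sum_support_decompose 𝒜 a]
  symm
  refine Finset.sum_subset (fun n hn => ?_) (fun n _ hn => ?_)
  · rw [Finset.mem_range]
    have := Finset.le_sup (f := id) hn
    simp only [id] at this
    omega
  · rw [DFinsupp.notMem_support_iff] at hn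
    rw [hn]; rfl

theorem Syzygy.range_cover_le (X : Syzygy A) : LinearMap.range X.cover ≤ X.sub := by
  rintro _ ⟨f, rfl⟩
  rw [Syzygy.cover, Finsupp.linearCombination_apply]
  exact X.sub.sum_mem fun g _ => X.sub.smul_mem _ g.2.2.2

theorem Syzygy.range_cover {S : Type u} {A : Type v} [Ring S] [Ring A] [SRing S A]
    {𝒜 : ℕ → Subbimodule S A} (X : Syzygy A) (hX : IsGood 𝒜 X.comp X.sub) :
    LinearMap.range X.cover = X.sub := by
  refine le_antisymm X.range_cover_le fun x hx => ?_
  obtain ⟨N, y, hy, rfl⟩ := hX.sub_le x hx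
  refine Submodule.sum_mem _ fun n _ => ?_
  refine ⟨Finsupp.single ⟨n, y n, hy n⟩ 1, ?_⟩
  rw [Syzygy.cover, Finsupp.linearCombination_single, one_smul]

theorem Syzygy.cover_mem {X : Syzygy A} (hX : IsGood 𝒜 X.comp X.sub) {n : ℕ} {f : X.Gen →₀ A}
    (hf : f ∈ X.nextComp 𝒜 n) : X.cover f ∈ X.comp n := by
  rw [Syzygy.cover, Finsupp.linearCombination_apply]
  refine sum_mem fun g _ => ?_
  obtain ⟨M, hM⟩ := exists_sum_proj (𝒜 := 𝒜) (f g)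
  show f g • (g.2 : X.carrier) ∈ X.comp n
  rw [← hM M le_rfl, Finset.sum_smul]
  refine sum_mem fun j _ => ?_
  by_cases h : j + g.1 = n
  · subst h
    exact hX.smul_mem (SetLike.coe_mem _) g.2.2.1
  · rw [hf g j h, zero_smul]
    exact zero_mem _

theorem Syzygy.exists_sum_comp (X : Syzygy A) (f : X.Gen →₀ A) :
    ∃ (N : ℕ) (y : ℕ → X.Gen →₀ A), (∀ n, y n ∈ X.nextComp 𝒜 n) ∧
      ∀ M ≥ N, ∑ n ∈ Finset.range M, y n = f := by
  induction f using Finsupp.induction_linear with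
  | zero => exact ⟨0, 0, fun n => zero_mem _, fun M _ => by simp⟩
  | add f f' hf hf' =>
    obtain ⟨N, y, hy, hN⟩ := hf
    obtain ⟨N', y', hy', hN'⟩ := hf'
    refine ⟨max N N', fun n => y n + y' n, fun n => add_mem (hy n) (hy' n), fun M hM => ?_⟩
    rw [Finset.sum_add_distrib, hN M (le_of_max_le_left hM), hN' M (le_of_max_le_right hM)]
  | single g a =>
    obtain ⟨N, hN⟩ := exists_sum_proj (𝒜 := 𝒜) a
    refine ⟨g.1 + N, fun n => Finsupp.single g
      (if g.1 ≤ n then GradedRing.proj 𝒜 (n - g.1) a else 0), fun n g' j hj => ?_, fun M hM => ?_⟩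
    · rcases eq_or_ne g g' with rfl | hg
      · rw [Finsupp.single_eq_same]
        split_ifs with h
        · rw [proj_proj, if_neg (by omega)]
        · exact map_zero _
      · rw [Finsupp.single_eq_of_ne (Ne.symm hg), map_zero]
    · obtain ⟨K, rfl⟩ := Nat.exists_eq_add_of_le ((Nat.le_add_right _ _).trans hM)
      rw [Finset.sum_range_add, Finset.sum_eq_zero, zero_add]
      · simp only [Nat.le_add_right, if_true, Nat.add_sub_cancel_left]
        exact (map_sum (Finsupp.singleAddHom g) _ _).symm.trans
          (congrArg (Finsupp.single g) (hN K (by omega)))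
      · intro n hn
        rw [Finset.mem_range] at hn
        rw [if_neg (by omega), Finsupp.single_zero]

theorem Syzygy.isGood_next {X : Syzygy A} (hX : IsGood 𝒜 X.comp X.sub) :
    IsGood 𝒜 (X.nextComp 𝒜) (LinearMap.ker X.cover) where
  smul_mem {i j a f} ha hf := by
    intro g k hk
    show GradedRing.proj 𝒜 k (a * f g) = 0
    obtain ⟨M, hM⟩ := exists_sum_proj (𝒜 := 𝒜) (f g)
    rw [← hM M le_rfl, Finset.mul_sum, map_sum]
    refine Finset.sum_eq_zero fun l _ => ?_
    by_cases h : l + g.1 = j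
    · exact DirectSum.decompose_of_mem_ne 𝒜 (SetLike.GradedMul.mul_mem ha (SetLike.coe_mem _))
        (by omega)
    · rw [hf g l h, mul_zero, map_zero]
  indep N x hx h n hn := by
    refine Finsupp.ext fun g => ?_
    obtain ⟨M, hM⟩ := exists_sum_proj (𝒜 := 𝒜) ((x n : X.Gen →₀ A) g)
    rw [← hM M le_rfl]
    refine Finset.sum_eq_zero fun j _ => ?_
    by_cases hj : j + g.1 = n
    · have h1 := congrArg (fun f : X.Gen →₀ A => GradedRing.proj 𝒜 j (f g)) h
      have h2 : GradedRing.proj 𝒜 j ((∑ n ∈ Finset.range N, (x n : X.Gen →₀ A)) g) = 0 :=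
        h1.trans (map_zero _)
      rw [Finsupp.finsetSum_apply, map_sum,
        Finset.sum_eq_single_of_mem n (Finset.mem_range.2 hn)] at h2
      · exact h2
      · intro m _ hm
        exact hx m g j (by omega)
    · exact hx n g j hj
  sub_le f hf := by
    obtain ⟨N, y, hy, hN⟩ := X.exists_sum_comp (𝒜 := 𝒜) f
    have h := hX.indep N (fun n => X.cover (y n)) (fun n => Syzygy.cover_mem hX (hy n)) (by
      rw [← map_sum, hN N le_rfl]; exact hf)
    refine ⟨N, fun n => if n < N then y n else 0, fun n => ?_, ?_⟩
    · by_cases hn : n < N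
      · simp only [if_pos hn]; exact ⟨hy n, h n hn⟩
      · simp only [if_neg hn]; exact ⟨zero_mem _, zero_mem _⟩
    · rw [← hN N le_rfl]
      exact Finset.sum_congr rfl fun n hn => if_pos (Finset.mem_range.1 hn)

theorem augmentation_eq_zero_iff [IsConnected 𝒜] (a : A) :
    augmentation 𝒜 a = 0 ↔ GradedRing.proj 𝒜 0 a = 0 := by
  show (degreeZeroEquiv 𝒜).symm _ = 0 ↔ _
  rw [map_eq_zero_iff _ (RingEquiv.injective _)]
  exact ⟨fun h => congrArg Subtype.val h, fun h => Subtype.ext h⟩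

theorem isGood_augmentation [IsConnected 𝒜] :
    IsGood 𝒜 (M := A) (fun n => (𝒜 n).toAddSubgroup) (RingHom.ker (augmentation 𝒜)) := by
  refine ⟨fun ha hx => SetLike.GradedMul.mul_mem (A := 𝒜) ha hx, fun N x hx h n hn => ?_,
    fun a ha => ?_⟩
  · have h2 := congrArg (GradedRing.proj 𝒜 n) h
    rw [map_zero, map_sum, Finset.sum_eq_single_of_mem n (Finset.mem_range.2 hn)] at h2
    · rw [GradedRing.proj_apply, DirectSum.decompose_of_mem_same 𝒜 (hx n)] at h2
      exact h2
    · intro m _ hm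
      exact DirectSum.decompose_of_mem_ne 𝒜 (hx m) hm
  · obtain ⟨N, hN⟩ := exists_sum_proj (𝒜 := 𝒜) a
    refine ⟨N, fun n => GradedRing.proj 𝒜 n a, fun n => ⟨SetLike.coe_mem _, ?_⟩, hN N le_rfl⟩
    have ha' : GradedRing.proj 𝒜 0 a = 0 := (augmentation_eq_zero_iff a).1 ha
    refine (augmentation_eq_zero_iff _).2 ?_
    rw [proj_proj]
    split_ifs with h0
    · rw [← h0]; exact ha'
    · rfl

theorem resolution_isGood [IsConnected 𝒜] (i : ℕ) :
    IsGood 𝒜 (resolution 𝒜 i).comp (resolution 𝒜 i).sub := by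
  induction i with
  | succ i ih => exact Syzygy.isGood_next ih
  | zero => exact isGood_augmentation

/-- The resolution is exact at `F_0 = A`. -/
theorem range_resolutionD_zero [IsConnected 𝒜] :
    LinearMap.range (resolutionD 𝒜 0) = RingHom.ker (augmentation 𝒜) :=
  Syzygy.range_cover _ (resolution_isGood 0)

/-- The resolution is exact at `F_{i+1}`. -/
theorem range_resolutionD_succ [IsConnected 𝒜] (i : ℕ) :
    LinearMap.range (resolutionD 𝒜 (i + 1)) = LinearMap.ker (resolutionD 𝒜 i) :=
  Syzygy.range_cover _ (resolution_isGood (i + 1))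

variable (𝒜)

/-- The term `S ⊗_A F_i` of the complex computing the torsion groups. -/
abbrev TorChain [IsConnected 𝒜] (i : ℕ) : Type (max u v) :=
  TensorOver A (RightTrivial 𝒜) (resolution 𝒜 i).carrier

/-- The differential `S ⊗_A F_{i+1} → S ⊗_A F_i`. -/
noncomputable def torD [IsConnected 𝒜] (i : ℕ) : TorChain 𝒜 (i + 1) →+ TorChain 𝒜 i :=
  TensorOver.map (RightTrivial 𝒜) (resolutionD 𝒜 i)

/-- The chains of internal degree `n`, generated by the `s ⊗ x` with `x` homogeneous of
degree `n`. -/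
noncomputable def torComp [IsConnected 𝒜] (i n : ℕ) : AddSubgroup (TorChain 𝒜 i) :=
  AddSubgroup.closure {z | ∃ (s : RightTrivial 𝒜) (x : (resolution 𝒜 i).carrier),
    x ∈ (resolution 𝒜 i).comp n ∧ TensorOver.tmul A s x = z}

/-- The cycles of homological degree `i` and internal degree `n`. -/
noncomputable def torCycles [IsConnected 𝒜] : (i n : ℕ) → AddSubgroup (TorChain 𝒜 i)
  | 0, n => torComp 𝒜 0 n
  | i + 1, n => torComp 𝒜 (i + 1) n ⊓ (torD 𝒜 i).ker

/-- The boundaries of homological degree `i` and internal degree `n`. -/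
noncomputable def torBoundaries [IsConnected 𝒜] (i n : ℕ) : AddSubgroup (TorChain 𝒜 i) :=
  (torComp 𝒜 (i + 1) n).map (torD 𝒜 i)

/-- The component `Tor_{i,n}^A(S, S)` of internal degree `n` of `Tor_i^A(S, S)`. -/
abbrev Tor [IsConnected 𝒜] (i n : ℕ) : Type (max u v) :=
  torCycles 𝒜 i n ⧸ (torBoundaries 𝒜 i n).addSubgroupOf (torCycles 𝒜 i n)

open Classical in
/-- The homological complexity `c(A)`: it is `-1` if `Tor_3^A(S, S) = 0`, and the supremum of the
numbers `n - 1` with `Tor_{3,n}^A(S, S) ≠ 0` otherwise. -/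
noncomputable def complexity [IsConnected 𝒜] : EReal :=
  if ∀ n, Subsingleton (Tor 𝒜 3 n) then -1
  else ⨆ (n : ℕ) (_ : Nontrivial (Tor 𝒜 3 n)), ((n : EReal) - 1)

end Resolution

/-! ### The tensor `S`-ring of a connected graded ring -/

section Presentation

variable {S : Type u} {A : Type v} [Ring S] [Ring A] [SRing S A]
  (𝒜 : ℕ → Subbimodule S A) [GradedRing 𝒜]

/-- The tensor `S`-ring `T_A = T_S(A^1)`. -/
abbrev TA : Type _ := TensorRing S (𝒜 1)

/-- The grading of `T_A`. -/
abbrev TAgrade : ℕ → Subbimodule S (TA 𝒜) := TensorRing.grade S (𝒜 1)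

/-- The canonical morphism `π_A : T_A → A`, the identity on `S` and on `A^1`. -/
def piA : TA 𝒜 →+* A :=
  TensorRing.lift SRing.unit (𝒜 1).subtype.toAddMonoidHom
    (fun s v => by
      show Env.tmul s 1 • (v : A) = _
      rw [env_smul_def, map_one, mul_one]; rfl)
    (fun v s => by
      show Env.tmul 1 s • (v : A) = _
      rw [env_smul_def, map_one, one_mul]; rfl)

/-- The kernel `I_A` of `π_A`. -/
def kerPiA : Submodule ℤ (TA 𝒜) := AddSubgroup.toIntSubmodule (piA 𝒜).toAddMonoidHom.ker

end Presentation

end PBW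

open PBW

/-! Write `T = T_A`, `V = A^1`, `I = I_A`. Sending `t r t'` to `t α(r) t'` is not a well-defined map
on `⟨R⟩`; it is an additive relation, recorded degree by degree by `graph`. Its two components
always agree up to lower degree. What obstructs PBW is a pair `(0, y)` in degree `N`: a syzygy among
the `t r t'` producing an element `y` of `⟨α(R)⟩` which need not be a combination of terms `t α(r)
t'` of degree less than `N`. The condition `(J_n)` says exactly that such a `y` is a combination of
this kind in degree `N = n + 1` (`IsFilteredMap.jacobi_iff`).

PBW means that leading components of `⟨P⟩` lie in `⟨R⟩` (`isPBWDeformation_iff`). If the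
obstructions vanish in all degrees, any expression of an element of `⟨α(R)⟩` can be rewritten
without terms above its own degree, and its leading component is then visibly in `⟨R⟩`
(`proj_mem_of_graph_relations`). Conversely, projectivity of `R_P` lifts `R` to a filtered map into
`P` (`exists_isFilteredMap`), and in a PBW-deformation cancelling leading components one after the
other yields all the Jacobi conditions (`mem_idealFilt_of_isPBWDeformation`).

The homological point is that the condition in degree `N` follows from those in lower degrees when
`Tor_{3,N} = 0` (`mem_letterGraph_of_subsingleton_tor`). Lift the bases of `F_1` and `F_2` of the
resolution to `T` and to the graph. Modulo pairs ending with a letter, a pair of degree `N` with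
first component in `I V` is the image `λ(f)` of a family `f` of coefficients in `T^+`; the component
from `R` disappears because `R ∩ (I V + V I) = 0`. The reduction of `f` to `A` is a cycle in `A^+
F_2`, so vanishing of Tor puts it in `A^+ Z_2`, where `Z_2` is the kernel of `F_2 → F_1`. Elements
of `A^+ Z_2` lift to pairs handled in lower degrees, and the remaining coefficients in `I` give
trivial relations, harmless by `IsFilteredMap.graph_comm`. So the pair ends with a letter modulo
harmless terms. A dual basis of `V` then splits `(0, y)` into coordinates which are relations of
degree `N - 1` (`mem_idealFilt_of_mem_letterGraph`). -/

namespace PBW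

/-! ### Coordinates in the tensor ring -/

namespace TensorRing

variable {S V : Type*} [Ring S] [AddCommGroup V] [Module (Env S) V]

theorem induction {p : TensorRing S V → Prop} (unit : ∀ s : S, p (SRing.unit s))
    (gen : ∀ v, p (ι S V v)) (mul : ∀ x y, p x → p y → p (x * y))
    (add : ∀ x y, p x → p y → p (x + y)) (x : TensorRing S V) : p x := by
  obtain ⟨y, rfl⟩ : ∃ y, mk S V y = x := RingQuot.mkAlgHom_surjective ℤ (TensorRel S V) x
  induction y using FreeAlgebra.induction with
  | grade0 n =>
    have h : mk S V (algebraMap ℤ _ n) = SRing.unit (n : S) := by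
      rw [eq_intCast, map_intCast, map_intCast]
    rw [h]; exact unit _
  | grade1 x =>
    cases x with
    | inl s => exact unit s
    | inr v => exact gen v
  | mul a b ha hb => rw [map_mul]; exact mul _ _ ha hb
  | add a b ha hb => rw [map_add]; exact add _ _ ha hb

/-- Every element of the tensor ring is the sum of a scalar and of products `y v`. -/
theorem induction_right {p : TensorRing S V → Prop} (unit : ∀ s : S, p (SRing.unit s))
    (mul_gen : ∀ y v, p (y * ι S V v)) (add : ∀ x y, p x → p y → p (x + y))
    (x : TensorRing S V) : p x := by
  -- The induction carries a prefix `y` and a trailing scalar `s`: `p` itself is not assumed stable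
  -- under scalars, but a scalar after a letter is absorbed by the letter.
  have key : ∀ x y : TensorRing S V, (∀ s : S, p (y * SRing.unit s)) →
      ∀ s : S, p (y * x * SRing.unit s) := by
    intro x
    induction x using induction with
    | unit t => intro y hy s; rw [mul_assoc, ← map_mul]; exact hy _
    | gen v => intro y _ s; rw [mul_assoc, ← ι_right]; exact mul_gen _ _
    | mul a b ha hb => intro y hy s; rw [← mul_assoc]; exact hb _ (ha _ hy) s
    | add a b ha hb =>
      intro y hy s; rw [mul_add, add_mul]; exact add _ _ (ha _ hy s) (hb _ hy s)
  have := key x 1 (fun s => by rw [one_mul]; exact unit s) 1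
  rwa [one_mul, map_one, mul_one] at this

/-- A map `V → S` which is linear for the left action of `S`. -/
def IsLeftLinear (c : V →+ S) : Prop := ∀ (s : S) (v : V), c (Env.tmul s 1 • v) = s * c v

theorem tmul_one_smul_comm (s t : S) (v : V) :
    Env.tmul 1 t • Env.tmul s 1 • v = Env.tmul s 1 • Env.tmul 1 t • v := by
  have h : ∀ a b c d : S, Env.tmul a b * Env.tmul c d = Env.tmul (a * c) (d * b) :=
    fun a b c d => Algebra.TensorProduct.tmul_mul_tmul (R := ℤ) a c (op b) (op d)
  rw [smul_smul, smul_smul, h, h]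
  simp only [one_mul, mul_one]

theorem tmul_one_smul_smul (s t : S) (v : V) :
    Env.tmul 1 t • Env.tmul 1 s • v = Env.tmul 1 (s * t) • v := by
  have h : ∀ a b c d : S, Env.tmul a b * Env.tmul c d = Env.tmul (a * c) (d * b) :=
    fun a b c d => Algebra.TensorProduct.tmul_mul_tmul (R := ℤ) a c (op b) (op d)
  rw [smul_smul, h, one_mul]

theorem tmul_one_one_smul (v : V) : Env.tmul (1 : S) (1 : S) • v = v := one_smul (Env S) v

theorem tmul_one_add (r s : S) : Env.tmul (1 : S) (r + s) = Env.tmul 1 r + Env.tmul 1 s :=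
  TensorProduct.tmul_add (R := ℤ) (1 : S) (op r) (op s)

/-! ### Coordinate maps of degree -1 attached to left linear functionals. -/

section Deriv
variable (c : V →+ S)

/-- The endomorphism `(t, φ) ↦ (t s, φ (s -))` of `T × Hom(S, T)`. -/
def scalarEnd (s : S) : AddMonoid.End (TensorRing S V × (S →+ TensorRing S V)) where
  toFun z := (z.1 * SRing.unit s, z.2.comp (AddMonoidHom.mulLeft s))
  map_zero' := by ext <;> simp
  map_add' z w := by ext <;> simp [add_mul]

/-- The endomorphism `(t, φ) ↦ (t v, t c(v -))` of `T × Hom(S, T)`. -/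
def letterEnd (v : V) : AddMonoid.End (TensorRing S V × (S →+ TensorRing S V)) where
  toFun z := (z.1 * ι S V v, AddMonoidHom.mk' (fun r => z.1 * SRing.unit (c (Env.tmul 1 r • v)))
    fun r s => by rw [tmul_one_add, add_smul, map_add, map_add, mul_add])
  map_zero' := by ext <;> simp
  map_add' z w := by ext <;> simp [add_mul]

/-- The right action of the scalars on `T × Hom(S, T)`. -/
def scalarAction (S V : Type*) [Ring S] [AddCommGroup V] [Module (Env S) V] :
    S →+* (AddMonoid.End (TensorRing S V × (S →+ TensorRing S V)))ᵐᵒᵖ where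
  toFun s := op (scalarEnd s)
  map_one' := MulOpposite.unop_injective (AddMonoidHom.ext fun z => Prod.ext
    (show z.1 * SRing.unit (1 : S) = z.1 by simp)
    (AddMonoidHom.ext fun r => show z.2 (1 * r) = z.2 r by simp))
  map_mul' s t := MulOpposite.unop_injective (AddMonoidHom.ext fun z => Prod.ext
    (show z.1 * SRing.unit (s * t) = z.1 * SRing.unit s * SRing.unit t by simp [mul_assoc])
    (AddMonoidHom.ext fun r => show z.2 (s * t * r) = z.2 (s * (t * r)) by rw [mul_assoc]))
  map_zero' := MulOpposite.unop_injective (AddMonoidHom.ext fun z => Prod.ext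
    (show z.1 * SRing.unit (0 : S) = 0 by simp)
    (AddMonoidHom.ext fun r => show z.2 (0 * r) = 0 by simp))
  map_add' s t := MulOpposite.unop_injective (AddMonoidHom.ext fun z => Prod.ext
    (show z.1 * SRing.unit (s + t) = z.1 * SRing.unit s + z.1 * SRing.unit t by simp [mul_add])
    (AddMonoidHom.ext fun r => show z.2 ((s + t) * r) = z.2 (s * r) + z.2 (t * r) by
      rw [add_mul, map_add]))

/-- The right action of the letters on `T × Hom(S, T)`. -/
def letterAction : V →+ (AddMonoid.End (TensorRing S V × (S →+ TensorRing S V)))ᵐᵒᵖ where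
  toFun v := op (letterEnd c v)
  map_zero' := MulOpposite.unop_injective (AddMonoidHom.ext fun z => Prod.ext
    (show z.1 * ι S V 0 = 0 by simp)
    (AddMonoidHom.ext fun r => show z.1 * SRing.unit (c (Env.tmul 1 r • (0 : V))) = 0 by simp))
  map_add' v w := MulOpposite.unop_injective (AddMonoidHom.ext fun z => Prod.ext
    (show z.1 * ι S V (v + w) = z.1 * ι S V v + z.1 * ι S V w by simp [mul_add])
    (AddMonoidHom.ext fun r => show z.1 * SRing.unit (c (Env.tmul 1 r • (v + w))) =
      z.1 * SRing.unit (c (Env.tmul 1 r • v)) + z.1 * SRing.unit (c (Env.tmul 1 r • w)) by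
      rw [smul_add, map_add, map_add, mul_add]))

/-- This is where left linearity of `c` makes the action well defined. As `c` is not right linear,
`∂(x r)` is not determined by `∂ x`; the second component of the state therefore remembers the whole
function `r ↦ ∂(x r)`. -/
theorem letterAction_left (hc : IsLeftLinear c) (s : S) (v : V) :
    letterAction c (Env.tmul s 1 • v) = scalarAction S V s * letterAction c v :=
  MulOpposite.unop_injective (AddMonoidHom.ext fun z => Prod.ext
    (show z.1 * ι S V (Env.tmul s 1 • v) = z.1 * SRing.unit s * ι S V v by
      rw [ι_left, mul_assoc])
    (AddMonoidHom.ext fun r => show z.1 * SRing.unit (c (Env.tmul 1 r • Env.tmul s 1 • v)) =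
        z.1 * SRing.unit s * SRing.unit (c (Env.tmul 1 r • v)) by
      rw [tmul_one_smul_comm, hc, map_mul, mul_assoc]))

theorem letterAction_right (v : V) (s : S) :
    letterAction c (Env.tmul 1 s • v) = letterAction c v * scalarAction S V s :=
  MulOpposite.unop_injective (AddMonoidHom.ext fun z => Prod.ext
    (show z.1 * ι S V (Env.tmul 1 s • v) = z.1 * ι S V v * SRing.unit s by
      rw [ι_right, mul_assoc])
    (AddMonoidHom.ext fun r => show z.1 * SRing.unit (c (Env.tmul 1 r • Env.tmul 1 s • v)) =
        z.1 * SRing.unit (c (Env.tmul 1 (s * r) • v)) by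
      rw [tmul_one_smul_smul]))

/-- The right action of the tensor ring on `T × Hom(S, T)` for which `(t, φ) s = (t s, φ (s -))`
and `(t, φ) v = (t v, t c(v -))`. -/
def derivAction (hc : IsLeftLinear c) :
    TensorRing S V →+* (AddMonoid.End (TensorRing S V × (S →+ TensorRing S V)))ᵐᵒᵖ :=
  lift (B := (AddMonoid.End (TensorRing S V × (S →+ TensorRing S V)))ᵐᵒᵖ)
    (scalarAction S V) (letterAction c) (letterAction_left c hc) (letterAction_right c)

theorem derivAction_fst (hc : IsLeftLinear c) (x : TensorRing S V)
    (z : TensorRing S V × (S →+ TensorRing S V)) :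
    ((derivAction c hc x).unop z).1 = z.1 * x := by
  induction x using induction generalizing z with
  | unit s => rw [derivAction, lift_unit]; rfl
  | gen v => rw [derivAction, lift_ι]; rfl
  | mul x y hx hy =>
    rw [map_mul, ← mul_assoc, ← hx, ← hy]; rfl
  | add x y hx hy =>
    rw [map_add, mul_add, ← hx, ← hy]; rfl

/-- The additive map `∂ : T → T` with `∂ s = 0` and `∂ (y v) = y c(v)`. -/
def deriv (hc : IsLeftLinear c) : TensorRing S V →+ TensorRing S V where
  toFun x := ((derivAction c hc x).unop (1, 0)).2 1
  map_zero' := by rw [map_zero, MulOpposite.unop_zero]; rfl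
  map_add' x y := by rw [map_add, MulOpposite.unop_add]; rfl

theorem deriv_unit (hc : IsLeftLinear c) (s : S) : deriv c hc (SRing.unit s) = 0 := by
  show ((derivAction c hc _).unop (1, 0)).2 1 = 0
  rw [derivAction, lift_unit]; rfl

theorem deriv_mul_ι (hc : IsLeftLinear c) (y : TensorRing S V) (v : V) :
    deriv c hc (y * ι S V v) = y * SRing.unit (c v) := by
  show ((derivAction c hc _).unop (1, 0)).2 1 = _
  rw [map_mul]
  show ((derivAction c hc (ι S V v)).unop ((derivAction c hc y).unop (1, 0))).2 1 = _
  rw [derivAction, lift_ι]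
  show ((derivAction c hc y).unop (1, 0)).1 * SRing.unit (c (Env.tmul 1 1 • v)) = _
  rw [derivAction_fst, one_mul, tmul_one_one_smul]

end Deriv

/-- A dual basis of a bimodule for its left structure: `v = ∑ F(v)_w w`. -/
structure IsDualBasis (F : V →+ V →₀ S) : Prop where
  left (s : S) (v : V) : F (Env.tmul s 1 • v) = s • F v
  sum (v : V) : ((F v).sum fun w s => Env.tmul s 1 • w) = v

/-- Projectivity gives a left linear section of the canonical map from the free module on the set
`V`, so the dual basis is indexed by `V` itself. -/
theorem exists_isDualBasis (h : LeftProjective S V) : ∃ F : V →+ V →₀ S, IsDualBasis F := by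
  let inst : Module S V := Module.compHom V (Env.includeLeft S)
  obtain ⟨F, hF⟩ := (h : Module.Projective S V).out
  exact ⟨F.toAddMonoidHom, fun s v => F.map_smul s v, fun v => hF v⟩

variable {F : V →+ V →₀ S} (hF : IsDualBasis F)

theorem IsDualBasis.isLeftLinear (hF : IsDualBasis F) (w : V) :
    IsLeftLinear ((Finsupp.applyAddHom w).comp F) := fun s v => by
  show F _ w = s * F v w
  rw [hF.left]; rfl

theorem finite_support_deriv (x : TensorRing S V) :
    (Function.support fun w => deriv _ (hF.isLeftLinear w) x).Finite := by
  induction x using induction_right with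
  | unit s => simp only [deriv_unit]; simp
  | mul_gen y v =>
    simp only [deriv_mul_ι]
    refine (F v).hasFiniteSupport.subset fun w hw => ?_
    contrapose! hw
    have hw : F v w = 0 := by simpa using hw
    show ¬ y * SRing.unit (F v w) ≠ 0
    rw [hw]; simp
  | add x y hx hy =>
    simp only [map_add]
    exact (hx.union hy).subset (Function.support_add _ _)

/-- The left coordinates of an element of `T⁺ = T ⊗ V`: the map with `y v ↦ (y F(v)_w)_w`. -/
noncomputable def coords : TensorRing S V →+ V →₀ TensorRing S V where
  toFun x := Finsupp.ofSupportFinite _ (finite_support_deriv hF x)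
  map_zero' := by ext w; exact map_zero (deriv _ (hF.isLeftLinear w))
  map_add' x y := by ext w; exact map_add (deriv _ (hF.isLeftLinear w)) x y

theorem coords_mul_ι (y : TensorRing S V) (v w : V) :
    coords hF (y * ι S V v) w = y * SRing.unit (F v w) := deriv_mul_ι ..

/-- The elements of positive degree: the combinations of products `y v`. -/
def pos (S V : Type*) [Ring S] [AddCommGroup V] [Module (Env S) V] :
    Submodule (TensorRing S V) (TensorRing S V) :=
  Submodule.span _ (Set.range (ι S V))

theorem pos_induction {p : TensorRing S V → Prop} (mul_gen : ∀ y v, p (y * ι S V v)) (zero : p 0)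
    (add : ∀ x y, p x → p y → p (x + y)) {x : TensorRing S V} (hx : x ∈ pos S V) : p x := by
  induction hx using Submodule.closure_induction with
  | zero => exact zero
  | add x y _ _ hx hy => exact add _ _ hx hy
  | smul_mem y x hx =>
    obtain ⟨v, rfl⟩ := hx
    exact mul_gen y v

theorem mul_ι_mem_pos (y : TensorRing S V) (v : V) : y * ι S V v ∈ pos S V :=
  Submodule.smul_mem _ y (Submodule.subset_span ⟨v, rfl⟩)

/-- Positivity of `x` is essential: coordinates vanish on scalars, so linearity over `T` fails for
`x = 1`. -/
theorem coords_mul (t : TensorRing S V) {x : TensorRing S V} (hx : x ∈ pos S V) :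
    coords hF (t * x) = t • coords hF x := by
  refine pos_induction (p := fun x => coords hF (t * x) = t • coords hF x)
    (fun y v => ?_) ?_ (fun x y hx hy => ?_) hx
  · ext w
    rw [← mul_assoc, coords_mul_ι, Finsupp.smul_apply, coords_mul_ι, smul_eq_mul, mul_assoc]
  · simp
  · rw [mul_add, map_add, map_add, hx, hy, smul_add]

theorem sum_unit_mul_ι (hF : IsDualBasis F) (v : V) :
    ((F v).sum fun w s => SRing.unit s * ι S V w) = ι S V v := by
  conv_rhs => rw [← hF.sum v]
  refine Eq.trans (Finset.sum_congr rfl fun w _ => (ι_left _ _).symm) (map_sum (ι S V) _ _).symm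

theorem linearCombination_coords {x : TensorRing S V} (hx : x ∈ pos S V) :
    Finsupp.linearCombination (TensorRing S V) (ι S V) (coords hF x) = x := by
  refine pos_induction (p := fun x =>
    Finsupp.linearCombination (TensorRing S V) (ι S V) (coords hF x) = x)
    (fun y v => ?_) ?_ (fun x y hx hy => ?_) hx
  · have h : coords hF (y * ι S V v) = y • (F v).mapRange (SRing.unit (T := TensorRing S V))
        (map_zero _) := by
      ext w
      rw [coords_mul_ι]; rfl
    rw [h, map_smul, smul_eq_mul, Finsupp.linearCombination_apply, Finsupp.sum_mapRange_index]
    · simp only [smul_eq_mul]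
      rw [sum_unit_mul_ι hF]
    · simp
  · simp
  · rw [map_add, map_add, hx, hy]

/-- In `s v₁ ⋯ vₙ₊₁ t` the final scalar is absorbed in the last letter, so that every term really
ends with a letter. -/
theorem grade_succ_induction {n : ℕ} {p : TensorRing S V → Prop}
    (mul_gen : ∀ y v, y ∈ grade S V n → p (y * ι S V v)) (zero : p 0)
    (add : ∀ x y, p x → p y → p (x + y)) {x : TensorRing S V} (hx : x ∈ grade S V (n + 1)) :
    p x := by
  refine grade_induction (fun s t l hl => ?_) zero add hx
  obtain ⟨l, v, rfl⟩ := List.eq_nil_or_concat l |>.resolve_left (by rintro rfl; simp at hl)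
  rw [List.concat_eq_append, List.map_append, List.prod_append, List.map_singleton,
    List.prod_singleton, ← mul_assoc, mul_assoc _ (ι S V v), ← ι_right]
  refine mul_gen _ _ (unit_mul_mem s ?_)
  have : l.length = n := by simpa using hl
  exact this ▸ word_mem l

theorem grade_succ_le_pos {n : ℕ} {x : TensorRing S V} (hx : x ∈ grade S V (n + 1)) :
    x ∈ pos S V :=
  grade_succ_induction (p := (· ∈ pos S V)) (fun y v _ => mul_ι_mem_pos y v) (zero_mem _)
    (fun _ _ => add_mem) hx

theorem coords_mem {n : ℕ} {x : TensorRing S V} (hx : x ∈ grade S V (n + 1)) (w : V) :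
    coords hF x w ∈ grade S V n := by
  refine grade_succ_induction (p := fun x => coords hF x w ∈ grade S V n)
    (fun y v hy => ?_) ?_ (fun x y hx hy => ?_) hx
  · rw [coords_mul_ι]; exact mul_unit_mem _ hy
  · rw [map_zero]; exact zero_mem _
  · rw [map_add]; exact add_mem hx hy

theorem mem_grade_one {x : TensorRing S V} (hx : x ∈ grade S V 1) : ∃ v, ι S V v = x := by
  refine grade_succ_induction (p := fun x => ∃ v, ι S V v = x) (fun y v hy => ?_)
    ⟨0, map_zero _⟩ (fun x y hx hy => ?_) hx
  · obtain ⟨s, rfl⟩ := (IsConnected.mem_zero_iff (𝒯 := grade S V) y).1 hy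
    exact ⟨Env.tmul s 1 • v, ι_left s v⟩
  · obtain ⟨v, rfl⟩ := hx
    obtain ⟨w, rfl⟩ := hy
    exact ⟨v + w, map_add _ _ _⟩

end TensorRing

/-! ### The graph of a filtered map -/

/-- Induction on the subgroup generated by a symmetric set. -/
theorem closure_induction_of_neg {G : Type*} [AddCommGroup G] {s : Set G}
    (hs : ∀ x ∈ s, -x ∈ s) {p : G → Prop} (mem : ∀ x ∈ s, p x) (zero : p 0)
    (add : ∀ x y, p x → p y → p (x + y)) {x : G} (hx : x ∈ AddSubgroup.closure s) : p x := by
  suffices h : p x ∧ p (-x) from h.1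
  induction hx using AddSubgroup.closure_induction with
  | mem x hx => exact ⟨mem x hx, mem _ (hs x hx)⟩
  | zero => exact ⟨zero, by rwa [neg_zero]⟩
  | add x y _ _ hx hy =>
    refine ⟨add _ _ hx.1 hy.1, ?_⟩
    rw [neg_add]
    exact add _ _ hx.2 hy.2
  | neg x _ hx => exact ⟨hx.2, by rw [neg_neg]; exact hx.1⟩

section Graph

variable {S T : Type*} [Ring S] [Ring T] [SRing S T] (𝒯 : ℕ → Subbimodule S T)

/-- The elements with components in degrees less than `n`. -/
def lowerDeg (n : ℕ) : AddSubgroup T := AddSubgroup.closure {x | ∃ i < n, x ∈ 𝒯 i}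

variable {𝒯}

theorem mem_lowerDeg {i n : ℕ} (h : i < n) {x : T} (hx : x ∈ 𝒯 i) : x ∈ lowerDeg 𝒯 n :=
  AddSubgroup.subset_closure ⟨i, h, hx⟩

theorem lowerDeg_induction {n : ℕ} {p : T → Prop} (mem : ∀ i < n, ∀ x ∈ 𝒯 i, p x) (zero : p 0)
    (add : ∀ x y, p x → p y → p (x + y)) {x : T} (hx : x ∈ lowerDeg 𝒯 n) : p x :=
  closure_induction_of_neg (s := {x | ∃ i < n, x ∈ 𝒯 i})
    (fun _ ⟨i, hi, hx⟩ => ⟨i, hi, neg_mem hx⟩) (fun x ⟨i, hi, hx⟩ => mem i hi x hx) zero add hx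

theorem lowerDeg_mono {m n : ℕ} (h : m ≤ n) : lowerDeg 𝒯 m ≤ lowerDeg 𝒯 n :=
  AddSubgroup.closure_mono fun _ ⟨i, hi, hx⟩ => ⟨i, hi.trans_le h, hx⟩

theorem lowerDeg_zero {x : T} (hx : x ∈ lowerDeg 𝒯 0) : x = 0 :=
  lowerDeg_induction (p := fun x : T => x = 0) (fun i hi => absurd hi i.not_lt_zero) rfl
    (fun x y hx hy => by rw [hx, hy, add_zero]) hx

/-- Indexing by a strict bound makes the step `0` trivial, which provides the base of the inductions
on degree and the value `T^{≤-1} = 0`. -/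
theorem mem_upTo_iff {n : ℕ} {x : T} : x ∈ upTo 𝒯 n ↔ x ∈ lowerDeg 𝒯 (n + 1) := by
  constructor
  · intro hx
    exact Submodule.iSup_induction (fun i : Set.Iic n => 𝒯 i)
      (motive := (· ∈ lowerDeg 𝒯 (n + 1))) hx
      (fun i x hx => mem_lowerDeg (Nat.lt_succ_of_le i.2) hx) (zero_mem _)
      (fun _ _ => add_mem)
  · intro hx
    exact lowerDeg_induction (p := (· ∈ upTo 𝒯 n))
      (fun i hi x hx => le_upTo (Nat.le_of_lt_succ hi) hx) (zero_mem _) (fun _ _ => add_mem) hx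

theorem exists_mem_lowerDeg [GradedRing 𝒯] (x : T) : ∃ n, x ∈ lowerDeg 𝒯 n := by
  induction x using DirectSum.Decomposition.inductionOn 𝒯 with
  | zero => exact ⟨0, zero_mem _⟩
  | homogeneous x => exact ⟨_, mem_lowerDeg (Nat.lt_succ_self _) x.2⟩
  | add x y hx hy =>
    obtain ⟨m, hm⟩ := hx
    obtain ⟨n, hn⟩ := hy
    exact ⟨max m n, add_mem (lowerDeg_mono (le_max_left _ _) hm)
      (lowerDeg_mono (le_max_right _ _) hn)⟩

section Proj
variable [GradedRing 𝒯]

theorem proj_mem (n : ℕ) (x : T) : GradedRing.proj 𝒯 n x ∈ 𝒯 n := SetLike.coe_mem _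

theorem proj_of_mem {n : ℕ} {x : T} (hx : x ∈ 𝒯 n) : GradedRing.proj 𝒯 n x = x :=
  DirectSum.decompose_of_mem_same 𝒯 hx

theorem proj_of_mem_ne {m n : ℕ} {x : T} (hx : x ∈ 𝒯 m) (h : m ≠ n) :
    GradedRing.proj 𝒯 n x = 0 :=
  DirectSum.decompose_of_mem_ne 𝒯 hx h

theorem proj_lowerDeg {m n : ℕ} (h : m ≤ n) {x : T} (hx : x ∈ lowerDeg 𝒯 m) :
    GradedRing.proj 𝒯 n x = 0 :=
  lowerDeg_induction (p := fun x => GradedRing.proj 𝒯 n x = 0)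
    (fun _ hi _ hx => proj_of_mem_ne hx (hi.trans_le h).ne) (map_zero _)
    (fun x y hx hy => by rw [map_add, hx, hy, add_zero]) hx

theorem sub_proj_mem_lowerDeg {n : ℕ} {x : T} (hx : x ∈ lowerDeg 𝒯 (n + 1)) :
    x - GradedRing.proj 𝒯 n x ∈ lowerDeg 𝒯 n := by
  refine lowerDeg_induction (p := fun x => x - GradedRing.proj 𝒯 n x ∈ lowerDeg 𝒯 n)
    (fun i hi x hx => ?_) ?_ (fun x y hx hy => ?_) hx
  · clear * - hi hx
    rcases eq_or_ne i n with rfl | h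
    · rw [proj_of_mem hx, sub_self]; exact zero_mem _
    · rw [proj_of_mem_ne hx h, sub_zero]; exact mem_lowerDeg (by omega) hx
  · rw [map_zero, sub_zero]; exact zero_mem _
  · rw [map_add, add_sub_add_comm]; exact add_mem hx hy

theorem proj_mul_right {m n : ℕ} {v : T} (hv : v ∈ 𝒯 m) (x : T) :
    GradedRing.proj 𝒯 (n + m) (x * v) = GradedRing.proj 𝒯 n x * v :=
  DirectSum.coe_decompose_mul_add_of_right_mem 𝒯 hv

theorem proj_mul_left {m n : ℕ} {v : T} (hv : v ∈ 𝒯 m) (x : T) :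
    GradedRing.proj 𝒯 (m + n) (v * x) = v * GradedRing.proj 𝒯 n x :=
  DirectSum.coe_decompose_mul_add_of_left_mem 𝒯 hv

end Proj

variable (𝒯) {R : Subbimodule S T} (α : R →ₗ[Env S] T)

/-- The pairs `(∑ t r t', ∑ t α(r) t')` with all terms of total degree `N`. -/
def graph (N : ℕ) : AddSubgroup (T × T) :=
  AddSubgroup.closure {z | ∃ i j k, i + j + k = N ∧ ∃ t ∈ 𝒯 i, ∃ r : R, (r : T) ∈ 𝒯 j ∧
    ∃ t' ∈ 𝒯 k, z = (t * r * t', t * α r * t')}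

/-- The sums of terms `t α(r) t'` of total degree less than `n`. -/
def idealFilt (n : ℕ) : AddSubgroup T :=
  AddSubgroup.closure {y | ∃ N < n, ∃ z ∈ graph 𝒯 α N, y = z.2}

variable {𝒯 α}

theorem mem_graph {i j k N : ℕ} (h : i + j + k = N) {t t' : T} {r : R} (ht : t ∈ 𝒯 i)
    (hr : (r : T) ∈ 𝒯 j) (ht' : t' ∈ 𝒯 k) : (t * r * t', t * α r * t') ∈ graph 𝒯 α N :=
  AddSubgroup.subset_closure ⟨i, j, k, h, t, ht, r, hr, t', ht', rfl⟩

theorem graph_induction {N : ℕ} {p : T × T → Prop}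
    (mem : ∀ i j k, i + j + k = N → ∀ t ∈ 𝒯 i, ∀ r : R, (r : T) ∈ 𝒯 j → ∀ t' ∈ 𝒯 k,
      p (t * r * t', t * α r * t'))
    (zero : p 0) (add : ∀ x y, p x → p y → p (x + y)) {z : T × T} (hz : z ∈ graph 𝒯 α N) :
    p z := by
  refine closure_induction_of_neg ?_ ?_ zero add hz
  · rintro _ ⟨i, j, k, h, t, ht, r, hr, t', ht', rfl⟩
    refine ⟨i, j, k, h, -t, neg_mem ht, r, hr, t', ht', ?_⟩
    simp
  · rintro _ ⟨i, j, k, h, t, ht, r, hr, t', ht', rfl⟩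
    exact mem i j k h t ht r hr t' ht'

theorem snd_mem_idealFilt {N n : ℕ} (h : N < n) {z : T × T} (hz : z ∈ graph 𝒯 α N) :
    z.2 ∈ idealFilt 𝒯 α n := AddSubgroup.subset_closure ⟨N, h, z, hz, rfl⟩

theorem idealFilt_induction {n : ℕ} {p : T → Prop}
    (mem : ∀ N < n, ∀ z ∈ graph 𝒯 α N, p z.2) (zero : p 0)
    (add : ∀ x y, p x → p y → p (x + y)) {y : T} (hy : y ∈ idealFilt 𝒯 α n) : p y := by
  refine closure_induction_of_neg ?_ ?_ zero add hy
  · rintro _ ⟨N, hN, z, hz, rfl⟩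
    exact ⟨N, hN, -z, neg_mem hz, rfl⟩
  · rintro _ ⟨N, hN, z, hz, rfl⟩
    exact mem N hN z hz

theorem idealFilt_mono {m n : ℕ} (h : m ≤ n) : idealFilt 𝒯 α m ≤ idealFilt 𝒯 α n :=
  AddSubgroup.closure_mono fun _ ⟨N, hN, z⟩ => ⟨N, hN.trans_le h, z⟩

/-- An element of the filtration step `n + 1` is the sum of the second component of an element of
the graph of degree `n` and of an element of the filtration step `n`. -/
theorem exists_graph_add_of_mem_idealFilt {n : ℕ} {y : T} (hy : y ∈ idealFilt 𝒯 α (n + 1)) :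
    ∃ z ∈ graph 𝒯 α n, y - z.2 ∈ idealFilt 𝒯 α n := by
  refine idealFilt_induction (p := fun y => ∃ z ∈ graph 𝒯 α n, y - z.2 ∈ idealFilt 𝒯 α n)
    (fun N hN z hz => ?_) ⟨0, zero_mem _, by simp⟩ ?_ hy
  · rcases eq_or_ne N n with rfl | h
    · exact ⟨z, hz, by simp⟩
    · exact ⟨0, zero_mem _, by simpa using snd_mem_idealFilt (by omega) hz⟩
  · rintro x y ⟨z, hz, hx⟩ ⟨w, hw, hy⟩
    refine ⟨z + w, add_mem hz hw, ?_⟩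
    rw [Prod.snd_add, add_sub_add_comm]
    exact add_mem hx hy

section Mul
variable [SetLike.GradedMonoid 𝒯]

theorem graph_mul_left {i N : ℕ} {t : T} (ht : t ∈ 𝒯 i) {z : T × T} (hz : z ∈ graph 𝒯 α N) :
    (t * z.1, t * z.2) ∈ graph 𝒯 α (i + N) := by
  refine graph_induction (p := fun z => (t * z.1, t * z.2) ∈ graph 𝒯 α (i + N))
    (fun a b c h x hx r hr x' hx' => ?_) ?_ (fun x y hx hy => ?_) hz
  · simp only [← mul_assoc]
    exact mem_graph (by omega) (SetLike.GradedMul.mul_mem ht hx) hr hx'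
  · simp only [Prod.fst_zero, Prod.snd_zero, mul_zero]; exact zero_mem _
  · simp only [Prod.fst_add, Prod.snd_add, mul_add]; exact add_mem hx hy

theorem graph_mul_right {i N : ℕ} {t : T} (ht : t ∈ 𝒯 i) {z : T × T} (hz : z ∈ graph 𝒯 α N) :
    (z.1 * t, z.2 * t) ∈ graph 𝒯 α (N + i) := by
  refine graph_induction (p := fun z => (z.1 * t, z.2 * t) ∈ graph 𝒯 α (N + i))
    (fun a b c h x hx r hr x' hx' => ?_) ?_ (fun x y hx hy => ?_) hz
  · simp only [mul_assoc _ _ t]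
    exact mem_graph (by omega) hx hr (SetLike.GradedMul.mul_mem hx' ht)
  · simp only [Prod.fst_zero, Prod.snd_zero, zero_mul]; exact zero_mem _
  · simp only [Prod.fst_add, Prod.snd_add, add_mul]; exact add_mem hx hy

theorem fst_mem_of_mem_graph {N : ℕ} {z : T × T} (hz : z ∈ graph 𝒯 α N) : z.1 ∈ 𝒯 N :=
  graph_induction (p := fun z => z.1 ∈ 𝒯 N)
    (fun _ _ _ h _ ht _ hr _ ht' => h ▸ SetLike.GradedMul.mul_mem
      (SetLike.GradedMul.mul_mem ht hr) ht') (zero_mem _) (fun _ _ => add_mem) hz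

theorem idealFilt_mul_left {i n : ℕ} {t : T} (ht : t ∈ 𝒯 i) {y : T} (hy : y ∈ idealFilt 𝒯 α n) :
    t * y ∈ idealFilt 𝒯 α (i + n) := by
  refine idealFilt_induction (p := fun y => t * y ∈ idealFilt 𝒯 α (i + n))
    (fun N hN z hz => ?_) ?_ (fun x y hx hy => ?_) hy
  · exact snd_mem_idealFilt (by omega) (graph_mul_left ht hz)
  · rw [mul_zero]; exact zero_mem _
  · rw [mul_add]; exact add_mem hx hy

theorem idealFilt_mul_right {i n : ℕ} {t : T} (ht : t ∈ 𝒯 i) {y : T}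
    (hy : y ∈ idealFilt 𝒯 α n) : y * t ∈ idealFilt 𝒯 α (n + i) := by
  refine idealFilt_induction (p := fun y => y * t ∈ idealFilt 𝒯 α (n + i))
    (fun N hN z hz => ?_) ?_ (fun x y hx hy => ?_) hy
  · exact snd_mem_idealFilt (by omega) (graph_mul_right ht hz)
  · rw [zero_mul]; exact zero_mem _
  · rw [add_mul]; exact add_mem hx hy

theorem lowerDeg_mul_idealFilt {m n : ℕ} {t : T} (ht : t ∈ lowerDeg 𝒯 m) {y : T}
    (hy : y ∈ idealFilt 𝒯 α (n + 1)) : t * y ∈ idealFilt 𝒯 α (m + n) := by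
  refine lowerDeg_induction (p := fun t => t * y ∈ idealFilt 𝒯 α (m + n))
    (fun i hi x hx => idealFilt_mono (by omega) (idealFilt_mul_left hx hy)) ?_
    (fun x x' hx hx' => ?_) ht
  · rw [zero_mul]; exact zero_mem _
  · rw [add_mul]; exact add_mem hx hx'

theorem idealFilt_mul_lowerDeg {m n : ℕ} {t : T} (ht : t ∈ lowerDeg 𝒯 m) {y : T}
    (hy : y ∈ idealFilt 𝒯 α (n + 1)) : y * t ∈ idealFilt 𝒯 α (n + m) := by
  refine lowerDeg_induction (p := fun t => y * t ∈ idealFilt 𝒯 α (n + m))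
    (fun i hi x hx => idealFilt_mono (by omega) (idealFilt_mul_right hx hy)) ?_
    (fun x x' hx hx' => ?_) ht
  · rw [mul_zero]; exact zero_mem _
  · rw [mul_add]; exact add_mem hx hx'

theorem lowerDeg_mul_mem {m n : ℕ} {t : T} (ht : t ∈ lowerDeg 𝒯 m) {x : T} (hx : x ∈ 𝒯 n) :
    t * x ∈ lowerDeg 𝒯 (m + n) := by
  refine lowerDeg_induction (p := fun t => t * x ∈ lowerDeg 𝒯 (m + n))
    (fun i hi t ht => mem_lowerDeg (by omega) (SetLike.GradedMul.mul_mem ht hx)) ?_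
    (fun x x' hx hx' => ?_) ht
  · rw [zero_mul]; exact zero_mem _
  · rw [add_mul]; exact add_mem hx hx'

theorem mem_mul_lowerDeg {m n : ℕ} {t : T} (ht : t ∈ lowerDeg 𝒯 m) {x : T} (hx : x ∈ 𝒯 n) :
    x * t ∈ lowerDeg 𝒯 (n + m) := by
  refine lowerDeg_induction (p := fun t => x * t ∈ lowerDeg 𝒯 (n + m))
    (fun i hi t ht => mem_lowerDeg (by omega) (SetLike.GradedMul.mul_mem hx ht)) ?_
    (fun x x' hx hx' => ?_) ht
  · rw [mul_zero]; exact zero_mem _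
  · rw [mul_add]; exact add_mem hx hx'

end Mul

theorem idealFilt_le_ideal {n : ℕ} {y : T} (hy : y ∈ idealFilt 𝒯 α n) :
    y ∈ ideal (LinearMap.range α) := by
  refine idealFilt_induction (p := (· ∈ ideal (LinearMap.range α))) (fun N _ z hz => ?_)
    (zero_mem _) (fun _ _ => add_mem) hy
  refine graph_induction (p := fun z => z.2 ∈ ideal (LinearMap.range α))
    (fun i j k _ t _ r _ t' _ => ?_) (zero_mem _) (fun _ _ => add_mem) hz
  exact TwoSidedIdeal.mul_mem_right _ _ _ (TwoSidedIdeal.mul_mem_left _ _ _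
    (TwoSidedIdeal.subset_span ⟨r, rfl⟩))

section Filtered
variable [GradedRing 𝒯] (hα : IsFilteredMap 𝒯 α)

theorem IsFilteredMap.self_sub_mem (hα : IsFilteredMap 𝒯 α) {n : ℕ} {r : R} (hr : (r : T) ∈ 𝒯 n) :
    (r : T) - α r ∈ lowerDeg 𝒯 n := by
  obtain ⟨h1, h2⟩ := hα n r hr
  have := neg_mem (sub_proj_mem_lowerDeg (mem_upTo_iff.1 h1))
  rwa [h2, neg_sub] at this

/-- Replacing `r` by `α(r)` inside `t r t'` changes only terms of lower degree, so the first
component is the leading part of the second. -/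
theorem IsFilteredMap.graph_sub_mem (hα : IsFilteredMap 𝒯 α) {N : ℕ} {z : T × T} (hz : z ∈ graph 𝒯 α N) :
    z.1 - z.2 ∈ lowerDeg 𝒯 N := by
  refine graph_induction (p := fun z => z.1 - z.2 ∈ lowerDeg 𝒯 N)
    (fun i j k h t ht r hr t' ht' => ?_) (by simp) (fun x y hx hy => ?_) hz
  · rw [← sub_mul, ← mul_sub, ← h]
    exact lowerDeg_mul_mem (mem_mul_lowerDeg (hα.self_sub_mem hr) ht) ht'
  · rw [Prod.fst_add, Prod.snd_add, add_sub_add_comm]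
    exact add_mem hx hy

theorem IsFilteredMap.idealFilt_le (hα : IsFilteredMap 𝒯 α) {n : ℕ} {y : T} (hy : y ∈ idealFilt 𝒯 α n) :
    y ∈ lowerDeg 𝒯 n := by
  refine idealFilt_induction (p := (· ∈ lowerDeg 𝒯 n)) (fun N hN z hz => ?_)
    (zero_mem _) (fun _ _ => add_mem) hy
  have h1 := lowerDeg_mono hN.le (hα.graph_sub_mem hz)
  have h2 := mem_lowerDeg hN (fst_mem_of_mem_graph hz)
  have := sub_mem h2 h1
  rwa [sub_sub_cancel] at this

/-- The commutation of two elements of the graph: the trivial relations do not produce elements of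
unexpected degree. -/
theorem IsFilteredMap.graph_comm (hα : IsFilteredMap 𝒯 α) {a b : ℕ} {z w : T × T} (hz : z ∈ graph 𝒯 α a)
    (hw : w ∈ graph 𝒯 α b) : z.1 * w.2 - z.2 * w.1 ∈ idealFilt 𝒯 α (a + b) := by
  -- Inserting `z.2 * w.2` produces the factors `z.1 - z.2` and `w.1 - w.2`, each of which loses a
  -- degree, while the other factor stays in the ideal.
  have h : z.1 * w.2 - z.2 * w.1 = (z.1 - z.2) * w.2 - z.2 * (w.1 - w.2) := by noncomm_ring
  rw [h]
  exact sub_mem (lowerDeg_mul_idealFilt (hα.graph_sub_mem hz) (snd_mem_idealFilt b.lt_succ_self hw))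
    (idealFilt_mul_lowerDeg (hα.graph_sub_mem hw) (snd_mem_idealFilt a.lt_succ_self hz))

end Filtered
end Graph

/-! ### A criterion for PBW-deformations -/

section Criterion

variable {S T : Type*} [Ring S] [Ring T] [SRing S T] {𝒯 : ℕ → Subbimodule S T}

theorem quotRing_mk_eq_zero {X : Subbimodule S T} {x : T} :
    QuotRing.mk X x = 0 ↔ x ∈ ideal X := by
  rw [← map_zero (QuotRing.mk X)]
  exact (RingCon.eq _).trans (TwoSidedIdeal.mem_iff _ _).symm

theorem mem_below_quotFilt {P : Subbimodule S T} {n : ℕ} {x : T} :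
    QuotRing.mk P x ∈ below (quotFilt 𝒯 P) n ↔ ∃ w ∈ lowerDeg 𝒯 n, x - w ∈ ideal P := by
  cases n with
  | zero =>
    refine (show QuotRing.mk P x ∈ (⊥ : AddSubgroup (QuotRing P)) ↔ _ from ?_)
    rw [AddSubgroup.mem_bot, quotRing_mk_eq_zero]
    refine ⟨fun h => ⟨0, zero_mem _, by rwa [sub_zero]⟩, ?_⟩
    rintro ⟨w, hw, h⟩
    rwa [lowerDeg_zero hw, sub_zero] at h
  | succ n =>
    constructor
    · rintro ⟨w, hw, h⟩
      refine ⟨w, mem_upTo_iff.1 hw, ?_⟩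
      rw [← quotRing_mk_eq_zero, map_sub, sub_eq_zero]
      exact h.symm
    · rintro ⟨w, hw, h⟩
      refine ⟨w, mem_upTo_iff.2 hw, ?_⟩
      rw [← quotRing_mk_eq_zero, map_sub, sub_eq_zero] at h
      exact h.symm

variable [GradedRing 𝒯]

theorem phi_apply (P : Subbimodule S T) (x : T) (n : ℕ) :
    phi 𝒯 P x n = phiComponent 𝒯 P n (DirectSum.decompose 𝒯 x n) := by
  induction x using DirectSum.Decomposition.inductionOn 𝒯 with
  | zero => simp
  | @homogeneous i x =>
    rw [phi_of_mem 𝒯 P x.2, DirectSum.decompose_coe]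
    rcases eq_or_ne i n with rfl | h
    · rw [DirectSum.of_eq_same, DirectSum.of_eq_same]
    · rw [DirectSum.of_eq_of_ne _ _ _ h.symm, DirectSum.of_eq_of_ne _ _ _ h.symm, map_zero]
  | add x y hx hy =>
    rw [map_add, DirectSum.add_apply, hx, hy, DirectSum.decompose_add, DirectSum.add_apply,
      map_add]

theorem phi_eq_zero_iff (P : Subbimodule S T) (x : T) :
    phi 𝒯 P x = 0 ↔ ∀ n, ∃ w ∈ lowerDeg 𝒯 n, GradedRing.proj 𝒯 n x - w ∈ ideal P := by
  rw [DFinsupp.ext_iff]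
  refine forall_congr' fun n => ?_
  rw [phi_apply]
  exact (Gr.mk_eq_zero _).trans mem_below_quotFilt

theorem Phi_mk (P R : Subbimodule S T) (h : R ≤ leading 𝒯 P) (x : T) :
    Phi 𝒯 P R h (QuotRing.mk R x) = phi 𝒯 P x := rfl

/-- An element of `T^{≤n}` and its component of degree `n` have the same class in `gr^n`. Hence only
injectivity is at stake in the PBW property. -/
theorem Phi_surjective (P R : Subbimodule S T) (h : R ≤ leading 𝒯 P) :
    Function.Surjective (Phi 𝒯 P R h) := by
  intro y
  induction y using DirectSum.induction_on with
  | zero => exact ⟨0, map_zero _⟩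
  | add x y hx hy =>
    obtain ⟨a, rfl⟩ := hx
    obtain ⟨b, rfl⟩ := hy
    exact ⟨a + b, map_add _ _ _⟩
  | of n y =>
    obtain ⟨⟨_, x, hx, rfl⟩, rfl⟩ := Gr.mk_surjective _ n y
    refine ⟨QuotRing.mk R (GradedRing.proj 𝒯 n x), ?_⟩
    rw [Phi_mk, phi_of_mem 𝒯 P (proj_mem n x)]
    congr 1
    refine sub_eq_zero.1 ((map_sub (Gr.mk (quotFilt 𝒯 P) n) _ _).symm.trans
      ((Gr.mk_eq_zero _).2 ?_))
    have := neg_mem (sub_proj_mem_below hx P)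
    rw [map_sub, neg_sub] at this
    exact this

theorem mem_of_proj_mem {X : TwoSidedIdeal T} {x : T}
    (h : ∀ n, GradedRing.proj 𝒯 n x ∈ X) : x ∈ X := by
  classical
  rw [← DirectSum.sum_support_decompose 𝒯 x]
  exact sum_mem fun n _ => h n

/-- `U(P)` is a PBW-deformation of `A(R)` if and only if the components of highest degree of the
elements of `⟨P⟩` lie in `⟨R⟩`. -/
theorem isPBWDeformation_iff {P R : Subbimodule S T} (h : R ≤ leading 𝒯 P) :
    IsPBWDeformation 𝒯 P R h ↔
      ∀ n, ∀ z ∈ lowerDeg 𝒯 (n + 1), z ∈ ideal P → GradedRing.proj 𝒯 n z ∈ ideal R := by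
  constructor
  · intro hb n z hz hP
    rw [← quotRing_mk_eq_zero]
    refine hb.1 ?_
    rw [map_zero, Phi_mk, phi_eq_zero_iff]
    intro m
    rcases eq_or_ne n m with rfl | hm
    · refine ⟨-(z - GradedRing.proj 𝒯 n z), neg_mem (sub_proj_mem_lowerDeg hz), ?_⟩
      rw [proj_of_mem (proj_mem n z), sub_neg_eq_add, add_sub_cancel]
      exact hP
    · exact ⟨0, zero_mem _, by
        rw [proj_of_mem_ne (proj_mem n z) hm, sub_zero]; exact zero_mem _⟩
  · intro H
    refine ⟨?_, Phi_surjective P R h⟩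
    rw [injective_iff_map_eq_zero]
    intro y hy
    obtain ⟨x, rfl⟩ : ∃ x, QuotRing.mk R x = y := RingCon.mk'_surjective _ y
    rw [Phi_mk, phi_eq_zero_iff] at hy
    rw [quotRing_mk_eq_zero]
    refine mem_of_proj_mem (𝒯 := 𝒯) fun n => ?_
    obtain ⟨w, hw, hP⟩ := hy n
    have := H n _ (sub_mem (mem_lowerDeg n.lt_succ_self (proj_mem n x))
      (lowerDeg_mono n.le_succ hw)) hP
    rwa [map_sub, proj_of_mem (proj_mem n x), proj_lowerDeg le_rfl hw, sub_zero] at this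

end Criterion

/-! ### The Jacobi conditions -/

section Jacobi

variable {S T : Type*} [Ring S] [Ring T] [SRing S T] {𝒯 : ℕ → Subbimodule S T} [GradedRing 𝒯]
  {R : Subbimodule S T} {α : R →ₗ[Env S] T}

theorem lowerDeg_mul_graph {m j : ℕ} {t t' : T} (n : ℕ) (ht : t ∈ lowerDeg 𝒯 (m + 1))
    (ht' : t' ∈ lowerDeg 𝒯 (n + 1)) {y : T} (hy : y ∈ idealFilt 𝒯 α (j + 1)) :
    t * y * t' ∈ idealFilt 𝒯 α (m + j + n + 1) := by
  have h1 := lowerDeg_mul_idealFilt ht hy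
  rw [show m + 1 + j = m + j + 1 by omega] at h1
  have h2 := idealFilt_mul_lowerDeg ht' h1
  rwa [show m + j + (n + 1) = m + j + n + 1 by omega] at h2

/-- An element of `R` whose image has components in degrees at most `j` is the sum of homogeneous
elements of `R` of degrees at most `j`. -/
theorem IsFilteredMap.mem_idealFilt (hα : IsFilteredMap 𝒯 α) (hR : IsGradedSub 𝒯 R) {j : ℕ}
    {r : R} (h : α r ∈ lowerDeg 𝒯 j) : α r ∈ idealFilt 𝒯 α j := by
  have hgen : ∀ k n (r : R), n ≤ k → (r : T) ∈ 𝒯 n → α r ∈ idealFilt 𝒯 α (k + 1) :=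
    fun k n r hk hr => by
      have := mem_graph (α := α) (show 0 + n + 0 = n by omega)
        (SetLike.GradedOne.one_mem (A := 𝒯)) hr SetLike.GradedOne.one_mem
      simpa using snd_mem_idealFilt (Nat.lt_succ_of_le hk) this
  have key : ∀ n (r : R), (r : T) ∈ lowerDeg 𝒯 n → α r ∈ lowerDeg 𝒯 j →
      α r ∈ idealFilt 𝒯 α j := by
    intro n
    induction n with
    | zero =>
      intro r hr _
      have : r = 0 := Subtype.ext (lowerDeg_zero hr)
      rw [this, map_zero]; exact zero_mem _
    | succ n ih =>
      intro r hr hj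
      let s : R := ⟨GradedRing.proj 𝒯 n r, hR r r.2 n⟩
      have hs : (s : T) ∈ 𝒯 n := proj_mem n _
      have hrs : ((r - s : R) : T) ∈ lowerDeg 𝒯 n := sub_proj_mem_lowerDeg hr
      rcases lt_or_ge n j with hn | hn
      · have h1 : α s ∈ lowerDeg 𝒯 j := lowerDeg_mono hn (mem_upTo_iff.1 (hα n s hs).1)
        have h2 := ih (r - s) hrs (by rw [map_sub]; exact sub_mem hj h1)
        have h3 := idealFilt_mono hn (hgen n n s le_rfl hs)
        rw [map_sub] at h2
        simpa using add_mem h2 h3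
      -- For `n ≥ j` the component `s` is zero: `α r` and `r` have the same component of degree `n`,
      -- and `α r` lives in degrees below `j`. The auxiliary bound extends `self_sub_mem` to
      -- non-homogeneous elements.
      · have h1 : ∀ m (r : R), (r : T) ∈ lowerDeg 𝒯 m → (r : T) - α r ∈ lowerDeg 𝒯 m := by
          intro m
          induction m with
          | zero =>
            intro r hr
            have : r = 0 := Subtype.ext (lowerDeg_zero hr)
            rw [this, map_zero]; simp
          | succ m ih =>
            intro r hr
            let s : R := ⟨GradedRing.proj 𝒯 m r, hR r r.2 m⟩
            have hs : (s : T) ∈ 𝒯 m := proj_mem m _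
            have h1 := ih (r - s) (sub_proj_mem_lowerDeg hr)
            have h2 := add_mem h1 (hα.self_sub_mem hs)
            rw [map_sub, Submodule.coe_sub] at h2
            refine lowerDeg_mono m.le_succ ?_
            convert h2 using 1
            abel
        have h2 := h1 n (r - s) hrs
        have h3 : GradedRing.proj 𝒯 n (α r) = s := by
          have h4 : α r = α (r - s) + α s := by rw [← map_add, sub_add_cancel]
          have h5 := proj_lowerDeg le_rfl (sub_mem hrs h2)
          rw [sub_sub_cancel] at h5
          rw [h4, map_add, h5, (hα n s hs).2, zero_add]
        rw [proj_lowerDeg hn hj] at h3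
        have h4 : r = r - s := by
          have : s = 0 := Subtype.ext h3.symm
          rw [this, sub_zero]
        exact ih r (h4 ▸ hrs) hj
  obtain ⟨n, hn⟩ := exists_mem_lowerDeg (𝒯 := 𝒯) (r : T)
  exact key n r hn h

/-- One filtration uses all elements of `α(R) ∩ T^{≤j}`, the other only images of homogeneous
elements; `mem_idealFilt` reconciles them. The shift of index comes from the strict bound in
`idealFilt`. -/
theorem IsFilteredMap.mem_jacobiFilt_iff (hα : IsFilteredMap 𝒯 α) (hR : IsGradedSub 𝒯 R) {n : ℕ}
    {y : T} : y ∈ jacobiFilt 𝒯 (LinearMap.range α) n ↔ y ∈ idealFilt 𝒯 α (n + 1) := by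
  constructor
  · suffices h : jacobiFilt 𝒯 (LinearMap.range α) n ≤
        AddSubgroup.toIntSubmodule (idealFilt 𝒯 α (n + 1)) from fun hy => h hy
    refine iSup_le fun i => iSup_le fun j => iSup_le fun k => iSup_le fun hn => ?_
    rw [Submodule.mul_le]
    intro x hx t' ht'
    refine Submodule.mul_induction_on hx (fun t ht y hy => ?_) (fun x y hx hy => ?_)
    · obtain ⟨⟨r, rfl⟩, hr⟩ := hy
      have h1 := hα.mem_idealFilt hR (mem_upTo_iff.1 hr)
      have := lowerDeg_mul_graph k (mem_upTo_iff.1 ht) (mem_upTo_iff.1 ht') h1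
      rw [hn] at this
      exact this
    · rw [add_mul]; exact add_mem hx hy
  · intro hy
    refine idealFilt_induction (p := (· ∈ jacobiFilt 𝒯 (LinearMap.range α) n))
      (fun N hN z hz => ?_) (zero_mem _) (fun _ _ => add_mem) hy
    refine graph_induction (p := fun z => z.2 ∈ jacobiFilt 𝒯 (LinearMap.range α) n)
      (fun i j k h t ht r hr t' ht' => ?_) (zero_mem _) (fun _ _ => add_mem) hz
    -- The total degree may be smaller than `n`; the slack is put into the bound on the right
    -- factor.
    refine (le_iSup_of_le i <| le_iSup_of_le j <| le_iSup_of_le (n - i - j) <|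
      le_iSup_of_le (by omega) le_rfl :
      (upTo 𝒯 i).toZ * Subbimodule.toZ (LinearMap.range α ⊓ upTo 𝒯 j) *
        (upTo 𝒯 (n - i - j)).toZ ≤
        jacobiFilt 𝒯 (LinearMap.range α) n) ?_
    exact Submodule.mul_mem_mul (Submodule.mul_mem_mul (le_upTo le_rfl ht)
      ⟨⟨r, rfl⟩, (hα j r hr).1⟩) (le_upTo (by omega) ht')

/-- The Jacobi condition `(J_n)` in terms of the graph: the relations in degree `n + 1` between the
elements `t r t'` produce no elements of unexpected degree. -/
theorem IsFilteredMap.jacobi_iff (hα : IsFilteredMap 𝒯 α) (hR : IsGradedSub 𝒯 R) {n : ℕ} :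
    Jacobi 𝒯 (LinearMap.range α) n ↔
      ∀ y, (0, y) ∈ graph 𝒯 α (n + 1) → y ∈ idealFilt 𝒯 α (n + 1) := by
  constructor
  · intro h y hy
    rw [← hα.mem_jacobiFilt_iff hR]
    refine h ⟨(hα.mem_jacobiFilt_iff hR).2 (snd_mem_idealFilt (by omega) hy), ?_⟩
    refine mem_upTo_iff.2 ?_
    simpa using hα.graph_sub_mem hy
  · rintro h y ⟨h1, h2⟩
    have h1 := (hα.mem_jacobiFilt_iff hR).1 h1
    have h2 := mem_upTo_iff.1 h2
    refine (hα.mem_jacobiFilt_iff hR).2 ?_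
    -- The part of degree `n + 1` is isolated. As `y` has degree at most `n`, comparing components
    -- of degree `n + 1` gives `z.1 = 0`.
    obtain ⟨z, hz, hyz⟩ := exists_graph_add_of_mem_idealFilt h1
    have h3 := proj_lowerDeg le_rfl (hα.idealFilt_le hyz)
    rw [map_sub, proj_lowerDeg le_rfl h2, zero_sub, neg_eq_zero] at h3
    have h4 := proj_lowerDeg le_rfl (hα.graph_sub_mem hz)
    rw [map_sub, h3, sub_zero, proj_of_mem (fst_mem_of_mem_graph hz)] at h4
    have h5 := h z.2 (by rw [← h4]; exact hz)
    simpa using add_mem hyz h5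

/-- The step `n` found here may far exceed the degree of `y`; bringing it down to that degree is the
content of the PBW property. -/
theorem IsFilteredMap.exists_mem_idealFilt (hα : IsFilteredMap 𝒯 α) (hR : IsGradedSub 𝒯 R) {y : T}
    (hy : y ∈ ideal (LinearMap.range α)) : ∃ n, y ∈ idealFilt 𝒯 α n := by
  induction hy using TwoSidedIdeal.span_induction with
  | mem x hx =>
    obtain ⟨r, rfl⟩ := hx
    obtain ⟨n, hn⟩ := exists_mem_lowerDeg (𝒯 := 𝒯) (α r)
    exact ⟨n, hα.mem_idealFilt hR hn⟩
  | zero => exact ⟨0, zero_mem _⟩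
  | add x y _ _ hx hy =>
    obtain ⟨m, hm⟩ := hx
    obtain ⟨n, hn⟩ := hy
    exact ⟨max m n, add_mem (idealFilt_mono (le_max_left _ _) hm)
      (idealFilt_mono (le_max_right _ _) hn)⟩
  | neg x _ hx =>
    obtain ⟨n, hn⟩ := hx
    exact ⟨n, neg_mem hn⟩
  | left_absorb a x _ hx =>
    obtain ⟨n, hn⟩ := hx
    obtain ⟨m, hm⟩ := exists_mem_lowerDeg (𝒯 := 𝒯) a
    exact ⟨m + n, lowerDeg_mul_idealFilt hm (idealFilt_mono n.le_succ hn)⟩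
  | right_absorb a x _ hx =>
    obtain ⟨n, hn⟩ := hx
    obtain ⟨m, hm⟩ := exists_mem_lowerDeg (𝒯 := 𝒯) a
    exact ⟨n + m, idealFilt_mul_lowerDeg hm (idealFilt_mono n.le_succ hn)⟩

end Jacobi

/-! ### The presentation of a strongly graded connected ring -/

section Presentation

variable {S : Type u} {A : Type v} [Ring S] [Ring A] [SRing S A]
  {𝒜 : ℕ → Subbimodule S A} {R : Subbimodule S (TA 𝒜)}

theorem mem_kerPiA {x : TA 𝒜} : x ∈ kerPiA 𝒜 ↔ piA 𝒜 x = 0 := Iff.rfl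

theorem piA_unit (s : S) : piA 𝒜 (SRing.unit s) = SRing.unit s := TensorRing.lift_unit ..

theorem piA_ι (v : 𝒜 1) : piA 𝒜 (TensorRing.ι S (𝒜 1) v) = v := TensorRing.lift_ι ..

theorem IsBimoduleOfRelations.mem_kerPiA (hR : IsBimoduleOfRelations (TAgrade 𝒜) R (kerPiA 𝒜))
    {r : TA 𝒜} (hr : r ∈ R) : r ∈ kerPiA 𝒜 := by
  rw [← hR.sup_eq]
  exact Submodule.mem_sup_left hr

theorem IsBimoduleOfRelations.eq_zero_of_mem
    (hR : IsBimoduleOfRelations (TAgrade 𝒜) R (kerPiA 𝒜)) {r : TA 𝒜} (hr : r ∈ R)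
    (h : r ∈ kerPiA 𝒜 * (TAgrade 𝒜 1).toZ + (TAgrade 𝒜 1).toZ * kerPiA 𝒜) : r = 0 := by
  have : r ∈ R.toZ ⊓ (kerPiA 𝒜 * (TAgrade 𝒜 1).toZ + (TAgrade 𝒜 1).toZ * kerPiA 𝒜) := ⟨hr, h⟩
  rwa [hR.inf_eq] at this

theorem mul_mem_kerPiA_left (t : TA 𝒜) {x : TA 𝒜} (hx : x ∈ kerPiA 𝒜) : t * x ∈ kerPiA 𝒜 := by
  rw [mem_kerPiA] at hx ⊢
  rw [map_mul, hx, mul_zero]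

theorem mul_mem_kerPiA_right (t : TA 𝒜) {x : TA 𝒜} (hx : x ∈ kerPiA 𝒜) : x * t ∈ kerPiA 𝒜 := by
  rw [mem_kerPiA] at hx ⊢
  rw [map_mul, hx, zero_mul]

theorem eq_zero_of_mem_kerPiA_one {x : TA 𝒜} (h : x ∈ TAgrade 𝒜 1) (hx : x ∈ kerPiA 𝒜) :
    x = 0 := by
  obtain ⟨v, rfl⟩ := TensorRing.mem_grade_one h
  rw [mem_kerPiA, piA_ι] at hx
  have hv : v = 0 := Subtype.ext hx
  rw [hv, map_zero]

theorem IsBimoduleOfRelations.graph_fst_mem (hR : IsBimoduleOfRelations (TAgrade 𝒜) R (kerPiA 𝒜))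
    {α : R →ₗ[Env S] TA 𝒜} {N : ℕ} {z : TA 𝒜 × TA 𝒜} (hz : z ∈ graph (TAgrade 𝒜) α N) :
    z.1 ∈ kerPiA 𝒜 :=
  graph_induction (p := fun z => z.1 ∈ kerPiA 𝒜)
    (fun _ _ _ _ _ _ r _ _ _ => mul_mem_kerPiA_right _
      (mul_mem_kerPiA_left _ (hR.mem_kerPiA r.2))) (zero_mem _) (fun _ _ => add_mem) hz

variable [GradedRing 𝒜]

theorem unit_mem_zero (s : S) : SRing.unit s ∈ 𝒜 0 := by
  have := (𝒜 0).smul_mem (Env.tmul s 1) (SetLike.GradedOne.one_mem (A := 𝒜))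
  rwa [env_smul_def, map_one, mul_one, mul_one] at this

theorem piA_mem {n : ℕ} {x : TA 𝒜} (hx : x ∈ TAgrade 𝒜 n) : piA 𝒜 x ∈ 𝒜 n := by
  induction n generalizing x with
  | zero =>
    obtain ⟨s, rfl⟩ := (IsConnected.mem_zero_iff (𝒯 := TAgrade 𝒜) x).1 hx
    rw [piA_unit]; exact unit_mem_zero s
  | succ n ih =>
    refine TensorRing.grade_succ_induction (p := fun x => piA 𝒜 x ∈ 𝒜 (n + 1))
      (fun y v hy => ?_) ?_ (fun x y hx hy => ?_) hx
    · rw [map_mul, piA_ι]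
      exact SetLike.GradedMul.mul_mem (ih hy) v.2
    · rw [map_zero]; exact zero_mem _
    · rw [map_add]; exact add_mem hx hy

theorem piA_proj (n : ℕ) (x : TA 𝒜) :
    piA 𝒜 (GradedRing.proj (TAgrade 𝒜) n x) = GradedRing.proj 𝒜 n (piA 𝒜 x) := by
  induction x using DirectSum.Decomposition.inductionOn (TAgrade 𝒜) with
  | zero => simp only [map_zero]
  | @homogeneous i x =>
    rcases eq_or_ne i n with rfl | h
    · rw [proj_of_mem x.2, proj_of_mem (piA_mem x.2)]
    · rw [proj_of_mem_ne x.2 h, proj_of_mem_ne (piA_mem x.2) h, map_zero]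
  | add x y hx hy => simp only [map_add, hx, hy]

theorem proj_mem_kerPiA {x : TA 𝒜} (hx : x ∈ kerPiA 𝒜) (n : ℕ) :
    GradedRing.proj (TAgrade 𝒜) n x ∈ kerPiA 𝒜 := by
  rw [mem_kerPiA] at hx ⊢
  rw [piA_proj, hx, map_zero]

theorem eq_zero_of_mem_kerPiA_zero [IsConnected 𝒜] {x : TA 𝒜} (h : x ∈ TAgrade 𝒜 0)
    (hx : x ∈ kerPiA 𝒜) : x = 0 := by
  obtain ⟨s, rfl⟩ := (IsConnected.mem_zero_iff (𝒯 := TAgrade 𝒜) x).1 h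
  rw [mem_kerPiA, piA_unit] at hx
  rw [IsConnected.unit_injective (𝒯 := 𝒜) (hx.trans (map_zero SRing.unit).symm), map_zero]

theorem exists_lift [IsConnected 𝒜] (hA : IsStronglyGraded 𝒜) {n : ℕ} {a : A} (ha : a ∈ 𝒜 n) :
    ∃ t ∈ TAgrade 𝒜 n, piA 𝒜 t = a := by
  induction n generalizing a with
  | zero =>
    obtain ⟨s, rfl⟩ := (IsConnected.mem_zero_iff (𝒯 := 𝒜) a).1 ha
    exact ⟨SRing.unit s, TensorRing.unit_mem s, piA_unit s⟩
  | succ n ih =>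
    have ha : a ∈ (𝒜 n).toZ * (𝒜 1).toZ := by rw [hA n 1]; exact ha
    refine Submodule.mul_induction_on ha (fun b hb v hv => ?_) ?_
    · obtain ⟨t, ht, rfl⟩ := ih hb
      exact ⟨t * TensorRing.ι S (𝒜 1) ⟨v, hv⟩,
        SetLike.GradedMul.mul_mem ht (TensorRing.ι_mem _), by rw [map_mul, piA_ι]⟩
    · rintro x y ⟨t, ht, rfl⟩ ⟨t', ht', rfl⟩
      exact ⟨t + t', add_mem ht ht', map_add _ _ _⟩

/-- `π_A` is injective on `S` and on `A^1`, so there are no relations in degrees 0 and 1. -/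
theorem IsBimoduleOfRelations.two_le [IsConnected 𝒜]
    (hR : IsBimoduleOfRelations (TAgrade 𝒜) R (kerPiA 𝒜)) {n : ℕ} (hn : n < 2) {r : TA 𝒜}
    (hr : r ∈ R) (hrn : r ∈ TAgrade 𝒜 n) : r = 0 := by
  interval_cases n
  · exact eq_zero_of_mem_kerPiA_zero hrn (hR.mem_kerPiA hr)
  · exact eq_zero_of_mem_kerPiA_one hrn (hR.mem_kerPiA hr)

/-- The relations of degree `N` of `A` are generated by `R`. -/
theorem IsBimoduleOfRelations.exists_mem_graph [IsConnected 𝒜]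
    (hR : IsBimoduleOfRelations (TAgrade 𝒜) R (kerPiA 𝒜)) (α : R →ₗ[Env S] TA 𝒜) {N : ℕ}
    {x : TA 𝒜} (hx : x ∈ kerPiA 𝒜) (hN : x ∈ TAgrade 𝒜 N) :
    ∃ z ∈ graph (TAgrade 𝒜) α N, z.1 = x := by
  induction N generalizing x with
  | zero => exact ⟨0, zero_mem _, (eq_zero_of_mem_kerPiA_zero hN hx).symm⟩
  | succ N ih =>
    have key : ∀ x ∈ kerPiA 𝒜, ∃ z ∈ graph (TAgrade 𝒜) α (N + 1),
        z.1 = GradedRing.proj (TAgrade 𝒜) (N + 1) x := by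
      intro x hx
      -- In `I = R + I V + V I`, the first summand gives generators of the graph, and in the two
      -- others the factor in `I` is needed only in degree `N`.
      rw [← hR.sup_eq] at hx
      obtain ⟨r, hr, y, hy, rfl⟩ := Submodule.mem_sup.1 hx
      obtain ⟨y1, hy1, y2, hy2, rfl⟩ := Submodule.mem_sup.1 hy
      have h0 : ∃ z ∈ graph (TAgrade 𝒜) α (N + 1),
          z.1 = GradedRing.proj (TAgrade 𝒜) (N + 1) r := by
        refine ⟨_, mem_graph (r := ⟨_, hR.graded r hr (N + 1)⟩) (show 0 + (N + 1) + 0 = N + 1 by omega)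
          (SetLike.GradedOne.one_mem (A := TAgrade 𝒜)) (proj_mem _ _)
          SetLike.GradedOne.one_mem, ?_⟩
        simp
      have h1 : ∃ z ∈ graph (TAgrade 𝒜) α (N + 1),
          z.1 = GradedRing.proj (TAgrade 𝒜) (N + 1) y1 := by
        refine Submodule.mul_induction_on hy1 (fun u hu v hv => ?_) ?_
        · obtain ⟨z, hz, h⟩ := ih (proj_mem_kerPiA hu N) (proj_mem _ _)
          refine ⟨_, graph_mul_right hv hz, ?_⟩
          rw [proj_mul_right hv, h]
        · rintro x y ⟨z, hz, h⟩ ⟨w, hw, h'⟩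
          exact ⟨z + w, add_mem hz hw, by rw [Prod.fst_add, h, h', map_add]⟩
      have h2 : ∃ z ∈ graph (TAgrade 𝒜) α (N + 1),
          z.1 = GradedRing.proj (TAgrade 𝒜) (N + 1) y2 := by
        refine Submodule.mul_induction_on hy2 (fun v hv u hu => ?_) ?_
        · obtain ⟨z, hz, h⟩ := ih (proj_mem_kerPiA hu N) (proj_mem _ _)
          rw [add_comm N 1]
          refine ⟨_, graph_mul_left hv hz, ?_⟩
          rw [proj_mul_left hv, h]
        · rintro x y ⟨z, hz, h⟩ ⟨w, hw, h'⟩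
          exact ⟨z + w, add_mem hz hw, by rw [Prod.fst_add, h, h', map_add]⟩
      obtain ⟨z0, hz0, e0⟩ := h0
      obtain ⟨z1, hz1, e1⟩ := h1
      obtain ⟨z2, hz2, e2⟩ := h2
      exact ⟨z0 + (z1 + z2), add_mem hz0 (add_mem hz1 hz2), by
        rw [Prod.fst_add, Prod.fst_add, e0, e1, e2, map_add, map_add]⟩
    obtain ⟨z, hz, h⟩ := key x hx
    exact ⟨z, hz, by rw [h, proj_of_mem hN]⟩

theorem IsBimoduleOfRelations.graph_eq_zero [IsConnected 𝒜]
    (hR : IsBimoduleOfRelations (TAgrade 𝒜) R (kerPiA 𝒜)) {α : R →ₗ[Env S] TA 𝒜} {N : ℕ}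
    (hN : N < 2) {z : TA 𝒜 × TA 𝒜} (hz : z ∈ graph (TAgrade 𝒜) α N) : z = 0 := by
  refine graph_induction (p := fun z : TA 𝒜 × TA 𝒜 => z = 0) (fun i j k h t _ r hr t' _ => ?_) rfl
    (fun x y hx hy => by rw [hx, hy, add_zero]) hz
  have : r = 0 := Subtype.ext (hR.two_le (by omega) r.2 hr)
  simp [this]

theorem IsBimoduleOfRelations.mem_ideal_iff [IsConnected 𝒜]
    (hR : IsBimoduleOfRelations (TAgrade 𝒜) R (kerPiA 𝒜)) {x : TA 𝒜} :
    x ∈ ideal R ↔ x ∈ kerPiA 𝒜 := by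
  constructor
  · intro hx
    have : ideal R ≤ TwoSidedIdeal.ker (piA 𝒜) :=
      TwoSidedIdeal.span_le.2 fun x hx => (TwoSidedIdeal.mem_ker _).2 (hR.mem_kerPiA hx)
    exact (TwoSidedIdeal.mem_ker (piA 𝒜)).1 (this hx)
  · intro hx
    refine mem_of_proj_mem (𝒯 := TAgrade 𝒜) fun n => ?_
    -- With the inclusion in place of `α`, the graph simply records expressions `∑ t r t'`.
    obtain ⟨z, hz, h⟩ := hR.exists_mem_graph R.subtype (proj_mem_kerPiA hx n) (proj_mem n x)
    rw [← h]
    exact graph_induction (p := fun z => z.1 ∈ ideal R)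
      (fun i j k _ t _ r _ t' _ => TwoSidedIdeal.mul_mem_right _ _ _
        (TwoSidedIdeal.mul_mem_left _ _ _ (TwoSidedIdeal.subset_span r.2)))
      (zero_mem _) (fun _ _ => add_mem) hz

end Presentation

/-! ### Filtered maps of PBW-deformations -/

section Lifting

variable {S T : Type*} [Ring S] [Ring T] [SRing S T] {𝒯 : ℕ → Subbimodule S T} [GradedRing 𝒯]

variable (𝒯) in
/-- The projection onto a component, as a bimodule map. -/
def projLinear (n : ℕ) : T →ₗ[Env S] T where
  toFun := GradedRing.proj 𝒯 n
  map_add' := map_add _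
  map_smul' e x := by
    show ((DirectSum.decompose 𝒯 (e • x) n : 𝒯 n) : T) = e • (DirectSum.decompose 𝒯 x n : 𝒯 n)
    rw [DirectSum.decompose_smul]; rfl

theorem finite_proj_ne_zero (x : T) : {n | GradedRing.proj 𝒯 n x ≠ 0}.Finite := by
  obtain ⟨n, hn⟩ := exists_mem_lowerDeg (𝒯 := 𝒯) x
  refine (Set.finite_Iio n).subset fun m hm => ?_
  by_contra h
  exact hm (proj_lowerDeg (not_lt.1 h) hn)

/-- The generators of `R_P` are homogeneous, so those attached to other degrees do not contribute to
the component of degree `n`, and `p^n(P ∩ T^{≤n})` is already a subbimodule. -/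
theorem proj_leading {P : Subbimodule S T} (n : ℕ) {x : T} (hx : x ∈ leading 𝒯 P) :
    ∃ y ∈ P ⊓ upTo 𝒯 n, GradedRing.proj 𝒯 n y = GradedRing.proj 𝒯 n x := by
  suffices h : leading 𝒯 P ≤ ((P ⊓ upTo 𝒯 n).map (projLinear 𝒯 n)).comap (projLinear 𝒯 n) from
    h hx
  refine Submodule.span_le.2 ?_
  rintro _ ⟨m, y, hy, hym, rfl⟩
  rcases eq_or_ne m n with rfl | hmn
  · exact ⟨y, ⟨hy, hym⟩, (proj_of_mem (proj_mem m y)).symm⟩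
  · exact ⟨0, zero_mem _, (map_zero _).trans (proj_of_mem_ne (proj_mem m y) hmn).symm⟩

theorem proj_mem_leading {P : Subbimodule S T} (n : ℕ) {x : T} (hx : x ∈ leading 𝒯 P) :
    GradedRing.proj 𝒯 n x ∈ leading 𝒯 P := by
  obtain ⟨y, hy, h⟩ := proj_leading n hx
  exact Submodule.subset_span ⟨n, y, hy.1, hy.2, h⟩

/-- Bimodule projectivity lifts `p^n : R_P → p^n(P ∩ T^{≤n})` through the surjection from `P ∩
T^{≤n}`. -/
theorem exists_lift_leading {P : Subbimodule S T} (hP : Module.Projective (Env S) (leading 𝒯 P))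
    (n : ℕ) : ∃ β : leading 𝒯 P →ₗ[Env S] T, ∀ x : leading 𝒯 P, β x ∈ P ⊓ upTo 𝒯 n ∧
      GradedRing.proj 𝒯 n (β x) = GradedRing.proj 𝒯 n x := by
  let p := (projLinear 𝒯 n).domRestrict (P ⊓ upTo 𝒯 n)
  let g : leading 𝒯 P →ₗ[Env S] LinearMap.range p :=
    ((projLinear 𝒯 n).domRestrict (leading 𝒯 P)).codRestrict _ fun x => by
      obtain ⟨y, hy, h⟩ := proj_leading n x.2
      exact ⟨⟨y, hy⟩, h⟩
  obtain ⟨β, hβ⟩ := Module.projective_lifting_property p.rangeRestrict g p.surjective_rangeRestrict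
  refine ⟨(P ⊓ upTo 𝒯 n).subtype ∘ₗ β, fun x => ⟨(β x).2, ?_⟩⟩
  have h := congrArg Subtype.val (LinearMap.congr_fun hβ x)
  exact h

/-- If `R_P` is projective, then the elements of `R ⊆ R_P` lift to `P`. -/
theorem exists_isFilteredMap {P R : Subbimodule S T} (h : R ≤ leading 𝒯 P)
    (hP : Module.Projective (Env S) (leading 𝒯 P)) :
    ∃ α : R →ₗ[Env S] T, IsFilteredMap 𝒯 α ∧ LinearMap.range α ≤ P := by
  choose β hβ using fun n => exists_lift_leading hP n
  -- `γ n` lifts the component of degree `n` only. For each `r` almost all `γ n r` vanish, so `α = ∑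
  -- γ n` makes sense.
  let γ : ℕ → R →ₗ[Env S] T := fun n => β n ∘ₗ
    ((projLinear 𝒯 n).domRestrict R).codRestrict (leading 𝒯 P) fun r => proj_mem_leading n (h r.2)
  have hγ : ∀ n r, γ n r ∈ P ⊓ upTo 𝒯 n ∧
      GradedRing.proj 𝒯 n (γ n r) = GradedRing.proj 𝒯 n (r : T) := fun n r =>
    ⟨(hβ n _).1, (hβ n _).2.trans (proj_of_mem (proj_mem n _))⟩
  have hγ0 : ∀ n (r : R), GradedRing.proj 𝒯 n (r : T) = 0 → γ n r = 0 := fun n r hr =>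
    (congrArg (β n) (Subtype.ext hr)).trans (map_zero _)
  have hfin : ∀ r : R, (Function.support fun n => γ n r).Finite := fun r =>
    (finite_proj_ne_zero (𝒯 := 𝒯) (r : T)).subset fun n hn h0 => hn (hγ0 n r h0)
  refine ⟨⟨⟨fun r => ∑ᶠ n, γ n r, fun r s => ?_⟩, fun e r => ?_⟩, fun n r hr => ?_, ?_⟩
  · simp only [map_add]
    exact finsum_add_distrib (hfin r) (hfin s)
  · simp only [map_smul, RingHom.id_apply]
    exact (smul_finsum' e (hfin r)).symm
  · have : ∑ᶠ n, γ n r = γ n r :=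
      finsum_eq_single _ n fun m hm => hγ0 m r (proj_of_mem_ne hr hm.symm)
    show (∑ᶠ n, γ n r) ∈ upTo 𝒯 n ∧ GradedRing.proj 𝒯 n (∑ᶠ n, γ n r) = r
    rw [this, (hγ n r).2, proj_of_mem hr]
    exact ⟨(hγ n r).1.2, rfl⟩
  · rintro _ ⟨r, rfl⟩
    exact finsum_induction (· ∈ P) (zero_mem _) (fun _ _ => add_mem) fun n => (hγ n r).1.1

end Lifting

/-! ### From a PBW-deformation to a filtered map with all Jacobi conditions. -/

section Forward

variable {S : Type u} {A : Type v} [Ring S] [Ring A] [SRing S A]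
  {𝒜 : ℕ → Subbimodule S A} [GradedRing 𝒜] [IsConnected 𝒜] {R P : Subbimodule S (TA 𝒜)}
  {α : R →ₗ[Env S] TA 𝒜}

/-- For a PBW-deformation, the ideal generated by `P` is generated by the lifts of the elements of
`R`, compatibly with the filtrations. -/
theorem mem_idealFilt_of_isPBWDeformation
    (hR : IsBimoduleOfRelations (TAgrade 𝒜) R (kerPiA 𝒜)) (hα : IsFilteredMap (TAgrade 𝒜) α)
    (hαP : LinearMap.range α ≤ P)
    (hP : ∀ n, ∀ z ∈ lowerDeg (TAgrade 𝒜) (n + 1), z ∈ ideal P →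
      GradedRing.proj (TAgrade 𝒜) n z ∈ ideal R)
    {n : ℕ} {z : TA 𝒜} (hz : z ∈ lowerDeg (TAgrade 𝒜) n) (hzP : z ∈ ideal P) :
    z ∈ idealFilt (TAgrade 𝒜) α n := by
  induction n generalizing z with
  | zero => rw [lowerDeg_zero hz]; exact zero_mem _
  | succ n ih =>
    -- The leading component of `z` lies in `⟨R⟩`; subtracting the corresponding combination `w.2`
    -- of terms `t α(r) t'` lowers the degree and stays in `⟨P⟩`.
    obtain ⟨w, hw, h⟩ := hR.exists_mem_graph α (hR.mem_ideal_iff.1 (hP n z hz hzP)) (proj_mem n z)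
    have h1 := snd_mem_idealFilt n.lt_succ_self hw
    have h2 : z - w.2 ∈ lowerDeg (TAgrade 𝒜) n := by
      have := add_mem (sub_proj_mem_lowerDeg hz) (hα.graph_sub_mem hw)
      rwa [h, sub_add_sub_cancel] at this
    have h3 : w.2 ∈ ideal P := TwoSidedIdeal.span_mono hαP (idealFilt_le_ideal h1)
    have := add_mem (idealFilt_mono n.le_succ (ih h2 (sub_mem hzP h3))) h1
    rwa [sub_add_cancel] at this

theorem exists_filteredMap_of_isPBWDeformation
    (hR : IsBimoduleOfRelations (TAgrade 𝒜) R (kerPiA 𝒜))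
    (hRP : R ≤ leading (TAgrade 𝒜) P)
    (hRPproj : Module.Projective (Env S) (leading (TAgrade 𝒜) P))
    (h : IsPBWDeformation (TAgrade 𝒜) P R hRP) :
    ideal R = ideal (leading (TAgrade 𝒜) P) ∧
      ∃ α : R →ₗ[Env S] TA 𝒜, IsFilteredMap (TAgrade 𝒜) α ∧
        LinearMap.range α ≤ P ∧ (∀ x ∈ P, x ∈ ideal (LinearMap.range α)) ∧
        ∀ k : ℕ, Jacobi (TAgrade 𝒜) (LinearMap.range α) k := by
  rw [isPBWDeformation_iff] at h
  refine ⟨le_antisymm (TwoSidedIdeal.span_mono hRP) (TwoSidedIdeal.span_le.2 fun x hx => ?_), ?_⟩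
  · refine mem_of_proj_mem (𝒯 := TAgrade 𝒜) fun n => ?_
    obtain ⟨y, hy, hyx⟩ := proj_leading n hx
    rw [← hyx]
    exact h n y (mem_upTo_iff.1 hy.2) (TwoSidedIdeal.subset_span hy.1)
  · obtain ⟨α, hα, hαP⟩ := exists_isFilteredMap hRP hRPproj
    refine ⟨α, hα, hαP, fun x hx => ?_, fun k => (hα.jacobi_iff hR.graded).2 fun y hy => ?_⟩
    · obtain ⟨n, hn⟩ := exists_mem_lowerDeg (𝒯 := TAgrade 𝒜) x
      exact idealFilt_le_ideal (mem_idealFilt_of_isPBWDeformation hR hα hαP h hn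
        (TwoSidedIdeal.subset_span hx))
    -- A first component `0` forces `y` into lower degree, and `y` is an element of `⟨P⟩`; the
    -- preceding lemma then expresses it within that degree.
    · refine mem_idealFilt_of_isPBWDeformation hR hα hαP h (by simpa using hα.graph_sub_mem hy) ?_
      exact TwoSidedIdeal.span_mono hαP (idealFilt_le_ideal
        (snd_mem_idealFilt (Nat.lt_succ_self _) hy))

end Forward

/-! ### The vanishing of a torsion group -/

theorem TensorOver.tmul_add {A N M : Type*} [Ring A] [AddCommGroup N] [Module Aᵐᵒᵖ N]
    [AddCommGroup M] [Module A M] (n : N) (x y : M) :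
    TensorOver.tmul A n (x + y) = TensorOver.tmul A n x + TensorOver.tmul A n y :=
  (congrArg (QuotientAddGroup.mk' (tensorRel A N M)) (TensorProduct.tmul_add n x y)).trans
    (map_add _ _ _)

theorem TensorOver.zero_tmul {A N M : Type*} [Ring A] [AddCommGroup N] [Module Aᵐᵒᵖ N]
    [AddCommGroup M] [Module A M] (x : M) : TensorOver.tmul A (0 : N) x = 0 :=
  (congrArg (QuotientAddGroup.mk' (tensorRel A N M)) (TensorProduct.zero_tmul N x)).trans
    (map_zero _)

theorem TensorOver.tmul_smul {A N M : Type*} [Ring A] [AddCommGroup N] [Module Aᵐᵒᵖ N]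
    [AddCommGroup M] [Module A M] (n : N) (a : A) (x : M) :
    TensorOver.tmul A n (a • x) = TensorOver.tmul A (op a • n) x := by
  refine (sub_eq_zero.1 ?_).symm
  refine (map_sub (QuotientAddGroup.mk' (tensorRel A N M)) _ _).symm.trans
    ((QuotientAddGroup.eq_zero_iff _).2 ?_)
  exact AddSubgroup.subset_closure ⟨n, a, x, rfl⟩

section Vanishing

variable {S : Type u} {A : Type v} [Ring S] [Ring A] [SRing S A]
  {𝒜 : ℕ → Subbimodule S A}

variable (𝒜) in
/-- The subgroup `A⁺ X` generated by the products with the elements of positive degree. -/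
def augMul [GradedRing 𝒜] [IsConnected 𝒜] {M : Type v} [AddCommGroup M] [Module A M] (X : Submodule A M) : AddSubgroup M :=
  AddSubgroup.closure {y | ∃ a : A, augmentation 𝒜 a = 0 ∧ ∃ x ∈ X, y = a • x}

variable (𝒜) in
/-- The homogeneous part of degree `N` of `A⁺ X`. -/
def augMulComp {M : Type v} [AddCommGroup M] [Module A M] (comp : ℕ → AddSubgroup M)
    (X : Submodule A M) (N : ℕ) : AddSubgroup M :=
  AddSubgroup.closure {y | ∃ p q, p + q = N ∧ 0 < p ∧ ∃ a ∈ 𝒜 p, ∃ x ∈ comp q, x ∈ X ∧ y = a • x}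

theorem augMulComp_le {M : Type v} [AddCommGroup M] [Module A M] {comp : ℕ → AddSubgroup M}
    {X : Submodule A M} (h : IsGood 𝒜 comp X) (N : ℕ) : augMulComp 𝒜 comp X N ≤ comp N := by
  refine (AddSubgroup.closure_le _).2 ?_
  rintro _ ⟨p, q, rfl, -, a, ha, x, hx, -, rfl⟩
  exact h.smul_mem ha hx

variable [GradedRing 𝒜] [IsConnected 𝒜]

/-- The product of the homogeneous components of a coefficient and of an element of `X` is
homogeneous, and the coefficient has no component of degree 0. Asking for all `L ≥ K` allows two
expansions to be added. -/
theorem exists_sum_augMulComp {M : Type v} [AddCommGroup M] [Module A M]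
    {comp : ℕ → AddSubgroup M} {X : Submodule A M} (h : IsGood 𝒜 comp X) {y : M}
    (hy : y ∈ augMul 𝒜 X) :
    ∃ (K : ℕ) (x : ℕ → M), (∀ n, x n ∈ augMulComp 𝒜 comp X n) ∧
      ∀ L ≥ K, ∑ n ∈ Finset.range L, x n = y := by
  let G : AddSubgroup M :=
    { carrier := {y | ∃ (K : ℕ) (x : ℕ → M), (∀ n, x n ∈ augMulComp 𝒜 comp X n) ∧
        ∀ L ≥ K, ∑ n ∈ Finset.range L, x n = y}
      zero_mem' := ⟨0, 0, fun n => zero_mem _, fun L _ => by simp⟩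
      add_mem' := by
        rintro _ _ ⟨K, x, hx, hs⟩ ⟨K', x', hx', hs'⟩
        refine ⟨max K K', x + x', fun n => add_mem (hx n) (hx' n), fun L hL => ?_⟩
        simp only [Pi.add_apply]
        rw [Finset.sum_add_distrib, hs L (le_of_max_le_left hL), hs' L (le_of_max_le_right hL)]
      neg_mem' := by
        rintro _ ⟨K, x, hx, hs⟩
        refine ⟨K, -x, fun n => neg_mem (hx n), fun L hL => ?_⟩
        simp only [Pi.neg_apply]
        rw [Finset.sum_neg_distrib, hs L hL] }
  suffices h : augMul 𝒜 X ≤ G from h hy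
  refine (AddSubgroup.closure_le _).2 ?_
  rintro _ ⟨a, ha, x, hx, rfl⟩
  obtain ⟨K, hK⟩ := exists_sum_proj (𝒜 := 𝒜) a
  obtain ⟨L, y, hy, rfl⟩ := h.sub_le x hx
  rw [← hK K le_rfl, Finset.sum_smul]
  refine sum_mem fun p _ => ?_
  rw [Finset.smul_sum]
  refine sum_mem fun q _ => ?_
  rcases Nat.eq_zero_or_pos p with rfl | hp
  · rw [(augmentation_eq_zero_iff a).1 ha, zero_smul]
    exact zero_mem _
  · refine ⟨p + q + 1, Pi.single (p + q) (GradedRing.proj 𝒜 p a • y q), fun n => ?_,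
      fun L hL => ?_⟩
    · rcases eq_or_ne n (p + q) with rfl | hn
      · rw [Pi.single_eq_same]
        exact AddSubgroup.subset_closure
          ⟨p, q, rfl, hp, _, SetLike.coe_mem _, _, (hy q).1, (hy q).2, rfl⟩
      · rw [Pi.single_eq_of_ne hn]; exact zero_mem _
    · rw [Finset.sum_pi_single', if_pos (Finset.mem_range.2 (by omega))]

theorem mem_augMulComp {M : Type v} [AddCommGroup M] [Module A M]
    {comp : ℕ → AddSubgroup M} {X : Submodule A M} (h : IsGood 𝒜 comp X) {y : M} {N : ℕ}
    (hN : y ∈ comp N) (hy : y ∈ augMul 𝒜 X) : y ∈ augMulComp 𝒜 comp X N := by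
  obtain ⟨K, x, hx, hs⟩ := exists_sum_augMulComp h hy
  -- Both `x` and the family concentrated in degree `N` sum to `y`, so independence of the
  -- components identifies `x N` with `y`.
  have h1 := h.indep (max K (N + 1)) (x - Pi.single N y) (fun n => by
    refine sub_mem (augMulComp_le h n (hx n)) ?_
    rcases eq_or_ne n N with rfl | hn
    · rw [Pi.single_eq_same]; exact hN
    · rw [Pi.single_eq_of_ne hn]; exact zero_mem _) (by
    simp only [Pi.sub_apply]
    rw [Finset.sum_sub_distrib, hs _ (le_max_left _ _), Finset.sum_pi_single',
      if_pos (Finset.mem_range.2 (lt_max_of_lt_right N.lt_succ_self)), sub_self]) N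
      (lt_max_of_lt_right N.lt_succ_self)
  rw [Pi.sub_apply, Pi.single_eq_same, sub_eq_zero] at h1
  rw [← h1]
  exact hx N

theorem augmentation_unit (s : S) : augmentation 𝒜 (SRing.unit s) = s := by
  refine (degreeZeroEquiv 𝒜).symm_apply_eq.2 (Subtype.ext ?_)
  exact DirectSum.decompose_of_mem_same 𝒜 (unit_mem_zero s)

variable (𝒜) in
/-- The pairing `(s, x) ↦ s dx` of `S` and `F_{i+1}` with values in `F_i / A⁺ Z_i`, where `Z_i` is
the module of cycles. -/
noncomputable def torPairing (i : ℕ) : RightTrivial 𝒜 →+ (resolution 𝒜 (i + 1)).carrier →+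
    (resolution 𝒜 i).carrier ⧸ augMul 𝒜 (resolution 𝒜 i).sub :=
  AddMonoidHom.mk' (fun s => (QuotientAddGroup.mk' _).comp
    ((DistribSMul.toAddMonoidHom _ (SRing.unit (S := S) (T := A) s)).comp
      (resolutionD 𝒜 i).toAddMonoidHom)) fun s t => by
    ext x
    refine (congrArg (QuotientAddGroup.mk' (augMul 𝒜 (resolution 𝒜 i).sub)) ?_).trans
      (map_add (QuotientAddGroup.mk' (augMul 𝒜 (resolution 𝒜 i).sub)) _ _)
    exact (congrArg (· • resolutionD 𝒜 i x)
      (map_add (SRing.unit (S := S) (T := A)) s t)).trans (add_smul _ _ _)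

theorem torPairing_apply (i : ℕ) (s : S) (x : (resolution 𝒜 (i + 1)).carrier) :
    torPairing 𝒜 i s x = QuotientAddGroup.mk' (augMul 𝒜 (resolution 𝒜 i).sub)
      ((SRing.unit s : A) • resolutionD 𝒜 i x) := rfl

/-- The pairing is balanced because `s ε(a) - s a` lies in `A⁺`, where `ε` is the augmentation, and
`dx` is a cycle. -/
theorem torPairing_smul (i : ℕ) (s : S) (a : A) (x : (resolution 𝒜 (i + 1)).carrier) :
    torPairing 𝒜 i (s * augmentation 𝒜 a) x = torPairing 𝒜 i s (a • x) := by
  rw [torPairing_apply, torPairing_apply, ← sub_eq_zero, ← map_sub]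
  refine (QuotientAddGroup.eq_zero_iff _).2 ?_
  refine AddSubgroup.subset_closure ⟨SRing.unit (s * augmentation 𝒜 a : S) -
    SRing.unit (s : S) * a, ?_, resolutionD 𝒜 i x, ?_, ?_⟩
  · rw [map_sub, map_mul (augmentation 𝒜), augmentation_unit, augmentation_unit, sub_self]
  · exact Syzygy.range_cover_le _ ⟨x, rfl⟩
  · rw [map_smul, sub_smul, mul_smul]

variable (𝒜) in
/-- The map `S ⊗_A F_{i+1} → F_i / A⁺ Z_i` induced by the differential. -/
noncomputable def torToQuot (i : ℕ) : TorChain 𝒜 (i + 1) →+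
    (resolution 𝒜 i).carrier ⧸ augMul 𝒜 (resolution 𝒜 i).sub :=
  QuotientAddGroup.lift _
    (TensorProduct.liftAddHom (R := ℤ) (torPairing 𝒜 i)
      fun n s x => by rw [map_zsmul, map_zsmul]; rfl)
    ((AddSubgroup.closure_le _).2 (by
      rintro _ ⟨s, a, x, rfl⟩
      refine (map_sub _ _ _).trans (sub_eq_zero.2 ?_)
      rw [TensorProduct.liftAddHom_tmul, TensorProduct.liftAddHom_tmul]
      exact torPairing_smul (S := S) i s a x))

theorem torToQuot_tmul (i : ℕ) (s : RightTrivial 𝒜) (x : (resolution 𝒜 (i + 1)).carrier) :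
    torToQuot 𝒜 i (TensorOver.tmul A s x) = torPairing 𝒜 i s x := rfl

theorem torD_tmul (i : ℕ) (s : RightTrivial 𝒜) (x : (resolution 𝒜 (i + 1)).carrier) :
    torD 𝒜 i (TensorOver.tmul A s x) = TensorOver.tmul A s (resolutionD 𝒜 i x) := rfl

theorem torToQuot_torD {i n : ℕ} {y : TorChain 𝒜 (i + 2)} (hy : y ∈ torComp 𝒜 (i + 2) n) :
    torToQuot 𝒜 i (torD 𝒜 (i + 1) y) = 0 := by
  suffices h : torComp 𝒜 (i + 2) n ≤ ((torToQuot 𝒜 i).comp (torD 𝒜 (i + 1))).ker from h hy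
  refine (AddSubgroup.closure_le _).2 ?_
  rintro _ ⟨s, x, -, rfl⟩
  show torToQuot 𝒜 i (torD 𝒜 (i + 1) (TensorOver.tmul A s x)) = 0
  have h : resolutionD 𝒜 i (resolutionD 𝒜 (i + 1) x) = 0 := by
    have := range_resolutionD_succ (𝒜 := 𝒜) i
    exact this.le ⟨x, rfl⟩
  rw [torD_tmul, torToQuot_tmul]
  refine (torPairing_apply (S := S) i s _).trans ?_
  rw [h, smul_zero, map_zero]

theorem tmul_eq_zero_of_mem_augMul {i : ℕ} {x : (resolution 𝒜 i).carrier}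
    (hx : x ∈ augMul 𝒜 (⊤ : Submodule A (resolution 𝒜 i).carrier)) (s : RightTrivial 𝒜) :
    TensorOver.tmul A s x = 0 := by
  let f : (resolution 𝒜 i).carrier →+ TorChain 𝒜 i :=
    AddMonoidHom.mk' (fun x => TensorOver.tmul A s x) (TensorOver.tmul_add s)
  suffices h : augMul 𝒜 (⊤ : Submodule A (resolution 𝒜 i).carrier) ≤ f.ker from h hx
  refine (AddSubgroup.closure_le _).2 ?_
  rintro _ ⟨a, ha, x, -, rfl⟩
  show TensorOver.tmul A s (a • x) = 0
  rw [TensorOver.tmul_smul]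
  have h : op a • s = 0 := by
    refine (rightTrivial_smul (S := S) (𝒜 := 𝒜) a s).trans ?_
    rw [ha]
    exact mul_zero (M₀ := S) s
  rw [h, TensorOver.zero_tmul]

/-- If `Tor_{i+1,N}` vanishes, then a cycle of degree `N` of `F_i` which lies in `A⁺ F_i` is a
combination of cycles with coefficients in `A⁺`. -/
theorem mem_augMulComp_of_subsingleton_tor {i N : ℕ} (hT : Subsingleton (Tor 𝒜 (i + 1) N))
    {x : (resolution 𝒜 i).carrier} (hN : x ∈ (resolution 𝒜 i).comp N)
    (hx : x ∈ (resolution 𝒜 i).sub)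
    (haug : x ∈ augMul 𝒜 (⊤ : Submodule A (resolution 𝒜 i).carrier)) :
    x ∈ augMulComp 𝒜 (resolution 𝒜 i).comp (resolution 𝒜 i).sub N := by
  refine mem_augMulComp (resolution_isGood i) hN ?_
  -- A homogeneous cycle `x` is itself an index of the basis of `F_{i+1}`, with basis element `e`
  -- and `d e = x`. As `x ∈ A⁺ F_i`, the chain `1 ⊗ e` is a cycle, hence a boundary; `torToQuot`
  -- kills boundaries and sends it to the class of `x` modulo `A⁺ Z_i`.
  let g : (resolution 𝒜 i).Gen := ⟨N, x, hN, hx⟩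
  let e' : (resolution 𝒜 i).Gen →₀ A := Finsupp.single g 1
  let e : (resolution 𝒜 (i + 1)).carrier := e'
  have he : resolutionD 𝒜 i e = x :=
    (Finsupp.linearCombination_single _ _ _).trans (one_smul A x)
  have heN : e ∈ (resolution 𝒜 (i + 1)).comp N := by
    intro g' j hj
    rcases eq_or_ne g g' with rfl | hg
    · have h : e' g = 1 := Finsupp.single_eq_same
      have hj0 : 0 ≠ j := by rintro rfl; exact hj (zero_add _)
      refine (congrArg _ h).trans ?_
      exact DirectSum.decompose_of_mem_ne 𝒜 SetLike.GradedOne.one_mem hj0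
    · have h : e' g' = 0 := Finsupp.single_eq_of_ne hg.symm
      exact (congrArg _ h).trans (map_zero _)
  let o : RightTrivial 𝒜 := (1 : S)
  let z : TorChain 𝒜 (i + 1) := TensorOver.tmul A o e
  have hz : z ∈ torCycles 𝒜 (i + 1) N :=
    ⟨AddSubgroup.subset_closure ⟨o, e, heN, rfl⟩, by
      show torD 𝒜 i (TensorOver.tmul A o e) = 0
      rw [torD_tmul, he]
      exact tmul_eq_zero_of_mem_augMul haug o⟩
  have h0 : (QuotientAddGroup.mk ⟨z, hz⟩ : Tor 𝒜 (i + 1) N) = 0 := Subsingleton.elim _ _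
  obtain ⟨y, hy, hyz⟩ := (QuotientAddGroup.eq_zero_iff _).1 h0
  have h1 : torToQuot 𝒜 i z = 0 := by
    have := torToQuot_torD hy
    rwa [hyz] at this
  have h2 : torToQuot 𝒜 i z = QuotientAddGroup.mk' _ x := by
    refine (torPairing_apply i 1 e).trans ?_
    rw [he, map_one, one_smul]
  exact (QuotientAddGroup.eq_zero_iff _).1 (h2.symm.trans h1)

end Vanishing

/-! ### The part of the graph ending with a letter -/

section LetterGraph

variable {S V : Type*} [Ring S] [AddCommGroup V] [Module (Env S) V]
  {R : Subbimodule S (TensorRing S V)} (α : R →ₗ[Env S] TensorRing S V)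

open TensorRing

/-- The sums of products `g v` of elements of the graph with letters, of total degree `N`, and of
pairs `(0, y)` with `y` in the ideal generated by `α(R)`, of degree less than `N`. -/
def letterGraph (N : ℕ) : AddSubgroup (TensorRing S V × TensorRing S V) :=
  AddSubgroup.closure ({z | ∃ M, M + 1 = N ∧ ∃ g ∈ graph (grade S V) α M, ∃ v : V,
    z = (g.1 * ι S V v, g.2 * ι S V v)} ∪ {z | z.1 = 0 ∧ z.2 ∈ idealFilt (grade S V) α N})

variable {α}

theorem letterGraph_induction {N : ℕ} {p : TensorRing S V × TensorRing S V → Prop}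
    (mul_ι : ∀ M, M + 1 = N → ∀ g ∈ graph (grade S V) α M, ∀ v : V,
      p (g.1 * ι S V v, g.2 * ι S V v))
    (zero : ∀ y ∈ idealFilt (grade S V) α N, p (0, y))
    (add : ∀ x y, p x → p y → p (x + y)) {z : TensorRing S V × TensorRing S V}
    (hz : z ∈ letterGraph α N) : p z := by
  refine closure_induction_of_neg ?_ ?_ (zero 0 (zero_mem _)) add hz
  · rintro _ (⟨M, hM, g, hg, v, rfl⟩ | ⟨h1, h2⟩)
    · exact Or.inl ⟨M, hM, -g, neg_mem hg, v, by simp⟩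
    · exact Or.inr ⟨by simpa using h1, neg_mem h2⟩
  · rintro ⟨x, y⟩ (⟨M, hM, g, hg, v, h⟩ | ⟨h1, h2⟩)
    · rw [h]; exact mul_ι M hM g hg v
    · obtain rfl : x = 0 := h1
      exact zero y h2

theorem mul_ι_mem_letterGraph {M : ℕ} {g : TensorRing S V × TensorRing S V}
    (hg : g ∈ graph (grade S V) α M) (v : V) :
    (g.1 * ι S V v, g.2 * ι S V v) ∈ letterGraph α (M + 1) :=
  AddSubgroup.subset_closure (Or.inl ⟨M, rfl, g, hg, v, rfl⟩)

theorem zero_mk_mem_letterGraph {N : ℕ} {y : TensorRing S V}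
    (hy : y ∈ idealFilt (grade S V) α N) : (0, y) ∈ letterGraph α N :=
  AddSubgroup.subset_closure (Or.inr ⟨rfl, hy⟩)

theorem letterGraph_mul_left {i N : ℕ} {t : TensorRing S V} (ht : t ∈ grade S V i)
    {z : TensorRing S V × TensorRing S V} (hz : z ∈ letterGraph α N) :
    t • z ∈ letterGraph α (i + N) := by
  refine letterGraph_induction (p := fun z => t • z ∈ letterGraph α (i + N))
    (fun M hM g hg v => ?_) (fun y hy => ?_) (fun x y hx hy => ?_) hz
  · subst hM
    have := mul_ι_mem_letterGraph (graph_mul_left ht hg) v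
    simpa only [mul_assoc, add_assoc, Prod.smul_mk, smul_eq_mul] using this
  · have := zero_mk_mem_letterGraph (idealFilt_mul_left ht hy)
    rwa [← mul_zero t] at this
  · rw [smul_add]; exact add_mem hx hy

theorem graph_mul_mem_letterGraph {a b : ℕ} {z : TensorRing S V × TensorRing S V}
    (hz : z ∈ graph (grade S V) α a) {x : TensorRing S V} (hx : x ∈ grade S V (b + 1)) :
    (z.1 * x, z.2 * x) ∈ letterGraph α (a + b + 1) := by
  refine grade_succ_induction (p := fun x => (z.1 * x, z.2 * x) ∈ letterGraph α (a + b + 1))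
    (fun y v hy => ?_) ?_ (fun x y hx hy => ?_) hx
  · have := mul_ι_mem_letterGraph (graph_mul_right hy hz) v
    simpa only [mul_assoc] using this
  · rw [mul_zero, mul_zero]; exact zero_mem _
  · rw [mul_add, mul_add]; exact add_mem hx hy

/-- The sum `∑ y_w w` for a family of pairs `(x_w, y_w)`. -/
noncomputable def sndSum : (V →₀ TensorRing S V × TensorRing S V) →+ TensorRing S V :=
  Finsupp.liftAddHom fun w => (AddMonoidHom.mulRight (ι S V w)).comp (AddMonoidHom.snd _ _)

/-- For a generator `g v`, the coordinates are the pairs `g F(v)_w`, again in the graph, and `v = ∑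
F(v)_w w` reassembles the second component. -/
theorem exists_coords_of_mem_letterGraph {F : V →+ V →₀ S} (hF : IsDualBasis F) {n : ℕ}
    {z : TensorRing S V × TensorRing S V} (hz : z ∈ letterGraph α (n + 1)) :
    ∃ c : V →₀ TensorRing S V × TensorRing S V, (∀ w, c w ∈ graph (grade S V) α n) ∧
      (∀ w, coords hF z.1 w = (c w).1) ∧ z.2 - sndSum c ∈ idealFilt (grade S V) α (n + 1) := by
  refine letterGraph_induction (p := fun z => ∃ c : V →₀ TensorRing S V × TensorRing S V,
    (∀ w, c w ∈ graph (grade S V) α n) ∧ (∀ w, coords hF z.1 w = (c w).1) ∧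
      z.2 - sndSum c ∈ idealFilt (grade S V) α (n + 1))
    (fun M hM g hg v => ?_) (fun y hy => ?_) ?_ hz
  · obtain rfl : M = n := by omega
    refine ⟨(F v).mapRange (fun s => (g.1 * SRing.unit s, g.2 * SRing.unit s)) (by simp),
      fun w => graph_mul_right (unit_mem _) hg, fun w => coords_mul_ι hF _ _ _, ?_⟩
    suffices h : sndSum ((F v).mapRange (fun s => (g.1 * SRing.unit s, g.2 * SRing.unit s))
        (by simp)) = g.2 * ι S V v by
      rw [h, sub_self]; exact zero_mem _
    rw [sndSum, Finsupp.liftAddHom_apply, Finsupp.sum_mapRange_index (fun _ => map_zero _),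
      ← sum_unit_mul_ι hF v, Finsupp.mul_sum]
    exact Finset.sum_congr rfl fun w _ => mul_assoc _ _ _
  · exact ⟨0, fun w => zero_mem _, fun w => by simp, by simpa using hy⟩
  · rintro x y ⟨c, h1, h2, h3⟩ ⟨c', h1', h2', h3'⟩
    refine ⟨c + c', fun w => add_mem (h1 w) (h1' w), fun w => ?_, ?_⟩
    · rw [Prod.fst_add, map_add, Finsupp.add_apply, h2, h2']; rfl
    · rw [Prod.snd_add, map_add, add_sub_add_comm]
      exact add_mem h3 h3'

/-- Relations which end with a letter come from relations of smaller degree. -/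
theorem mem_idealFilt_of_mem_letterGraph {F : V →+ V →₀ S} (hF : IsDualBasis F) {n : ℕ}
    (h : ∀ y, (0, y) ∈ graph (grade S V) α n → y ∈ idealFilt (grade S V) α n)
    {y : TensorRing S V} (hy : (0, y) ∈ letterGraph α (n + 1)) :
    y ∈ idealFilt (grade S V) α (n + 1) := by
  obtain ⟨c, h1, h2, h3⟩ := exists_coords_of_mem_letterGraph hF hy
  have h4 : sndSum c ∈ idealFilt (grade S V) α (n + 1) := by
    rw [sndSum, Finsupp.liftAddHom_apply]
    refine sum_mem fun w _ => ?_
    -- The coordinates of `0` are all `0`, so a relation in degree `n + 1` splits into relations in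
    -- degree `n`.
    have h5 : (c w).1 = 0 := by rw [← h2 w, map_zero]; rfl
    have h6 := h (c w).2 (by rw [← h5]; exact h1 w)
    exact idealFilt_mul_right (ι_mem w) h6
  simpa using add_mem h3 h4

end LetterGraph

/-! ### The products `I V` and `V I`, and lifting elements of `I V` to the graph. -/

section Presentation

variable {S : Type u} {A : Type v} [Ring S] [Ring A] [SRing S A]
  {𝒜 : ℕ → Subbimodule S A}

theorem mul_mem_kerPiA_mul {u x : TA 𝒜} (hu : u ∈ kerPiA 𝒜) (hx : x ∈ TensorRing.pos S (𝒜 1)) :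
    u * x ∈ kerPiA 𝒜 * (TAgrade 𝒜 1).toZ := by
  refine TensorRing.pos_induction (p := fun x => u * x ∈ kerPiA 𝒜 * (TAgrade 𝒜 1).toZ)
    (fun y v => ?_) ?_ (fun x y hx hy => ?_) hx
  · rw [← mul_assoc]
    exact Submodule.mul_mem_mul (mul_mem_kerPiA_right _ hu) (TensorRing.ι_mem v)
  · rw [mul_zero]; exact zero_mem _
  · rw [mul_add]; exact add_mem hx hy

/-- The letters of `x` are moved one by one from its right end into `u`, which stays in the left
ideal `I`, until a single letter remains. -/
theorem mul_mem_mul_kerPiA {n : ℕ} {u x : TA 𝒜} (hu : u ∈ kerPiA 𝒜)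
    (hx : x ∈ TAgrade 𝒜 (n + 1)) : x * u ∈ (TAgrade 𝒜 1).toZ * kerPiA 𝒜 := by
  induction n generalizing u x with
  | zero => exact Submodule.mul_mem_mul hx hu
  | succ n ih =>
    refine TensorRing.grade_succ_induction
      (p := fun x => x * u ∈ (TAgrade 𝒜 1).toZ * kerPiA 𝒜)
      (fun y v hy => ?_) ?_ (fun x y hx hy => ?_) hx
    · rw [mul_assoc]
      exact ih (mul_mem_kerPiA_left _ hu) hy
    · rw [zero_mul]; exact zero_mem _
    · rw [add_mul]; exact add_mem hx hy

theorem kerPiA_mul_induction {p : TA 𝒜 → Prop}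
    (mul_ι : ∀ u ∈ kerPiA 𝒜, ∀ v, p (u * TensorRing.ι S (𝒜 1) v))
    (add : ∀ x y, p x → p y → p (x + y)) {x : TA 𝒜}
    (hx : x ∈ kerPiA 𝒜 * (TAgrade 𝒜 1).toZ) : p x := by
  refine Submodule.mul_induction_on hx (fun u hu v hv => ?_) add
  obtain ⟨v, rfl⟩ := TensorRing.mem_grade_one hv
  exact mul_ι u hu v

variable [GradedRing 𝒜] [IsConnected 𝒜] {R : Subbimodule S (TA 𝒜)} {α : R →ₗ[Env S] TA 𝒜}

/-- If the relations of degree `N` produce no elements of unexpected degree, then the elements of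
the graph whose first component lies in `I V` are combinations of products with letters. -/
theorem IsBimoduleOfRelations.mem_letterGraph
    (hR : IsBimoduleOfRelations (TAgrade 𝒜) R (kerPiA 𝒜)) {N : ℕ}
    (h : ∀ y, (0, y) ∈ graph (TAgrade 𝒜) α N → y ∈ idealFilt (TAgrade 𝒜) α N)
    {z : TA 𝒜 × TA 𝒜} (hz : z ∈ graph (TAgrade 𝒜) α N)
    (hz1 : z.1 ∈ kerPiA 𝒜 * (TAgrade 𝒜 1).toZ) : z ∈ letterGraph α N := by
  cases N with
  | zero => rw [hR.graph_eq_zero (by omega) hz]; exact zero_mem _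
  | succ N =>
    obtain ⟨w, hw, hwH, hwz⟩ : ∃ w ∈ graph (TAgrade 𝒜) α (N + 1), w ∈ letterGraph α (N + 1) ∧
        w.1 = GradedRing.proj (TAgrade 𝒜) (N + 1) z.1 := by
      refine kerPiA_mul_induction (p := fun x => ∃ w ∈ graph (TAgrade 𝒜) α (N + 1),
        w ∈ letterGraph α (N + 1) ∧ w.1 = GradedRing.proj (TAgrade 𝒜) (N + 1) x)
        (fun u hu v => ?_) ?_ hz1
      · obtain ⟨g, hg, e⟩ := hR.exists_mem_graph α (proj_mem_kerPiA hu N) (proj_mem N u)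
        refine ⟨_, graph_mul_right (TensorRing.ι_mem v) hg, mul_ι_mem_letterGraph hg v, ?_⟩
        rw [proj_mul_right (TensorRing.ι_mem v), e]
      · rintro x y ⟨w, h1, h2, h3⟩ ⟨w', h1', h2', h3'⟩
        exact ⟨w + w', add_mem h1 h1', add_mem h2 h2', by rw [Prod.fst_add, h3, h3', map_add]⟩
    rw [proj_of_mem (fst_mem_of_mem_graph hz)] at hwz
    -- `w` ends with a letter and has the same first component as `z`; the difference is an
    -- obstruction in degree `N`, controlled by hypothesis.
    have h1 : z - w = (0, (z - w).2) := Prod.ext (by simp [hwz]) rfl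
    have h2 := sub_mem hz hw
    rw [h1] at h2
    have h3 := zero_mk_mem_letterGraph (h _ h2)
    rw [← h1] at h3
    simpa using add_mem h3 hwH

end Presentation

/-! ### Graded free modules -/

section FreeComp

variable {S T : Type*} [Ring S] [Ring T] [SRing S T] {𝒯 : ℕ → Subbimodule S T} [GradedRing 𝒯]
  {X : Type*}

variable (𝒯) in
/-- The homogeneous elements of degree `N` of the free module with basis `X`, where `x` has degree
`d x`. -/
def freeComp (d : X → ℕ) (N : ℕ) : AddSubgroup (X →₀ T) where
  carrier := {f | ∀ (x : X) (j : ℕ), j + d x ≠ N → GradedRing.proj 𝒯 j (f x) = 0}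
  zero_mem' := fun x j _ => map_zero _
  add_mem' := fun {f f'} hf hf' x j h => by
    rw [Finsupp.add_apply, map_add, hf x j h, hf' x j h, add_zero]
  neg_mem' := fun {f} hf x j h => by
    rw [Finsupp.neg_apply, map_neg, hf x j h, neg_zero]

theorem eq_zero_of_proj_eq_zero {x : T} (h : ∀ n, GradedRing.proj 𝒯 n x = 0) : x = 0 := by
  refine (DirectSum.decompose 𝒯).injective (DFinsupp.ext fun n => Subtype.ext ?_)
  rw [DirectSum.decompose_zero]
  exact h n

variable {d : X → ℕ} {N : ℕ} {f : X →₀ T}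

/-- When `d x > N` no degree is allowed and the coefficient is zero; otherwise only the degree `N -
d x` survives. -/
theorem freeComp_cases (hf : f ∈ freeComp 𝒯 d N) (x : X) :
    f x = 0 ∨ ∃ i, i + d x = N ∧ f x ∈ 𝒯 i := by
  rcases lt_or_ge N (d x) with h | h
  · exact Or.inl (eq_zero_of_proj_eq_zero (𝒯 := 𝒯) fun n => hf x n (by omega))
  · refine Or.inr ⟨N - d x, by omega, ?_⟩
    suffices h : f x - GradedRing.proj 𝒯 (N - d x) (f x) = 0 by
      rw [sub_eq_zero.1 h]; exact proj_mem _ _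
    refine eq_zero_of_proj_eq_zero (𝒯 := 𝒯) fun n => ?_
    rw [map_sub]
    rcases eq_or_ne (N - d x) n with rfl | hn
    · rw [proj_of_mem (proj_mem _ _), sub_self]
    · rw [proj_of_mem_ne (proj_mem _ _) hn, hf x n (by omega), sub_zero]

theorem mem_freeComp (h : ∀ x, f x = 0 ∨ ∃ i, i + d x = N ∧ f x ∈ 𝒯 i) : f ∈ freeComp 𝒯 d N := by
  intro x j hj
  rcases h x with h | ⟨i, hi, h⟩
  · rw [h, map_zero]
  · exact proj_of_mem_ne h (by rintro rfl; exact hj hi)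

theorem single_mem_freeComp {x : X} {i : ℕ} {t : T} (ht : t ∈ 𝒯 i) (h : i + d x = N) :
    Finsupp.single x t ∈ freeComp 𝒯 d N := by
  classical
  refine mem_freeComp fun y => ?_
  rcases eq_or_ne x y with rfl | hxy
  · rw [Finsupp.single_eq_same]; exact Or.inr ⟨i, h, ht⟩
  · exact Or.inl (Finsupp.single_eq_of_ne hxy.symm)

theorem smul_mem_freeComp {p : ℕ} {t : T} (ht : t ∈ 𝒯 p) (hf : f ∈ freeComp 𝒯 d N) :
    t • f ∈ freeComp 𝒯 d (p + N) := by
  refine mem_freeComp fun x => ?_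
  rw [Finsupp.smul_apply, smul_eq_mul]
  rcases freeComp_cases hf x with h | ⟨i, hi, h⟩
  · rw [h, mul_zero]; exact Or.inl rfl
  · exact Or.inr ⟨p + i, by omega, SetLike.GradedMul.mul_mem ht h⟩

theorem linearCombination_mem_of_freeComp {M : Type*} [AddCommGroup M] [Module T M] {v : X → M}
    (C : AddSubgroup M) (h : ∀ x i, i + d x = N → f x ∈ 𝒯 i → f x • v x ∈ C)
    (hf : f ∈ freeComp 𝒯 d N) : Finsupp.linearCombination T v f ∈ C := by
  rw [Finsupp.linearCombination_apply]
  refine sum_mem fun x _ => ?_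
  rcases freeComp_cases hf x with h0 | ⟨i, hi, hx⟩
  · simp only [h0, zero_smul]; exact zero_mem _
  · exact h x i hi hx

end FreeComp

/-! ### Reduction of coefficients from `T` to `A` in free modules. -/

section CoeffMap

variable {S : Type u} {A : Type v} [Ring S] [Ring A] [SRing S A]
  {𝒜 : ℕ → Subbimodule S A} {X : Type*}

variable (𝒜 X) in
/-- The reduction of coefficients `⨁ T → ⨁ A` of free modules. -/
noncomputable def coeffMap : (X →₀ TA 𝒜) →+ (X →₀ A) :=
  Finsupp.mapRange.addMonoidHom (piA 𝒜).toAddMonoidHom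

theorem coeffMap_apply (f : X →₀ TA 𝒜) (x : X) : coeffMap 𝒜 X f x = piA 𝒜 (f x) := rfl

theorem coeffMap_smul (t : TA 𝒜) (f : X →₀ TA 𝒜) :
    coeffMap 𝒜 X (t • f) = piA 𝒜 t • coeffMap 𝒜 X f := by
  ext x
  simp only [coeffMap_apply, Finsupp.smul_apply, smul_eq_mul, map_mul]

theorem coeffMap_single (x : X) (t : TA 𝒜) :
    coeffMap 𝒜 X (Finsupp.single x t) = Finsupp.single x (piA 𝒜 t) :=
  Finsupp.mapRange_single (hf := map_zero (piA 𝒜))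

theorem mem_kerPiA_of_coeffMap {f : X →₀ TA 𝒜} (h : coeffMap 𝒜 X f = 0) (x : X) :
    f x ∈ kerPiA 𝒜 := by
  rw [mem_kerPiA, ← coeffMap_apply, h]; rfl

/-- The reduction of coefficients is compatible with linear combinations. -/
theorem map_linearCombination {M N : Type*} [AddCommGroup M] [Module (TA 𝒜) M] [AddCommGroup N]
    [Module A N] (φ : M →+ N) (hφ : ∀ (t : TA 𝒜) m, φ (t • m) = piA 𝒜 t • φ m) {v : X → M}
    {w : X → N} (hvw : ∀ x, φ (v x) = w x) (f : X →₀ TA 𝒜) :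
    φ (Finsupp.linearCombination (TA 𝒜) v f) = Finsupp.linearCombination A w (coeffMap 𝒜 X f) := by
  induction f using Finsupp.induction_linear with
  | zero => simp only [map_zero]
  | add f g hf hg => simp only [map_add, hf, hg]
  | single x t =>
    rw [coeffMap_single, Finsupp.linearCombination_single, Finsupp.linearCombination_single, hφ,
      hvw]

variable [GradedRing 𝒜]

theorem coeffMap_mem {d : X → ℕ} {N : ℕ} {f : X →₀ TA 𝒜}
    (hf : f ∈ freeComp (TAgrade 𝒜) d N) : coeffMap 𝒜 X f ∈ freeComp 𝒜 d N := fun x j hj => by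
  rw [coeffMap_apply, ← piA_proj, hf x j hj, map_zero]

theorem exists_lift_freeComp [IsConnected 𝒜] (hA : IsStronglyGraded 𝒜) {d : X → ℕ} {N : ℕ} {f : X →₀ A}
    (hf : f ∈ freeComp 𝒜 d N) : ∃ g ∈ freeComp (TAgrade 𝒜) d N, coeffMap 𝒜 X g = f := by
  -- Zero coefficients are lifted to zero, so that the lifted family has finite support.
  have h : ∀ x, ∃ t : TA 𝒜, piA 𝒜 t = f x ∧ (f x = 0 → t = 0) ∧
      (t = 0 ∨ ∃ i, i + d x = N ∧ t ∈ TAgrade 𝒜 i) := by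
    intro x
    by_cases h0 : f x = 0
    · exact ⟨0, by rw [h0, map_zero], fun _ => rfl, Or.inl rfl⟩
    · obtain ⟨i, hi, hx⟩ := (freeComp_cases hf x).resolve_left h0
      obtain ⟨t, ht, e⟩ := exists_lift hA hx
      exact ⟨t, e, fun h => absurd h h0, Or.inr ⟨i, hi, ht⟩⟩
  choose t h1 h2 h3 using h
  have hfin : (Function.support t).Finite :=
    f.hasFiniteSupport.subset fun x hx h0 => hx (h2 x h0)
  exact ⟨Finsupp.ofSupportFinite t hfin, mem_freeComp h3, Finsupp.ext h1⟩

end CoeffMap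

/-! ### The comparison of the graph with the resolution -/

section Comparison

variable {S : Type u} {A : Type v} [Ring S] [Ring A] [SRing S A]
  {𝒜 : ℕ → Subbimodule S A} [GradedRing 𝒜] [IsConnected 𝒜]

variable (𝒜) in
/-- The basis of the module `F_1` of the resolution. -/
abbrev Gen₁ := (resolution 𝒜 0).Gen

variable (𝒜) in
/-- The basis of the module `F_2` of the resolution. -/
abbrev Gen₂ := ((resolution 𝒜 0).next 𝒜).Gen

/-- The element of `A` corresponding to an element of the basis of `F_1`. -/
def Gen₁.val (a : Gen₁ 𝒜) : A := a.2.1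

theorem Gen₁.val_mem (a : Gen₁ 𝒜) : a.val ∈ 𝒜 a.1 := a.2.2.1

theorem Gen₁.augmentation_val (a : Gen₁ 𝒜) : augmentation 𝒜 a.val = 0 := a.2.2.2

/-- The element of `F_1` corresponding to an element of the basis of `F_2`. -/
def Gen₂.val (b : Gen₂ 𝒜) : Gen₁ 𝒜 →₀ A := b.2.1

theorem Gen₂.val_mem (b : Gen₂ 𝒜) : b.val ∈ freeComp 𝒜 Sigma.fst b.1 := b.2.2.1

theorem Gen₂.cover_val (b : Gen₂ 𝒜) : Finsupp.linearCombination A Gen₁.val b.val = 0 := b.2.2.2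

variable {R : Subbimodule S (TA 𝒜)}

/-- Homogeneous lifts to `T` of the basis of `F_1` and to the graph of the basis of `F_2`. -/
structure Lifts (α : R →ₗ[Env S] TA 𝒜) where
  gen : Gen₁ 𝒜 → TA 𝒜
  gen_mem : ∀ a, gen a ∈ TAgrade 𝒜 a.1
  piA_gen : ∀ a, piA 𝒜 (gen a) = a.val
  cyc : Gen₂ 𝒜 → Gen₁ 𝒜 →₀ TA 𝒜
  coeffMap_cyc : ∀ b, coeffMap 𝒜 _ (cyc b) = b.val
  pair : Gen₂ 𝒜 → TA 𝒜 × TA 𝒜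
  pair_mem : ∀ b, pair b ∈ graph (TAgrade 𝒜) α b.1
  pair_fst : ∀ b, (pair b).1 = Finsupp.linearCombination (TA 𝒜) gen (cyc b)

/-- Strong grading lifts homogeneous elements of `A` to `T`. For a cycle of `F_1`, the lifted
combination maps to `0` in `A`, so it lies in `I` and is the first component of a pair in the graph.
-/
theorem exists_lifts (hA : IsStronglyGraded 𝒜)
    (hR : IsBimoduleOfRelations (TAgrade 𝒜) R (kerPiA 𝒜)) (α : R →ₗ[Env S] TA 𝒜) :
    Nonempty (Lifts α) := by
  choose gen gen_mem piA_gen using fun a : Gen₁ 𝒜 => exists_lift hA a.val_mem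
  choose cyc cyc_mem coeffMap_cyc using fun b : Gen₂ 𝒜 => exists_lift_freeComp hA b.val_mem
  have h : ∀ b, ∃ z ∈ graph (TAgrade 𝒜) α b.1,
      z.1 = Finsupp.linearCombination (TA 𝒜) gen (cyc b) := by
    intro b
    refine hR.exists_mem_graph α ?_ ?_
    · rw [mem_kerPiA]
      have := map_linearCombination (piA 𝒜).toAddMonoidHom (fun t m => map_mul (piA 𝒜) t m)
        piA_gen (cyc b)
      rw [coeffMap_cyc, b.cover_val] at this
      exact this
    · exact linearCombination_mem_of_freeComp (TAgrade 𝒜 b.1).toAddSubgroup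
        (fun a i hi ht => by
          have := SetLike.GradedMul.mul_mem ht (gen_mem a)
          rwa [hi] at this) (cyc_mem b)
  choose pair pair_mem pair_fst using h
  exact ⟨⟨gen, gen_mem, piA_gen, cyc, coeffMap_cyc, pair, pair_mem, pair_fst⟩⟩

theorem augmentation_of_mem {n : ℕ} (hn : n ≠ 0) {a : A} (ha : a ∈ 𝒜 n) :
    augmentation 𝒜 a = 0 :=
  (augmentation_eq_zero_iff a).2 (proj_of_mem_ne ha hn)

theorem augmentation_piA_of_mem_pos {x : TA 𝒜} (hx : x ∈ TensorRing.pos S (𝒜 1)) :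
    augmentation 𝒜 (piA 𝒜 x) = 0 := by
  refine TensorRing.pos_induction (p := fun x => augmentation 𝒜 (piA 𝒜 x) = 0)
    (fun y v => ?_) (by simp) (fun x y hx hy => ?_) hx
  · rw [map_mul, map_mul, piA_ι, augmentation_of_mem one_ne_zero v.2, mul_zero]
  · rw [map_add, map_add, hx, hy, add_zero]

variable {α : R →ₗ[Env S] TA 𝒜} (L : Lifts α)

/-- The linear combinations of the lifts of the basis of `F_1`. -/
noncomputable def Lifts.mu : (Gen₁ 𝒜 →₀ TA 𝒜) →ₗ[TA 𝒜] TA 𝒜 := Finsupp.linearCombination _ L.gen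

/-- The lift of the differential `F_2 → F_1`. -/
noncomputable def Lifts.nu : (Gen₂ 𝒜 →₀ TA 𝒜) →ₗ[TA 𝒜] (Gen₁ 𝒜 →₀ TA 𝒜) :=
  Finsupp.linearCombination _ L.cyc

/-- The linear combinations of the lifts of the basis of `F_2`. -/
noncomputable def Lifts.lam : (Gen₂ 𝒜 →₀ TA 𝒜) →ₗ[TA 𝒜] TA 𝒜 × TA 𝒜 :=
  Finsupp.linearCombination _ L.pair

/-- Indices of degree 0 do occur in the basis of `F_1`, but only for the element `0`, whose lift of
degree 0 is `0`. -/
theorem Lifts.gen_mem_pos (a : Gen₁ 𝒜) : L.gen a ∈ TensorRing.pos S (𝒜 1) := by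
  have h := L.gen_mem a
  rcases Nat.eq_zero_or_pos a.1 with h0 | h0
  · rw [h0] at h
    have h1 : a.val ∈ 𝒜 0 := h0 ▸ a.val_mem
    have h2 : a.val = 0 := by
      rw [← proj_of_mem h1]
      exact (augmentation_eq_zero_iff _).1 a.augmentation_val
    rw [eq_zero_of_mem_kerPiA_zero h (by rw [mem_kerPiA, L.piA_gen, h2])]
    exact zero_mem _
  · obtain ⟨n, hn⟩ := Nat.exists_eq_succ_of_ne_zero h0.ne'
    rw [hn] at h
    exact TensorRing.grade_succ_le_pos h

theorem Lifts.mu_mem {f : Gen₁ 𝒜 →₀ TA 𝒜} (h : coeffMap 𝒜 _ f = 0) :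
    L.mu f ∈ kerPiA 𝒜 * (TAgrade 𝒜 1).toZ := by
  rw [Lifts.mu, Finsupp.linearCombination_apply]
  exact sum_mem fun a _ => mul_mem_kerPiA_mul (mem_kerPiA_of_coeffMap h a) (L.gen_mem_pos a)

theorem Lifts.piA_mu (f : Gen₁ 𝒜 →₀ TA 𝒜) :
    piA 𝒜 (L.mu f) = Finsupp.linearCombination A Gen₁.val (coeffMap 𝒜 _ f) :=
  map_linearCombination (piA 𝒜).toAddMonoidHom (fun t m => map_mul (piA 𝒜) t m) L.piA_gen f

theorem Lifts.coeffMap_nu (f : Gen₂ 𝒜 →₀ TA 𝒜) :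
    coeffMap 𝒜 _ (L.nu f) = Finsupp.linearCombination A Gen₂.val (coeffMap 𝒜 _ f) :=
  map_linearCombination (coeffMap 𝒜 _) coeffMap_smul L.coeffMap_cyc f

/-- If `f` reduces to a cycle of `F_2`, then `ν(f)` has coefficients in `I` and this places the
first component of `λ(f)` in `I V`. -/
theorem Lifts.lam_fst (f : Gen₂ 𝒜 →₀ TA 𝒜) : (L.lam f).1 = L.mu (L.nu f) := by
  induction f using Finsupp.induction_linear with
  | zero => simp only [map_zero, Prod.fst_zero]
  | add f g hf hg => simp only [map_add, Prod.fst_add, hf, hg]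
  | single b t =>
    rw [Lifts.lam, Lifts.nu, Finsupp.linearCombination_single, Finsupp.linearCombination_single,
      map_smul, Prod.smul_fst, L.pair_fst]
    rfl

theorem Lifts.lam_mem {N : ℕ} {f : Gen₂ 𝒜 →₀ TA 𝒜} (hf : f ∈ freeComp (TAgrade 𝒜) Sigma.fst N) :
    L.lam f ∈ graph (TAgrade 𝒜) α N :=
  linearCombination_mem_of_freeComp _ (fun b _ hi ht => by
    have := graph_mul_left ht (L.pair_mem b)
    rwa [hi] at this) hf

/-- The elements with coefficients in `I` are trivial relations. -/
theorem Lifts.lam_mem_letterGraph (hR : IsBimoduleOfRelations (TAgrade 𝒜) R (kerPiA 𝒜))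
    (hα : IsFilteredMap (TAgrade 𝒜) α) {N : ℕ} {f : Gen₂ 𝒜 →₀ TA 𝒜}
    (hf : f ∈ freeComp (TAgrade 𝒜) Sigma.fst N) (h : coeffMap 𝒜 _ f = 0) :
    L.lam f ∈ letterGraph α N := by
  refine linearCombination_mem_of_freeComp _ (fun b i hi ht => ?_) hf
  have hz := L.pair_mem b
  obtain ⟨w, hw, hwf⟩ := hR.exists_mem_graph α (mem_kerPiA_of_coeffMap h b) ht
  rw [← hwf]
  rcases Nat.eq_zero_or_pos b.1 with h0 | h0
  · rw [hR.graph_eq_zero (by omega) hz, smul_zero]; exact zero_mem _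
  · obtain ⟨n, hn⟩ := Nat.exists_eq_succ_of_ne_zero h0.ne'
    have hx := fst_mem_of_mem_graph hz
    have h1 := hα.graph_comm hw hz
    rw [hi] at h1
    rw [hn] at hx hi
    -- In the pair `w.1 • z` the second component `w.1 * z.2` is traded for `w.2 * z.1`, at the cost
    -- of a term of lower filtration by `graph_comm`; now the positive factor `z.1` is on the right.
    have h2 := graph_mul_mem_letterGraph hw hx
    rw [show i + n + 1 = N by omega] at h2
    have h3 := add_mem h2 (zero_mk_mem_letterGraph h1)
    rwa [Prod.mk_add_mk, add_zero, add_sub_cancel] at h3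

/-- An element of degree one, as an element of the basis of `F_1`. -/
def letterGen (v : 𝒜 1) : Gen₁ 𝒜 := ⟨1, (v : A), v.2, augmentation_of_mem one_ne_zero v.2⟩

theorem Lifts.gen_letterGen (v : 𝒜 1) : L.gen (letterGen v) = TensorRing.ι S (𝒜 1) v := by
  refine sub_eq_zero.1 (eq_zero_of_mem_kerPiA_one
    (sub_mem (L.gen_mem (letterGen v)) (TensorRing.ι_mem v)) ?_)
  rw [mem_kerPiA, map_sub, L.piA_gen, piA_ι, sub_eq_zero]; rfl

variable {F : 𝒜 1 →+ 𝒜 1 →₀ S} (hF : TensorRing.IsDualBasis F)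

/-- The map `T⁺ → F_1` with `y v ↦ ∑ y F(v)_w e_w`, with coefficients in `T`. -/
noncomputable def toFree : TA 𝒜 →+ (Gen₁ 𝒜 →₀ TA 𝒜) :=
  (Finsupp.mapDomain.addMonoidHom letterGen).comp (TensorRing.coords hF)

theorem toFree_mem {n : ℕ} {x : TA 𝒜} (hx : x ∈ TAgrade 𝒜 (n + 1)) :
    toFree hF x ∈ freeComp (TAgrade 𝒜) Sigma.fst (n + 1) := by
  show Finsupp.mapDomain letterGen (TensorRing.coords hF x) ∈ _
  refine sum_mem fun w _ => single_mem_freeComp (TensorRing.coords_mem hF hx w) rfl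

theorem toFree_mul (t : TA 𝒜) {x : TA 𝒜} (hx : x ∈ TensorRing.pos S (𝒜 1)) :
    toFree hF (t * x) = t • toFree hF x := by
  show Finsupp.mapDomain letterGen (TensorRing.coords hF (t * x)) = _
  rw [TensorRing.coords_mul hF t hx, Finsupp.mapDomain_smul]; rfl

theorem Lifts.mu_toFree {x : TA 𝒜} (hx : x ∈ TensorRing.pos S (𝒜 1)) :
    L.mu (toFree hF x) = x := by
  refine (Finsupp.linearCombination_mapDomain _ _ _).trans ?_
  rw [show L.gen ∘ letterGen = TensorRing.ι S (𝒜 1) from funext L.gen_letterGen]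
  exact TensorRing.linearCombination_coords hF hx

theorem coeffMap_toFree {x : TA 𝒜} (hx : x ∈ kerPiA 𝒜 * (TAgrade 𝒜 1).toZ) :
    coeffMap 𝒜 _ (toFree hF x) = 0 := by
  have h : coeffMap 𝒜 _ (TensorRing.coords hF x) = 0 := by
    refine kerPiA_mul_induction (p := fun x => coeffMap 𝒜 _ (TensorRing.coords hF x) = 0)
      (fun u hu v => ?_) (fun x y hx hy => by rw [map_add, map_add, hx, hy, add_zero]) hx
    ext w
    rw [coeffMap_apply, TensorRing.coords_mul_ι, map_mul, mem_kerPiA.1 hu, zero_mul]; rfl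
  refine (Finsupp.mapDomain_mapRange _ _ _ (map_zero (piA 𝒜)) (map_add _)).symm.trans ?_
  exact (congrArg (Finsupp.mapDomain letterGen) h).trans Finsupp.mapDomain_zero

end Comparison

/-! ### Relations in the degrees where the torsion vanishes -/

section TorStep

variable {S : Type u} {A : Type v} [Ring S] [Ring A] [SRing S A]
  {𝒜 : ℕ → Subbimodule S A} [GradedRing 𝒜] [IsConnected 𝒜] {R : Subbimodule S (TA 𝒜)}
  {α : R →ₗ[Env S] TA 𝒜} {F : 𝒜 1 →+ 𝒜 1 →₀ S}

/-- The coordinates of `r`, reduced to `A`, form a cycle of `F_1` because `π_A(r) = 0`. -/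
theorem IsBimoduleOfRelations.exists_gen₂
    (hR : IsBimoduleOfRelations (TAgrade 𝒜) R (kerPiA 𝒜)) (L : Lifts α)
    (hF : TensorRing.IsDualBasis F) {n : ℕ} {r : R} (hr : (r : TA 𝒜) ∈ TAgrade 𝒜 (n + 1)) :
    ∃ b : Gen₂ 𝒜, b.1 = n + 1 ∧ b.val = coeffMap 𝒜 _ (toFree hF r) := by
  refine ⟨⟨n + 1, coeffMap 𝒜 _ (toFree hF r), coeffMap_mem (toFree_mem hF hr), ?_⟩, rfl, rfl⟩
  refine (L.piA_mu _).symm.trans ?_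
  rw [L.mu_toFree hF (TensorRing.grade_succ_le_pos hr)]
  exact hR.mem_kerPiA r.2

/-- Modulo relations ending with a letter, every relation comes from `R` and from `F_2`. -/
theorem Lifts.exists_decomposition (hR : IsBimoduleOfRelations (TAgrade 𝒜) R (kerPiA 𝒜))
    (L : Lifts α) (hF : TensorRing.IsDualBasis F) {N : ℕ}
    (hC : ∀ m < N, ∀ z ∈ graph (TAgrade 𝒜) α m, z.1 ∈ kerPiA 𝒜 * (TAgrade 𝒜 1).toZ →
      z ∈ letterGraph α m)
    {z : TA 𝒜 × TA 𝒜} (hz : z ∈ graph (TAgrade 𝒜) α N) :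
    ∃ r : R, ∃ f ∈ freeComp (TAgrade 𝒜) Sigma.fst N, (∀ b, f b ∈ TensorRing.pos S (𝒜 1)) ∧
      coeffMap 𝒜 _ (L.nu f) = coeffMap 𝒜 _ (toFree hF (z.1 - r)) ∧
      z - ((r : TA 𝒜), α r) - L.lam f ∈ letterGraph α N ∧
      z.1 - r ∈ kerPiA 𝒜 * (TAgrade 𝒜 1).toZ + (TAgrade 𝒜 1).toZ * kerPiA 𝒜 := by
  refine graph_induction (p := fun z : TA 𝒜 × TA 𝒜 => ∃ r : R,
    ∃ f ∈ freeComp (TAgrade 𝒜) Sigma.fst N, (∀ b, f b ∈ TensorRing.pos S (𝒜 1)) ∧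
      coeffMap 𝒜 _ (L.nu f) = coeffMap 𝒜 _ (toFree hF (z.1 - r)) ∧
      z - ((r : TA 𝒜), α r) - L.lam f ∈ letterGraph α N ∧
      z.1 - r ∈ kerPiA 𝒜 * (TAgrade 𝒜 1).toZ + (TAgrade 𝒜 1).toZ * kerPiA 𝒜)
    (fun i j k h t ht r hr t' ht' => ?_) ?_ ?_ hz
  -- A right factor of positive degree makes the term end with a letter. A scalar right factor is
  -- absorbed in `r`; then a scalar left factor gives an element of `R`, and a left factor `t` of
  -- positive degree gives `t` times a basis element of `F_2`.
  · cases k with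
    | succ k =>
      have hpos := TensorRing.grade_succ_le_pos ht'
      have h1 := graph_mul_mem_letterGraph (mem_graph (α := α) rfl ht hr
        (SetLike.GradedOne.one_mem (A := TAgrade 𝒜))) ht'
      rw [show i + j + 0 + k + 1 = N by omega] at h1
      simp only [mul_one] at h1
      have h2 : t * r * t' ∈ kerPiA 𝒜 * (TAgrade 𝒜 1).toZ :=
        mul_mem_kerPiA_mul (mul_mem_kerPiA_left t (hR.mem_kerPiA r.2)) hpos
      refine ⟨0, 0, zero_mem _, fun b => zero_mem _, ?_, ?_, ?_⟩
      · rw [Submodule.coe_zero, sub_zero, coeffMap_toFree hF h2, map_zero, map_zero]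
      · rw [Submodule.coe_zero, map_zero, map_zero, sub_zero]
        rw [show ((0 : TA 𝒜), (0 : TA 𝒜)) = 0 from rfl, sub_zero]
        exact h1
      · rw [Submodule.coe_zero, sub_zero]
        exact Submodule.mem_sup_left h2
    | zero =>
      obtain ⟨s', rfl⟩ := (IsConnected.mem_zero_iff (𝒯 := TAgrade 𝒜) t').1 ht'
      obtain ⟨r', hr', e1, e2⟩ : ∃ r' : R, (r' : TA 𝒜) ∈ TAgrade 𝒜 j ∧
          (r' : TA 𝒜) = r * SRing.unit s' ∧ α r' = α r * SRing.unit s' := by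
        have e1 : ((Env.tmul 1 s' • r : R) : TA 𝒜) = r * SRing.unit s' := by
          rw [Submodule.coe_smul, env_smul_def, map_one, one_mul]
        refine ⟨Env.tmul 1 s' • r, ?_, e1, ?_⟩
        · rw [e1]; exact TensorRing.mul_unit_mem s' hr
        · rw [map_smul, env_smul_def, map_one, one_mul]
      rw [mul_assoc, mul_assoc, ← e1, ← e2]
      cases i with
      | zero =>
        obtain ⟨s, rfl⟩ := (IsConnected.mem_zero_iff (𝒯 := TAgrade 𝒜) t).1 ht
        refine ⟨Env.tmul s 1 • r', 0, zero_mem _, fun b => zero_mem _, ?_⟩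
        have e3 : ((Env.tmul s 1 • r' : R) : TA 𝒜) = SRing.unit s * r' := by
          rw [Submodule.coe_smul, env_smul_def, map_one, mul_one]
        have e4 : α (Env.tmul s 1 • r') = SRing.unit s * α r' := by
          rw [map_smul, env_smul_def, map_one, mul_one]
        simp only [e3, e4, sub_self, map_zero]
        exact ⟨trivial, zero_mem _, zero_mem _⟩
      | succ i =>
        cases j with
        | zero =>
          have : r' = 0 := Subtype.ext (hR.two_le (by omega) r'.2 hr')
          refine ⟨0, 0, zero_mem _, fun b => zero_mem _, ?_⟩
          simp only [this, Submodule.coe_zero, mul_zero, map_zero, sub_self]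
          exact ⟨trivial, zero_mem _, zero_mem _⟩
        | succ j =>
          obtain ⟨b, hb, hbv⟩ := hR.exists_gen₂ L hF hr'
          have hrpos := TensorRing.grade_succ_le_pos hr'
          refine ⟨0, Finsupp.single b t, single_mem_freeComp ht (by omega), fun b' => ?_, ?_, ?_, ?_⟩
          · classical
            rw [Finsupp.single_apply]
            split_ifs
            · exact TensorRing.grade_succ_le_pos ht
            · exact zero_mem _
          · rw [L.coeffMap_nu, coeffMap_single, Finsupp.linearCombination_single, hbv,
              Submodule.coe_zero, sub_zero, toFree_mul hF t hrpos, coeffMap_smul]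
          -- The pair of `r'` and the chosen lift of its cycle agree modulo coefficients in `I`, so
          -- their difference has first component in `I V`. Its degree `j + 1` is less than `N`, so
          -- `hC` applies.
          · have h1 : ((r' : TA 𝒜), α r') - L.pair b ∈ graph (TAgrade 𝒜) α (j + 1) := by
              refine sub_mem ?_ (hb ▸ L.pair_mem b)
              have := mem_graph (α := α) (show 0 + (j + 1) + 0 = j + 1 by omega)
                (SetLike.GradedOne.one_mem (A := TAgrade 𝒜)) hr' SetLike.GradedOne.one_mem
              simpa using this
            have h2 : (((r' : TA 𝒜), α r') - L.pair b).1 ∈ kerPiA 𝒜 * (TAgrade 𝒜 1).toZ := by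
              have h3 : (((r' : TA 𝒜), α r') - L.pair b).1 = L.mu (toFree hF r' - L.cyc b) := by
                rw [map_sub, L.mu_toFree hF hrpos, Prod.fst_sub, L.pair_fst]; rfl
              rw [h3]
              refine L.mu_mem ?_
              rw [map_sub, L.coeffMap_cyc, hbv, sub_self]
            have h3 := letterGraph_mul_left ht (hC (j + 1) (by omega) _ h1 h2)
            rw [show i + 1 + (j + 1) = N by omega] at h3
            rw [Lifts.lam, Finsupp.linearCombination_single, map_zero, Submodule.coe_zero,
              show ((0 : TA 𝒜), (0 : TA 𝒜)) = 0 from rfl, sub_zero]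
            rw [smul_sub] at h3
            exact h3
          · rw [Submodule.coe_zero, sub_zero]
            exact Submodule.mem_sup_right (mul_mem_mul_kerPiA (hR.mem_kerPiA r'.2) ht)
  · refine ⟨0, 0, zero_mem _, fun b => zero_mem _, ?_⟩
    simp only [Submodule.coe_zero, map_zero, sub_self, Prod.fst_zero, Prod.mk_zero_zero]
    exact ⟨trivial, zero_mem _, zero_mem _⟩
  · rintro x y ⟨r, f, h1, h2, h3, h4, h5⟩ ⟨r', f', h1', h2', h3', h4', h5'⟩
    refine ⟨r + r', f + f', add_mem h1 h1', fun b => add_mem (h2 b) (h2' b), ?_, ?_, ?_⟩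
    · rw [map_add, map_add, h3, h3', ← map_add, ← map_add, Prod.fst_add, Submodule.coe_add,
        add_sub_add_comm]
    · have e : x + y - (((r + r' : R) : TA 𝒜), α (r + r')) - L.lam (f + f') =
          (x - ((r : TA 𝒜), α r) - L.lam f) + (y - ((r' : TA 𝒜), α r') - L.lam f') := by
        rw [map_add, map_add, Submodule.coe_add, ← Prod.mk_add_mk]
        abel
      rw [e]
      exact add_mem h4 h4'
    · rw [Prod.fst_add, Submodule.coe_add, add_sub_add_comm]
      exact add_mem h5 h5'

/-- The combinations of cycles with coefficients of positive degree lift to the part of the graph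
ending with a letter. -/
theorem Lifts.exists_lift_augMulComp (hA : IsStronglyGraded 𝒜) (L : Lifts α) {N : ℕ}
    (hC : ∀ m < N, ∀ z ∈ graph (TAgrade 𝒜) α m, z.1 ∈ kerPiA 𝒜 * (TAgrade 𝒜 1).toZ →
      z ∈ letterGraph α m)
    {x : Gen₂ 𝒜 →₀ A}
    (hx : x ∈ augMulComp 𝒜 (freeComp 𝒜 Sigma.fst)
      (LinearMap.ker (Finsupp.linearCombination A (Gen₂.val (𝒜 := 𝒜)))) N) :
    ∃ f ∈ freeComp (TAgrade 𝒜) Sigma.fst N, L.lam f ∈ letterGraph α N ∧ coeffMap 𝒜 _ f = x := by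
  let G := (freeComp (TAgrade 𝒜) (Sigma.fst : Gen₂ 𝒜 → ℕ) N ⊓
    (letterGraph α N).comap L.lam.toAddMonoidHom).map (coeffMap 𝒜 (Gen₂ 𝒜))
  suffices h : augMulComp 𝒜 (freeComp 𝒜 Sigma.fst)
      (LinearMap.ker (Finsupp.linearCombination A (Gen₂.val (𝒜 := 𝒜)))) N ≤ G by
    obtain ⟨f, hf, e⟩ := h hx
    exact ⟨f, hf.1, hf.2, e⟩
  refine (AddSubgroup.closure_le _).2 ?_
  rintro _ ⟨p, q, hN, hp, a, ha, y, hy, hyZ, rfl⟩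
  obtain ⟨t, ht, rfl⟩ := exists_lift hA ha
  obtain ⟨g, hg, rfl⟩ := exists_lift_freeComp hA hy
  subst hN
  refine ⟨t • g, ⟨smul_mem_freeComp ht hg, ?_⟩, coeffMap_smul t g⟩
  show L.lam (t • g) ∈ letterGraph α (p + q)
  rw [map_smul]
  -- The coefficient has degree `p > 0`, so the cycle has degree `q < N`.
  refine letterGraph_mul_left ht (hC q (by omega) _ (L.lam_mem hg) ?_)
  rw [L.lam_fst]
  exact L.mu_mem ((L.coeffMap_nu g).trans hyZ)

/-- If `Tor_{3,N}` vanishes, then the relations of degree `N` are consequences of the relations of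
smaller degree. -/
theorem mem_letterGraph_of_subsingleton_tor (hA : IsStronglyGraded 𝒜)
    (hR : IsBimoduleOfRelations (TAgrade 𝒜) R (kerPiA 𝒜)) (hα : IsFilteredMap (TAgrade 𝒜) α)
    (hF : TensorRing.IsDualBasis F) {N : ℕ} (hT : Subsingleton (Tor 𝒜 3 N))
    (hC : ∀ m < N, ∀ z ∈ graph (TAgrade 𝒜) α m, z.1 ∈ kerPiA 𝒜 * (TAgrade 𝒜 1).toZ →
      z ∈ letterGraph α m)
    {z : TA 𝒜 × TA 𝒜} (hz : z ∈ graph (TAgrade 𝒜) α N)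
    (hz1 : z.1 ∈ kerPiA 𝒜 * (TAgrade 𝒜 1).toZ) : z ∈ letterGraph α N := by
  obtain ⟨L⟩ := exists_lifts hA hR α
  obtain ⟨r, f, hf, hfpos, hfnu, hfz, hr⟩ := L.exists_decomposition hR hF hC hz
  -- Both `z.1` and `z.1 - r` lie in `I V + V I`, which meets `R` trivially.
  have hr0 : r = 0 := by
    refine Subtype.ext (hR.eq_zero_of_mem r.2 ?_)
    have := sub_mem (Submodule.mem_sup_left hz1) hr
    rwa [sub_sub_cancel] at this
  rw [hr0, Submodule.coe_zero, sub_zero, coeffMap_toFree hF hz1, L.coeffMap_nu] at hfnu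
  rw [hr0, Submodule.coe_zero, map_zero, Prod.mk_zero_zero, sub_zero] at hfz
  have haug : coeffMap 𝒜 _ f ∈ augMul 𝒜 (⊤ : Submodule A (Gen₂ 𝒜 →₀ A)) := by
    rw [← Finsupp.sum_single (coeffMap 𝒜 _ f)]
    refine sum_mem fun b _ => AddSubgroup.subset_closure ⟨coeffMap 𝒜 _ f b, ?_,
      Finsupp.single b 1, trivial, by simp⟩
    exact augmentation_piA_of_mem_pos (hfpos b)
  have hmem : coeffMap 𝒜 _ f ∈ augMulComp 𝒜 (freeComp 𝒜 Sigma.fst)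
      (LinearMap.ker (Finsupp.linearCombination A (Gen₂.val (𝒜 := 𝒜)))) N :=
    mem_augMulComp_of_subsingleton_tor (i := 2) hT (coeffMap_mem hf) hfnu haug
  obtain ⟨g, hg, hgz, hgf⟩ := L.exists_lift_augMulComp hA hC hmem
  -- `f` and `g` have the same reduction, so `f - g` has coefficients in `I` and contributes only
  -- trivial relations.
  have h1 := L.lam_mem_letterGraph hR hα (sub_mem hf hg) (by rw [map_sub, hgf, sub_self])
  rw [map_sub] at h1
  simpa using add_mem hfz (add_mem h1 hgz)

end TorStep

/-! ### From the Jacobi conditions up to the complexity to a PBW-deformation. -/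

section Backward

variable {S : Type u} {A : Type v} [Ring S] [Ring A] [SRing S A]
  {𝒜 : ℕ → Subbimodule S A} [GradedRing 𝒜] [IsConnected 𝒜] {R : Subbimodule S (TA 𝒜)}
  {α : R →ₗ[Env S] TA 𝒜}

/-- Nonvanishing of `Tor_{3,k+1}` gives `0 ≤ k ≤ c(A)`, which excludes `c(A) = -1` and puts `k` in
the assumed range. -/
theorem jacobi_of_complexity
    (hJ : complexity 𝒜 = -1 ∨ ∀ k : ℕ, 1 ≤ k → (k : EReal) ≤ complexity 𝒜 →
      Jacobi (TAgrade 𝒜) (LinearMap.range α) k) {k : ℕ} (hk : 1 ≤ k)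
    (hT : ¬ Subsingleton (Tor 𝒜 3 (k + 1))) : Jacobi (TAgrade 𝒜) (LinearMap.range α) k := by
  have hle : (k : EReal) ≤ complexity 𝒜 := by
    rw [complexity, if_neg fun h => hT (h _)]
    have h1 : (k : EReal) = ((k + 1 : ℕ) : EReal) - 1 := by
      have : ((k : ℝ) : EReal) = (((k + 1 : ℕ) : ℝ) - (1 : ℝ) : ℝ) := by
        congr 1; push_cast; ring
      rw [EReal.coe_sub] at this
      exact this
    rw [h1]
    exact le_iSup₂ (f := fun (n : ℕ) (_ : Nontrivial (Tor 𝒜 3 n)) => (n : EReal) - 1) (k + 1)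
      (not_subsingleton_iff_nontrivial.1 hT)
  rcases hJ with h | h
  · rw [h] at hle
    have h1 : (0 : EReal) ≤ k := by exact_mod_cast k.zero_le
    have h2 : (-1 : EReal) < 0 := by
      rw [EReal.neg_lt_comm, neg_zero]; exact zero_lt_one
    exact absurd (h1.trans hle) (not_le.2 h2)
  · exact h k hk hle

/-- Under the Jacobi conditions up to the homological complexity, no relation produces elements of
unexpected degree. -/
theorem graph_relations (hA : IsStronglyGraded 𝒜)
    (hR : IsBimoduleOfRelations (TAgrade 𝒜) R (kerPiA 𝒜)) (hA1 : LeftProjective S (𝒜 1))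
    (hα : IsFilteredMap (TAgrade 𝒜) α)
    (hJ : complexity 𝒜 = -1 ∨ ∀ k : ℕ, 1 ≤ k → (k : EReal) ≤ complexity 𝒜 →
      Jacobi (TAgrade 𝒜) (LinearMap.range α) k) (N : ℕ) :
    ∀ y, (0, y) ∈ graph (TAgrade 𝒜) α N → y ∈ idealFilt (TAgrade 𝒜) α N := by
  obtain ⟨F, hF⟩ := TensorRing.exists_isDualBasis hA1
  induction N using Nat.strong_induction_on with
  | _ N ih =>
  rcases lt_or_ge N 2 with h2 | h2
  · intro y hy
    have := congrArg Prod.snd (hR.graph_eq_zero h2 hy)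
    rw [show y = 0 from this]
    exact zero_mem _
  · obtain ⟨k, rfl⟩ : ∃ k, N = k + 1 := ⟨N - 1, by omega⟩
    by_cases hT : Subsingleton (Tor 𝒜 3 (k + 1))
    · intro y hy
      refine mem_idealFilt_of_mem_letterGraph hF (ih k k.lt_succ_self) ?_
      exact mem_letterGraph_of_subsingleton_tor hA hR hα hF hT
        (fun m hm z hz hz1 => hR.mem_letterGraph (ih m hm) hz hz1) hy (zero_mem _)
    · exact (hα.jacobi_iff hR.graded).1 (jacobi_of_complexity hJ (by omega) hT)

/-- In an expression of `z` by terms of degree greater than `n`, the terms of highest degree have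
first components summing to `0`, so they can be replaced by terms of lower degree. At degree `n`
itself, the sum of the first components is the component of `z`. -/
theorem proj_mem_of_graph_relations (hR : IsBimoduleOfRelations (TAgrade 𝒜) R (kerPiA 𝒜))
    (hα : IsFilteredMap (TAgrade 𝒜) α)
    (h : ∀ N y, (0, y) ∈ graph (TAgrade 𝒜) α N → y ∈ idealFilt (TAgrade 𝒜) α N)
    {n : ℕ} {z : TA 𝒜} (hz : z ∈ lowerDeg (TAgrade 𝒜) (n + 1))
    (hzα : z ∈ ideal (LinearMap.range α)) : GradedRing.proj (TAgrade 𝒜) n z ∈ ideal R := by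
  have key : ∀ m, z ∈ idealFilt (TAgrade 𝒜) α (n + 1 + m) →
      z ∈ idealFilt (TAgrade 𝒜) α (n + 1) := by
    intro m
    induction m with
    | zero => exact id
    | succ m ih =>
      intro hm
      obtain ⟨w, hw, hzw⟩ := exists_graph_add_of_mem_idealFilt (n := n + 1 + m) hm
      have h1 : w.1 = 0 := by
        have h2 := proj_lowerDeg le_rfl (hα.idealFilt_le hzw)
        rw [map_sub, proj_lowerDeg (Nat.le_add_right _ _) hz, zero_sub, neg_eq_zero] at h2
        have h3 := proj_lowerDeg le_rfl (hα.graph_sub_mem hw)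
        rwa [map_sub, h2, sub_zero, proj_of_mem (fst_mem_of_mem_graph hw)] at h3
      have h2 := h _ w.2 (by rw [← h1]; exact hw)
      exact ih (by simpa using add_mem hzw h2)
  obtain ⟨m, hm⟩ := hα.exists_mem_idealFilt hR.graded hzα
  obtain ⟨w, hw, hzw⟩ := exists_graph_add_of_mem_idealFilt
    (key m (idealFilt_mono (by omega) hm))
  have h1 := proj_lowerDeg le_rfl (hα.idealFilt_le hzw)
  have h2 := proj_lowerDeg le_rfl (hα.graph_sub_mem hw)
  rw [map_sub, sub_eq_zero] at h1 h2
  rw [h1, ← h2, proj_of_mem (fst_mem_of_mem_graph hw), hR.mem_ideal_iff]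
  exact hR.graph_fst_mem hw

end Backward
end PBW

theorem mainTheorem3 {S : Type u} {A : Type v} [Ring S] [Ring A] [SRing S A]
    (𝒜 : ℕ → Subbimodule S A) [GradedRing 𝒜] [IsConnected 𝒜] (hA : IsStronglyGraded 𝒜)
    (R P : Subbimodule S (TA 𝒜))
    (hR : IsBimoduleOfRelations (TAgrade 𝒜) R (kerPiA 𝒜))
    (hRP : R ≤ leading (TAgrade 𝒜) P)
    (hA1 : LeftProjective S (𝒜 1)) (hRproj : LeftProjective S R)
    (hRPproj : Module.Projective (Env S) (leading (TAgrade 𝒜) P)) :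
    IsPBWDeformation (TAgrade 𝒜) P R hRP ↔
      ideal R = ideal (leading (TAgrade 𝒜) P) ∧
      ∃ α : R →ₗ[Env S] TA 𝒜, IsFilteredMap (TAgrade 𝒜) α ∧
        LinearMap.range α ≤ P ∧ (∀ x ∈ P, x ∈ ideal (LinearMap.range α)) ∧
        (complexity 𝒜 = -1 ∨ ∀ k : ℕ, 1 ≤ k → (k : EReal) ≤ complexity 𝒜 →
          Jacobi (TAgrade 𝒜) (LinearMap.range α) k) := by
  constructor
  · intro h
    obtain ⟨h1, α, hα, hαP, hPα, hJ⟩ := exists_filteredMap_of_isPBWDeformation hR hRP hRPproj h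
    -- All Jacobi conditions hold here, so the bound by the complexity plays no role in this
    -- direction.
    exact ⟨h1, α, hα, hαP, hPα, Or.inr fun k _ _ => hJ k⟩
  · rintro ⟨-, α, hα, hαP, hPα, hJ⟩
    refine (isPBWDeformation_iff hRP).2 fun n z hz hzP => ?_
    exact proj_mem_of_graph_relations hR hα (graph_relations hA hR hA1 hα hJ) hz
      (TwoSidedIdeal.span_le.2 hPα hzP)
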